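/- Let $p$ be a prime and let $\mathcal{O}$ be a complete local principal ideal domain whose residue field has characteristic $p$ (the case where $\mathcal{O}$ is a field is allowed). An $\mathcal{O}$-algebra $A$ is called symmetric if it is free of finite rank as an $\mathcal{O}$-module and isomorphic to $\mathrm{Hom}_{\mathcal{O}}(A,\mathcal{O})$ as an $A$-$A$-bimodule. A Rickard equivalence between two $\mathcal{O}$-algebras $E$ and $F$ consists of a bounded complex $M$ of $E$-$F$-bimodules and a bounded complex $N$ of $F$-$E$-bimodules, whose terms are finitely generated projective as left and as right modules, such that $M\otimes_F N\simeq E$ and $N\otimes_E M\simeq F$ are homotopy equivalent as complexes of $E$-$E$-bimodules and of $F$-$F$-bimodules, respectively. Modules are left modules unless stated otherwise, and $\mathrm{mod}(A)$ is the category of finitely generated $A$-modules. Let $A$ and $B$ be symmetric $\mathcal{O}$-algebras, let $X$ be a finitely generated $\mathcal{O}$-free $A$-module and $Y$ a finitely generated $\mathcal{O}$-free $B$-module. Suppose that $A$ is isomorphic to a direct summand of $X$ as an $A$-module and that $B$ is isomorphic to a direct summand of $Y$ as a $B$-module. Set $E=\mathrm{End}_A(X)$ and $F=\mathrm{End}_B(Y)$,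 and let $(M,N)$ be a Rickard equivalence between $E$ and $F$. Then there are idempotents $e\in E$ and $f\in F$ with $e(X)\cong A$ as $A$-modules and $f(Y)\cong B$ as $B$-modules. For all such idempotents $e$, $f$ and all isomorphisms $e(X)\cong A$, $f(Y)\cong B$, the following hold. (i) The functors $eMf\otimes_{fFf}-$ and $fNe\otimes_{eEe}-$ on complexes of finitely generated modules induce mutually inverse triangulated equivalences between the derived categories $D(\mathrm{mod}(fFf))$ and $D(\mathrm{mod}(eEe))$, which restrict to equivalences between $D^b(\mathrm{mod}(fFf))$ and $D^b(\mathrm{mod}(eEe))$. (ii) The algebras $A$ and $B$ are derived equivalent: through the isomorphisms $eEe\cong \mathrm{End}_A(A)\cong A^{\mathrm{op}}$ and $fFf\cong \mathrm{End}_B(B)\cong B^{\mathrm{op}}$ induced by $e(X)\cong A$ and $f(Y)\cong B$, regard $eMf$ as a complex of $B$-$A$-bimodules and $fNe$ as a complex of $A$-$B$-bimodules. Then the functors $eMf\otimes_A-$ and $fNe\otimes_B-$ on complexes of finitely generated modules induce mutually inverse triangulated equivalences between $D(\mathrm{mod}(A))$ and $D(\mathrm{mod}(B))$, which restrict to equivalences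 between $D^b(\mathrm{mod}(A))$ and $D^b(\mathrm{mod}(B))$. -/

import Mathlib

open CategoryTheory MulOpposite
open scoped TensorProduct

universe u

noncomputable section

/-! ### Symmetric algebras and direct summands -/

/-- An `O`-algebra `A` is symmetric if it is free of finite rank as an `O`-module and isomorphic
to its `O`-dual `Hom_O(A, O)` as an `A`-`A`-bimodule, the bimodule structure of the dual being
`(a · ψ · b)(c) = ψ (b * c * a)`. -/
class IsSymmetricOverBase (O A : Type*) [CommRing O] [Ring A] [Algebra O A] : Prop
    extends Module.Free O A, Module.Finite O A where
  exists_bimodule_iso : ∃ φ : A ≃ₗ[O] Module.Dual O A,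
    ∀ a x b c : A, φ (a * x * b) c = φ x (b * c * a)

/-- `U` is isomorphic to a direct summand of `V`. -/
def IsIsoToDirectSummand (A U V : Type*) [Ring A] [AddCommGroup U] [Module A U]
    [AddCommGroup V] [Module A V] : Prop :=
  ∃ (i : U →ₗ[A] V) (p : V →ₗ[A] U), p ∘ₗ i = LinearMap.id

/-! ### Tensor products over a noncommutative algebra -/

section BalancedTensor

variable (O S : Type u) [CommRing O] [Ring S]

/-- The relations `(m · s) ⊗ n = m ⊗ (s · n)`. -/
def balancedRel (M N : Type u) [AddCommGroup M] [Module O M] [Module Sᵐᵒᵖ M]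
    [AddCommGroup N] [Module O N] [Module S N] : Submodule O (M ⊗[O] N) :=
  Submodule.span O {t | ∃ (m : M) (s : S) (n : N), t = (op s • m) ⊗ₜ[O] n - m ⊗ₜ[O] (s • n)}

/-- The tensor product `M ⊗_S N` of a right `S`-module `M` and a left `S`-module `N`, for an
`O`-algebra `S`, as the quotient of `M ⊗_O N` by the relations `(m · s) ⊗ n = m ⊗ (s · n)`. -/
def BalancedTensor (M N : Type u) [AddCommGroup M] [Module O M] [Module Sᵐᵒᵖ M]
    [AddCommGroup N] [Module O N] [Module S N] : Type u :=
  (M ⊗[O] N) ⧸ balancedRel O S M N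

namespace BalancedTensor

variable (M M' N N' : Type u)
variable [AddCommGroup M] [Module O M] [Module Sᵐᵒᵖ M]
variable [AddCommGroup M'] [Module O M'] [Module Sᵐᵒᵖ M']
variable [AddCommGroup N] [Module O N] [Module S N]
variable [AddCommGroup N'] [Module O N'] [Module S N']

instance : AddCommGroup (BalancedTensor O S M N) :=
  inferInstanceAs (AddCommGroup ((M ⊗[O] N) ⧸ balancedRel O S M N))

instance : Module O (BalancedTensor O S M N) :=
  inferInstanceAs (Module O ((M ⊗[O] N) ⧸ balancedRel O S M N))

/-- The quotient map `M ⊗_O N → M ⊗_S N`. -/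
def mk : (M ⊗[O] N) →ₗ[O] BalancedTensor O S M N := (balancedRel O S M N).mkQ

variable {O S M M' N N'}

theorem mk_surjective : Function.Surjective (mk O S M N) :=
  Submodule.mkQ_surjective _

theorem induction {motive : BalancedTensor O S M N → Prop}
    (tmul : ∀ m n, motive (mk O S M N (m ⊗ₜ n)))
    (add : ∀ x y, motive x → motive y → motive (x + y)) (x : BalancedTensor O S M N) :
    motive x := by
  obtain ⟨t, rfl⟩ := mk_surjective x
  induction t with
  | zero => simpa using tmul 0 0
  | tmul m n => exact tmul m n
  | add a b ha hb => rw [map_add]; exact add _ _ ha hb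

/-- Functoriality of `M ⊗_S N`. -/
def map (g : M →ₗ[O] M') (hg : ∀ (s : S) (m : M), g (op s • m) = op s • g m)
    (h : N →ₗ[O] N') (hh : ∀ (s : S) (n : N), h (s • n) = s • h n) :
    BalancedTensor O S M N →ₗ[O] BalancedTensor O S M' N' :=
  Submodule.mapQ (balancedRel O S M N) (balancedRel O S M' N') (TensorProduct.map g h) (by
    rw [balancedRel, Submodule.span_le]
    rintro _ ⟨m, s, n, rfl⟩
    refine Submodule.subset_span ⟨g m, s, h n, ?_⟩
    simp [hg, hh])

@[simp] theorem map_mk (g : M →ₗ[O] M') (hg : ∀ (s : S) (m : M), g (op s • m) = op s • g m)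
    (h : N →ₗ[O] N') (hh : ∀ (s : S) (n : N), h (s • n) = s • h n) (m : M) (n : N) :
    map g hg h hh (mk O S M N (m ⊗ₜ n)) = mk O S M' N' (g m ⊗ₜ h n) := rfl

section Actions

variable (O S M N)
variable (R T : Type u) [Ring R] [Algebra O R] [Ring T] [Algebra O T]

theorem hom_ext {P : Type u} [AddCommGroup P] [Module O P] {f g : BalancedTensor O S M N →ₗ[O] P}
    (h : ∀ m n, f (mk O S M N (m ⊗ₜ n)) = g (mk O S M N (m ⊗ₜ n))) : f = g := by
  ext x
  induction x using induction with
  | tmul m n => exact h m n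
  | add x y hx hy => rw [map_add, map_add, hx, hy]

/-- The left action `r · (m ⊗ n) = (r · m) ⊗ n`, for an `R`-`S`-bimodule `M`. -/
def leftAction [Module R M] [IsScalarTower O R M] [SMulCommClass R Sᵐᵒᵖ M] :
    R →+* Module.End O (BalancedTensor O S M N) where
  toFun r := map (Algebra.lsmul O O M r) (fun s m => by simp only [Algebra.lsmul_coe]; exact smul_comm r (op s) m)
    (LinearMap.id : N →ₗ[O] N) (fun _ _ => rfl)
  map_one' := hom_ext O S M N fun m n => by
    rw [map_mk]; simp
  map_mul' r r' := hom_ext O S M N fun m n => by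
    rw [Module.End.mul_apply, map_mk, map_mk, map_mk]; simp
  map_zero' := hom_ext O S M N fun m n => by
    rw [map_mk]; simp
  map_add' r r' := hom_ext O S M N fun m n => by
    rw [LinearMap.add_apply, map_mk, map_mk, map_mk]; simp [TensorProduct.add_tmul]

/-- The right action `(m ⊗ n) · t = m ⊗ (n · t)`, for an `S`-`T`-bimodule `N`. -/
def rightAction [Module Tᵐᵒᵖ N] [IsScalarTower O Tᵐᵒᵖ N] [SMulCommClass S Tᵐᵒᵖ N] :
    Tᵐᵒᵖ →+* Module.End O (BalancedTensor O S M N) where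
  toFun t := map (LinearMap.id : M →ₗ[O] M) (fun _ _ => rfl)
    (Algebra.lsmul O O N t)
    (fun s n => by simp only [Algebra.lsmul_coe]; exact (smul_comm s t n).symm)
  map_one' := hom_ext O S M N fun m n => by
    rw [map_mk]; simp
  map_mul' r r' := hom_ext O S M N fun m n => by
    rw [Module.End.mul_apply, map_mk, map_mk, map_mk]; simp
  map_zero' := hom_ext O S M N fun m n => by
    rw [map_mk]; simp
  map_add' r r' := hom_ext O S M N fun m n => by
    rw [LinearMap.add_apply, map_mk, map_mk, map_mk]; simp [TensorProduct.tmul_add]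

/-- The left `R`-module `M ⊗_S N`, for an `R`-`S`-bimodule `M`. -/
@[reducible] def leftModule [Module R M] [IsScalarTower O R M] [SMulCommClass R Sᵐᵒᵖ M] :
    Module R (BalancedTensor O S M N) :=
  Module.compHom (BalancedTensor O S M N) (leftAction O S M N R)

/-- The right `T`-module `M ⊗_S N`, for an `S`-`T`-bimodule `N`. -/
@[reducible] def rightModule [Module Tᵐᵒᵖ N] [IsScalarTower O Tᵐᵒᵖ N] [SMulCommClass S Tᵐᵒᵖ N] :
    Module Tᵐᵒᵖ (BalancedTensor O S M N) :=
  Module.compHom (BalancedTensor O S M N) (rightAction O S M N T)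

/-- If `M` is an `R`-`S`-bimodule and `N` is an `S`-`T`-bimodule, then `M ⊗_S N` is an
`R`-`T`-bimodule, regarded as a left module over `R ⊗_O Tᵒᵖ`. -/
@[reducible] def bimodule [Module R M] [IsScalarTower O R M] [SMulCommClass R Sᵐᵒᵖ M]
    [Module Tᵐᵒᵖ N] [IsScalarTower O Tᵐᵒᵖ N] [SMulCommClass S Tᵐᵒᵖ N] :
    Module (R ⊗[O] Tᵐᵒᵖ) (BalancedTensor O S M N) :=
  letI : Module R (BalancedTensor O S M N) := leftModule O S M N R
  letI : Module Tᵐᵒᵖ (BalancedTensor O S M N) := rightModule O S M N T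
  haveI : IsScalarTower O R (BalancedTensor O S M N) := ⟨fun o r x => by
    change leftAction O S M N R (o • r) x = o • leftAction O S M N R r x
    induction x using induction with
    | tmul m n =>
      change mk O S M N (((o • r) • m) ⊗ₜ n) = o • mk O S M N ((r • m) ⊗ₜ n)
      rw [smul_assoc, ← map_smul, TensorProduct.smul_tmul']
    | add x y hx hy => rw [map_add, map_add, smul_add, hx, hy]⟩
  haveI : IsScalarTower O Tᵐᵒᵖ (BalancedTensor O S M N) := ⟨fun o t x => by
    change rightAction O S M N T (o • t) x = o • rightAction O S M N T t x
    induction x using induction with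
    | tmul m n =>
      change mk O S M N (m ⊗ₜ ((o • t) • n)) = o • mk O S M N (m ⊗ₜ (t • n))
      rw [smul_assoc, ← map_smul, TensorProduct.tmul_smul]
    | add x y hx hy => rw [map_add, map_add, smul_add, hx, hy]⟩
  haveI : SMulCommClass R Tᵐᵒᵖ (BalancedTensor O S M N) := ⟨fun r t x => by
    change leftAction O S M N R r (rightAction O S M N T t x) =
      rightAction O S M N T t (leftAction O S M N R r x)
    induction x using induction with
    | tmul m n => rfl
    | add x y hx hy => simp only [map_add, hx, hy]⟩
  TensorProduct.Algebra.module

end Actions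

end BalancedTensor

end BalancedTensor

/-! ### Bimodules -/

/-- An additive map between modules over `R ⊗_O T` which commutes with the action of all pure
tensors is linear. -/
def linearMapOfTmul {O R T P Q : Type u} [CommRing O] [Ring R] [Algebra O R] [Ring T] [Algebra O T]
    [AddCommGroup P] [Module (R ⊗[O] T) P] [AddCommGroup Q] [Module (R ⊗[O] T) Q] (g : P →+ Q)
    (h : ∀ (r : R) (t : T) (p : P), g ((r ⊗ₜ[O] t) • p) = (r ⊗ₜ[O] t) • g p) :
    P →ₗ[R ⊗[O] T] Q where
  toFun := g
  map_add' := map_add g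
  map_smul' a p := by
    induction a using TensorProduct.induction_on with
    | zero => simp
    | tmul r t => exact h r t p
    | add a b ha hb =>
      rw [add_smul, map_add, ha, hb]
      exact (add_smul a b (g p)).symm

/-- The category of `R`-`S`-bimodules over `O`, i.e. of left modules over `R ⊗_O Sᵒᵖ`. -/
abbrev BimodCat (O R S : Type u) [CommRing O] [Ring R] [Algebra O R] [Ring S] [Algebra O S] :=
  ModuleCat.{u} (R ⊗[O] Sᵐᵒᵖ)

namespace BimodCat

variable {O R S T : Type u} [CommRing O] [Ring R] [Algebra O R] [Ring S] [Algebra O S]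
variable [Ring T] [Algebra O T]

/-- The underlying `O`-module of a module over an `O`-algebra. -/
@[reducible] def baseModule (O : Type u) {A : Type u} [CommRing O] [Ring A] [Algebra O A]
    (M : ModuleCat.{u} A) : Module O M :=
  Module.compHom M (algebraMap O A)

/-- The underlying left `R`-module of an `R`-`S`-bimodule: `r · m = (r ⊗ 1) • m`. -/
@[reducible] def leftModule (M : BimodCat O R S) : Module R M :=
  Module.compHom M (Algebra.TensorProduct.includeLeft : R →ₐ[O] R ⊗[O] Sᵐᵒᵖ).toRingHom

/-- The underlying right `S`-module of an `R`-`S`-bimodule: `m · s = (1 ⊗ s) • m`. -/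
@[reducible] def rightModule (M : BimodCat O R S) : Module Sᵐᵒᵖ M :=
  Module.compHom M (Algebra.TensorProduct.includeRight : Sᵐᵒᵖ →ₐ[O] R ⊗[O] Sᵐᵒᵖ).toRingHom

attribute [local instance] baseModule leftModule rightModule

theorem base_smul_def {A : Type u} [Ring A] [Algebra O A] (M : ModuleCat.{u} A) (o : O) (m : M) :
    o • m = algebraMap O A o • m := rfl

theorem left_smul_def (M : BimodCat O R S) (r : R) (m : M) :
    r • m = (r ⊗ₜ[O] (1 : Sᵐᵒᵖ)) • m := rfl

theorem right_smul_def (M : BimodCat O R S) (s : Sᵐᵒᵖ) (m : M) :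
    s • m = ((1 : R) ⊗ₜ[O] s) • m := rfl

theorem smulCommClass (M : BimodCat O R S) : SMulCommClass R Sᵐᵒᵖ M :=
  ⟨fun r s m => by simp [left_smul_def, right_smul_def, ← mul_smul]⟩

theorem isScalarTower_base {A : Type u} [Ring A] [Algebra O A] (M : ModuleCat.{u} A) :
    IsScalarTower O A M :=
  ⟨fun o r m => by rw [base_smul_def, Algebra.smul_def, mul_smul]⟩

theorem isScalarTower_left (M : BimodCat O R S) : IsScalarTower O R M :=
  ⟨fun o r m => by
    rw [left_smul_def, left_smul_def, base_smul_def, ← mul_smul, ← Algebra.smul_def,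
      TensorProduct.smul_tmul']⟩

theorem isScalarTower_right (M : BimodCat O R S) : IsScalarTower O Sᵐᵒᵖ M :=
  ⟨fun o s m => by
    rw [right_smul_def, right_smul_def, base_smul_def, ← mul_smul, ← Algebra.smul_def,
      TensorProduct.tmul_smul]⟩

attribute [local instance] smulCommClass isScalarTower_base isScalarTower_left isScalarTower_right

/-- A homomorphism of modules over an `O`-algebra as an `O`-linear map. -/
def baseMap (O : Type u) {A : Type u} [CommRing O] [Ring A] [Algebra O A] {M N : ModuleCat.{u} A}
    (f : M ⟶ N) : M →ₗ[O] N where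
  toFun := f.hom
  map_add' := f.hom.map_add
  map_smul' o m := f.hom.map_smul (algebraMap O A o) m

/-- The `R`-`T`-bimodule `M ⊗_S N`. -/
def tensorObj (M : BimodCat O R S) (N : BimodCat O S T) : BimodCat O R T :=
  letI : Module (R ⊗[O] Tᵐᵒᵖ) (BalancedTensor O S M N) := BalancedTensor.bimodule O S M N R T
  ModuleCat.of (R ⊗[O] Tᵐᵒᵖ) (BalancedTensor O S M N)

/-- The bimodule homomorphism `f ⊗ g : M ⊗_S N → M' ⊗_S N'`. -/
def tensorMap {M M' : BimodCat O R S} {N N' : BimodCat O S T} (f : M ⟶ M') (g : N ⟶ N') :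
    tensorObj M N ⟶ tensorObj M' N' :=
  letI : Module (R ⊗[O] Tᵐᵒᵖ) (BalancedTensor O S M N) := BalancedTensor.bimodule O S M N R T
  letI : Module (R ⊗[O] Tᵐᵒᵖ) (BalancedTensor O S M' N') := BalancedTensor.bimodule O S M' N' R T
  ModuleCat.ofHom (linearMapOfTmul
    (BalancedTensor.map (O := O) (S := S) (baseMap O f) (fun s m => f.hom.map_smul _ m)
      (baseMap O g) (fun s n => g.hom.map_smul _ n)).toAddMonoidHom
    (fun r t x => by
      induction x using BalancedTensor.induction with
      | add x y hx hy => rw [smul_add, map_add, hx, hy, map_add, smul_add]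
      | tmul m n =>
        exact congrArg (BalancedTensor.mk O S M' N')
          (congrArg₂ (fun a b => a ⊗ₜ[O] b) (f.hom.map_smul _ m) (g.hom.map_smul _ n))))

theorem tensorObj_hom_ext {M : BimodCat O R S} {N : BimodCat O S T} {P : BimodCat O R T}
    {f g : tensorObj M N ⟶ P}
    (h : ∀ m n, f.hom (BalancedTensor.mk O S M N (m ⊗ₜ n)) =
      g.hom (BalancedTensor.mk O S M N (m ⊗ₜ n))) : f = g := by
  refine ModuleCat.hom_ext (LinearMap.ext fun x => ?_)
  refine BalancedTensor.induction (O := O) (S := S) (M := M) (N := N)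
    (motive := fun x => f.hom x = g.hom x) h (fun x y hx hy => ?_) x
  exact (map_add f.hom x y).trans
    ((congrArg₂ (· + ·) hx hy).trans (map_add g.hom x y).symm)

theorem tensorMap_mk {M M' : BimodCat O R S} {N N' : BimodCat O S T} (f : M ⟶ M') (g : N ⟶ N')
    (m : M) (n : N) :
    (tensorMap f g).hom (BalancedTensor.mk O S M N (m ⊗ₜ n)) =
      BalancedTensor.mk O S M' N' (f.hom m ⊗ₜ g.hom n) := rfl

/-- The left `R`-module `M ⊗_S V`, for an `R`-`S`-bimodule `M` and a left `S`-module `V`. -/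
def actObj (M : BimodCat O R S) (V : ModuleCat.{u} S) : ModuleCat.{u} R :=
  letI : Module R (BalancedTensor O S M V) := BalancedTensor.leftModule O S M V R
  ModuleCat.of R (BalancedTensor O S M V)

/-- The `R`-linear map `f ⊗ g : M ⊗_S V → M' ⊗_S V'`. -/
def actMap {M M' : BimodCat O R S} {V V' : ModuleCat.{u} S} (f : M ⟶ M') (g : V ⟶ V') :
    actObj M V ⟶ actObj M' V' :=
  letI : Module R (BalancedTensor O S M V) := BalancedTensor.leftModule O S M V R
  letI : Module R (BalancedTensor O S M' V') := BalancedTensor.leftModule O S M' V' R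
  ModuleCat.ofHom
    { toFun := BalancedTensor.map (O := O) (S := S) (baseMap O f) (fun s m => f.hom.map_smul _ m)
        (baseMap O g) (fun s n => g.hom.map_smul _ n)
      map_add' := map_add _
      map_smul' := fun r x => by
        induction x using BalancedTensor.induction with
        | add x y hx hy => simp only [smul_add, map_add, hx, hy]
        | tmul m n =>
          exact congrArg (BalancedTensor.mk O S M' V')
            (congrArg (fun a => a ⊗ₜ[O] g.hom n) (f.hom.map_smul _ m)) }

theorem actObj_hom_ext {M : BimodCat O R S} {V : ModuleCat.{u} S} {P : ModuleCat.{u} R}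
    {f g : actObj M V ⟶ P}
    (h : ∀ m n, f.hom (BalancedTensor.mk O S M V (m ⊗ₜ n)) =
      g.hom (BalancedTensor.mk O S M V (m ⊗ₜ n))) : f = g := by
  refine ModuleCat.hom_ext (LinearMap.ext fun x => ?_)
  refine BalancedTensor.induction (O := O) (S := S) (M := M) (N := V)
    (motive := fun x => f.hom x = g.hom x) h (fun x y hx hy => ?_) x
  exact (map_add f.hom x y).trans
    ((congrArg₂ (· + ·) hx hy).trans (map_add g.hom x y).symm)

theorem actMap_mk {M M' : BimodCat O R S} {V V' : ModuleCat.{u} S} (f : M ⟶ M') (g : V ⟶ V')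
    (m : M) (n : V) :
    (actMap f g).hom (BalancedTensor.mk O S M V (m ⊗ₜ n)) =
      BalancedTensor.mk O S M' V' (f.hom m ⊗ₜ g.hom n) := rfl

variable (O R S T)

/-- The bifunctor `(M, N) ↦ M ⊗_S N` on bimodules. -/
def tensorBifunctor : BimodCat O R S ⥤ BimodCat O S T ⥤ BimodCat O R T where
  obj M :=
    { obj := fun N => tensorObj M N
      map := fun g => tensorMap (𝟙 M) g
      map_id := fun N => tensorObj_hom_ext fun _ _ => rfl
      map_comp := fun g h => tensorObj_hom_ext fun _ _ => rfl }
  map f :=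
    { app := fun N => tensorMap f (𝟙 N)
      naturality := fun _ _ g => tensorObj_hom_ext fun _ _ => rfl }
  map_id M := NatTrans.ext (funext fun N => tensorObj_hom_ext fun _ _ => rfl)
  map_comp f g := NatTrans.ext (funext fun N => tensorObj_hom_ext fun _ _ => rfl)

/-- The bifunctor `(M, V) ↦ M ⊗_S V` from bimodules and left modules to left modules. -/
def actBifunctor : BimodCat O R S ⥤ ModuleCat.{u} S ⥤ ModuleCat.{u} R where
  obj M :=
    { obj := fun V => actObj M V
      map := fun g => actMap (𝟙 M) g
      map_id := fun V => actObj_hom_ext fun _ _ => rfl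
      map_comp := fun g h => actObj_hom_ext fun _ _ => rfl }
  map f :=
    { app := fun V => actMap f (𝟙 V)
      naturality := fun _ _ g => actObj_hom_ext fun _ _ => rfl }
  map_id M := NatTrans.ext (funext fun V => actObj_hom_ext fun _ _ => rfl)
  map_comp f g := NatTrans.ext (funext fun V => actObj_hom_ext fun _ _ => rfl)

instance : (tensorBifunctor O R S T).Additive where
  map_add {M M' f g} := NatTrans.ext (funext fun N => tensorObj_hom_ext fun m n =>
    (congrArg (BalancedTensor.mk O S M' N) (TensorProduct.add_tmul _ _ _)).trans
      (map_add _ _ _))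

instance (M : BimodCat O R S) : ((tensorBifunctor O R S T).obj M).Additive where
  map_add {N N' f g} := tensorObj_hom_ext fun m n =>
    (congrArg (BalancedTensor.mk O S M N') (TensorProduct.tmul_add _ _ _)).trans
      (map_add _ _ _)

instance : (actBifunctor O R S).Additive where
  map_add {M M' f g} := NatTrans.ext (funext fun V => actObj_hom_ext fun m n =>
    (congrArg (BalancedTensor.mk O S M' V) (TensorProduct.add_tmul _ _ _)).trans
      (map_add _ _ _))

instance (M : BimodCat O R S) : ((actBifunctor O R S).obj M).Additive where
  map_add {V V' f g} := actObj_hom_ext fun m n =>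
    (congrArg (BalancedTensor.mk O S M V') (TensorProduct.tmul_add _ _ _)).trans
      (map_add _ _ _)

/-- The regular `R`-`R`-bimodule `R`. -/
def regular : BimodCat O R R :=
  letI : Module (R ⊗[O] Rᵐᵒᵖ) R := instModuleTensorProductMop O R
  ModuleCat.of (R ⊗[O] Rᵐᵒᵖ) R

end BimodCat

/-! ### Corner algebras `eEe` and corner bimodules `eMf` -/

section Corner

variable {O E F : Type u} [CommRing O] [Ring E] [Algebra O E] [Ring F] [Algebra O F]
variable {e : E} {f : F}

/-- The `O`-algebra structure on `eEe`, with unit element `e`. -/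
instance cornerAlgebra (he : IsIdempotentElem e) : Algebra O he.Corner where
  smul o x := ⟨o • x.1, o • x.1, by
    have h := (Subsemigroup.mem_corner_iff he).mp x.2
    simp only [mul_smul_comm, smul_mul_assoc, h.1, h.2]⟩
  algebraMap :=
    { toFun := fun o => ⟨o • e, o • e, by simp only [mul_smul_comm, smul_mul_assoc, he.eq]⟩
      map_one' := Subtype.ext (one_smul O e)
      map_mul' := fun a b => Subtype.ext (by
        change (a * b) • e = (a • e) * (b • e)
        rw [smul_mul_smul_comm, he.eq])
      map_zero' := Subtype.ext (zero_smul O e)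
      map_add' := fun a b => Subtype.ext (add_smul a b e) }
  commutes' o x := Subtype.ext (by
    have h := (Subsemigroup.mem_corner_iff he).mp x.2
    change (o • e) * x.1 = x.1 * (o • e)
    rw [smul_mul_assoc, mul_smul_comm, h.1, h.2])
  smul_def' o x := Subtype.ext (by
    have h := (Subsemigroup.mem_corner_iff he).mp x.2
    change o • x.1 = (o • e) * x.1
    rw [smul_mul_assoc, h.1])

/-- The inclusion `eEe → E` is `O`-linear. -/
def cornerIncl (O : Type u) [CommRing O] [Algebra O E] (he : IsIdempotentElem e) :
    he.Corner →ₗ[O] E where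
  toFun x := x.1
  map_add' _ _ := rfl
  map_smul' _ _ := rfl

instance cornerFinite [IsNoetherianRing O] [Module.Finite O E] (he : IsIdempotentElem e) :
    Module.Finite O he.Corner :=
  Module.Finite.of_injective (cornerIncl O he) Subtype.val_injective

/-- The image `eMf` of the action of `e ⊗ f` on an `E`-`F`-bimodule `M`, as an `O`-module. -/
def cornerSub (e : E) (f : F) (M : BimodCat O E F) :
    letI := BimodCat.baseModule O M
    Submodule O M :=
  letI := BimodCat.baseModule O M
  haveI := BimodCat.isScalarTower_base (O := O) M
  LinearMap.range (Algebra.lsmul O O M (e ⊗ₜ[O] op f))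

namespace cornerSub

open BimodCat

attribute [local instance] baseModule

theorem mem_of_smul_eq {M : BimodCat O E F} {m : M} (h : (e ⊗ₜ[O] op f) • m = m) :
    m ∈ cornerSub e f M := ⟨m, h⟩

theorem smul_eq (he : IsIdempotentElem e) (hf : IsIdempotentElem f) {M : BimodCat O E F}
    (m : cornerSub e f M) : (e ⊗ₜ[O] op f) • m.1 = m.1 := by
  obtain ⟨_, m', rfl⟩ := m
  change (e ⊗ₜ[O] op f) • (e ⊗ₜ[O] op f) • m' = (e ⊗ₜ[O] op f) • m'
  rw [← mul_smul, Algebra.TensorProduct.tmul_mul_tmul, he.eq, ← op_mul, hf.eq]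

theorem left_smul_eq (he : IsIdempotentElem e) (hf : IsIdempotentElem f) {M : BimodCat O E F}
    (m : cornerSub e f M) : (e ⊗ₜ[O] (1 : Fᵐᵒᵖ)) • m.1 = m.1 := by
  conv_lhs => rw [← smul_eq he hf m]
  rw [← mul_smul, Algebra.TensorProduct.tmul_mul_tmul, he.eq, one_mul, smul_eq he hf]

theorem right_smul_eq (he : IsIdempotentElem e) (hf : IsIdempotentElem f) {M : BimodCat O E F}
    (m : cornerSub e f M) : ((1 : E) ⊗ₜ[O] op f) • m.1 = m.1 := by
  conv_lhs => rw [← smul_eq he hf m]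
  rw [← mul_smul, Algebra.TensorProduct.tmul_mul_tmul, one_mul, ← op_mul, hf.eq, smul_eq he hf]

/-- The left action of `eEe` on `eMf`. -/
@[reducible] def leftModule (he : IsIdempotentElem e) (hf : IsIdempotentElem f)
    (M : BimodCat O E F) : Module he.Corner (cornerSub e f M) where
  smul x m := ⟨(x.1 ⊗ₜ[O] (1 : Fᵐᵒᵖ)) • m.1, mem_of_smul_eq (by
    conv_rhs => rw [← right_smul_eq he hf m]
    rw [← mul_smul, ← mul_smul, Algebra.TensorProduct.tmul_mul_tmul,
      Algebra.TensorProduct.tmul_mul_tmul, mul_one, one_mul, mul_one,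
      ((Subsemigroup.mem_corner_iff he).mp x.2).1])⟩
  one_smul m := Subtype.ext (left_smul_eq he hf m)
  mul_smul x y m := Subtype.ext (by
    change ((x.1 * y.1) ⊗ₜ[O] (1 : Fᵐᵒᵖ)) • m.1 =
      (x.1 ⊗ₜ[O] (1 : Fᵐᵒᵖ)) • (y.1 ⊗ₜ[O] (1 : Fᵐᵒᵖ)) • m.1
    rw [← mul_smul, Algebra.TensorProduct.tmul_mul_tmul, one_mul])
  smul_zero x := Subtype.ext (smul_zero (x.1 ⊗ₜ[O] (1 : Fᵐᵒᵖ)))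
  smul_add x m n := Subtype.ext (smul_add (x.1 ⊗ₜ[O] (1 : Fᵐᵒᵖ)) m.1 n.1)
  add_smul x y m := Subtype.ext (by
    change ((x.1 + y.1) ⊗ₜ[O] (1 : Fᵐᵒᵖ)) • m.1 =
      (x.1 ⊗ₜ[O] (1 : Fᵐᵒᵖ)) • m.1 + (y.1 ⊗ₜ[O] (1 : Fᵐᵒᵖ)) • m.1
    rw [TensorProduct.add_tmul, add_smul])
  zero_smul m := Subtype.ext (by
    change ((0 : E) ⊗ₜ[O] (1 : Fᵐᵒᵖ)) • m.1 = 0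
    exact (congrArg (· • m.1) (TensorProduct.zero_tmul E (1 : Fᵐᵒᵖ))).trans
      (Module.zero_smul (R := E ⊗[O] Fᵐᵒᵖ) m.1))

/-- The right action of `fFf` on `eMf`. -/
@[reducible] def rightModule (he : IsIdempotentElem e) (hf : IsIdempotentElem f)
    (M : BimodCat O E F) : Module hf.Cornerᵐᵒᵖ (cornerSub e f M) where
  smul y m := ⟨((1 : E) ⊗ₜ[O] op y.unop.1) • m.1, mem_of_smul_eq (by
    conv_rhs => rw [← left_smul_eq he hf m]
    rw [← mul_smul, ← mul_smul, Algebra.TensorProduct.tmul_mul_tmul,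
      Algebra.TensorProduct.tmul_mul_tmul, mul_one, one_mul, mul_one, ← op_mul,
      ((Subsemigroup.mem_corner_iff hf).mp y.unop.2).2])⟩
  one_smul m := Subtype.ext (right_smul_eq he hf m)
  mul_smul x y m := Subtype.ext (by
    change ((1 : E) ⊗ₜ[O] op (y.unop.1 * x.unop.1)) • m.1 =
      ((1 : E) ⊗ₜ[O] op x.unop.1) • ((1 : E) ⊗ₜ[O] op y.unop.1) • m.1
    rw [← mul_smul, Algebra.TensorProduct.tmul_mul_tmul, one_mul, op_mul])
  smul_zero y := Subtype.ext (smul_zero ((1 : E) ⊗ₜ[O] op y.unop.1))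
  smul_add y m n := Subtype.ext (smul_add ((1 : E) ⊗ₜ[O] op y.unop.1) m.1 n.1)
  add_smul x y m := Subtype.ext (by
    change ((1 : E) ⊗ₜ[O] op (x.unop.1 + y.unop.1)) • m.1 =
      ((1 : E) ⊗ₜ[O] op x.unop.1) • m.1 + ((1 : E) ⊗ₜ[O] op y.unop.1) • m.1
    rw [MulOpposite.op_add, TensorProduct.tmul_add, add_smul])
  zero_smul m := Subtype.ext (by
    change ((1 : E) ⊗ₜ[O] op (0 : F)) • m.1 = 0
    exact (congrArg (· • m.1) (TensorProduct.tmul_zero Fᵐᵒᵖ (1 : E))).trans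
      (Module.zero_smul (R := E ⊗[O] Fᵐᵒᵖ) m.1))

/-- The `eEe`-`fFf`-bimodule `eMf`. -/
@[reducible] def bimodule (he : IsIdempotentElem e) (hf : IsIdempotentElem f)
    (M : BimodCat O E F) : Module (he.Corner ⊗[O] hf.Cornerᵐᵒᵖ) (cornerSub e f M) :=
  letI := leftModule he hf M
  letI := rightModule he hf M
  haveI := isScalarTower_base (O := O) M
  haveI : IsScalarTower O he.Corner (cornerSub e f M) := ⟨fun o x m => Subtype.ext (by
    change ((o • x.1) ⊗ₜ[O] (1 : Fᵐᵒᵖ)) • m.1 = o • (x.1 ⊗ₜ[O] (1 : Fᵐᵒᵖ)) • m.1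
    rw [← TensorProduct.smul_tmul', smul_assoc])⟩
  haveI : IsScalarTower O hf.Cornerᵐᵒᵖ (cornerSub e f M) := ⟨fun o y m => Subtype.ext (by
    change ((1 : E) ⊗ₜ[O] op (o • y.unop.1)) • m.1 = o • ((1 : E) ⊗ₜ[O] op y.unop.1) • m.1
    rw [op_smul, TensorProduct.tmul_smul, smul_assoc])⟩
  haveI : SMulCommClass he.Corner hf.Cornerᵐᵒᵖ (cornerSub e f M) := ⟨fun x y m => Subtype.ext (by
    change (x.1 ⊗ₜ[O] (1 : Fᵐᵒᵖ)) • ((1 : E) ⊗ₜ[O] op y.unop.1) • m.1 =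
      ((1 : E) ⊗ₜ[O] op y.unop.1) • (x.1 ⊗ₜ[O] (1 : Fᵐᵒᵖ)) • m.1
    rw [← mul_smul, ← mul_smul, Algebra.TensorProduct.tmul_mul_tmul,
      Algebra.TensorProduct.tmul_mul_tmul, mul_one, one_mul, mul_one, one_mul])⟩
  TensorProduct.Algebra.module

/-- The action of `x ⊗ y` on `eMf` is the restriction of the action of `x ⊗ y` on `M`. -/
theorem coe_tmul_smul (he : IsIdempotentElem e) (hf : IsIdempotentElem f) (M : BimodCat O E F)
    (x : he.Corner) (y : hf.Cornerᵐᵒᵖ) (m : cornerSub e f M) :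
    letI := bimodule he hf M
    (((x ⊗ₜ[O] y : he.Corner ⊗[O] hf.Cornerᵐᵒᵖ) • m : cornerSub e f M) : M) =
      (x.1 ⊗ₜ[O] op y.unop.1) • m.1 := by
  change (x.1 ⊗ₜ[O] (1 : Fᵐᵒᵖ)) • ((1 : E) ⊗ₜ[O] op y.unop.1) • m.1 = _
  rw [← mul_smul, Algebra.TensorProduct.tmul_mul_tmul, mul_one, one_mul]

/-- The restriction `eMf → eNf` of a bimodule homomorphism `M → N`. -/
def map (he : IsIdempotentElem e) (hf : IsIdempotentElem f) {M N : BimodCat O E F} (φ : M ⟶ N) :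
    cornerSub e f M →+ cornerSub e f N where
  toFun m := ⟨φ.hom m.1, mem_of_smul_eq
    ((φ.hom.map_smul _ _).symm.trans (congrArg φ.hom (smul_eq he hf m)))⟩
  map_zero' := Subtype.ext (map_zero φ.hom)
  map_add' m n := Subtype.ext (map_add φ.hom m.1 n.1)

end cornerSub

/-- The functor `M ↦ eMf` from `E`-`F`-bimodules to `eEe`-`fFf`-bimodules. -/
def cornerBimod (O : Type u) [CommRing O] [Algebra O E] [Algebra O F]
    (he : IsIdempotentElem e) (hf : IsIdempotentElem f) :
    BimodCat O E F ⥤ BimodCat O he.Corner hf.Corner where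
  obj M :=
    letI := cornerSub.bimodule he hf M
    ModuleCat.of (he.Corner ⊗[O] hf.Cornerᵐᵒᵖ) (cornerSub e f M)
  map {M N} φ :=
    letI := cornerSub.bimodule he hf M
    letI := cornerSub.bimodule he hf N
    ModuleCat.ofHom (linearMapOfTmul (cornerSub.map he hf φ)
      (fun x y m => Subtype.ext
        ((congrArg φ.hom (cornerSub.coe_tmul_smul he hf M x y m)).trans
          ((φ.hom.map_smul _ _).trans
            (cornerSub.coe_tmul_smul he hf N x y (cornerSub.map he hf φ m)).symm))))

instance (he : IsIdempotentElem e) (hf : IsIdempotentElem f) :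
    (cornerBimod O he hf).Additive where
  map_add := rfl

end Corner

section EndCorner

variable {O A B X Y : Type u} [CommRing O] [Ring A] [Algebra O A] [Ring B] [Algebra O B]
variable [AddCommGroup X] [Module O X] [Module A X] [IsScalarTower O A X]
variable [AddCommGroup Y] [Module O Y] [Module B Y] [IsScalarTower O B Y]
variable {e : Module.End A X} {f : Module.End B Y}

/-- The inclusion of `A ≅ e(X)` into `X`. -/
def summandIncl (θ : LinearMap.range e ≃ₗ[A] A) : A →ₗ[A] X :=
  (LinearMap.range e).subtype ∘ₗ θ.symm.toLinearMap

/-- The projection of `X` onto `e(X) ≅ A`. -/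
def summandProj (θ : LinearMap.range e ≃ₗ[A] A) : X →ₗ[A] A :=
  θ.toLinearMap ∘ₗ e.rangeRestrict

theorem summandIncl_summandProj (θ : LinearMap.range e ≃ₗ[A] A) (x : X) :
    summandIncl θ (summandProj θ x) = e x := by
  simp [summandIncl, summandProj]

theorem summandProj_summandIncl (he : IsIdempotentElem e) (θ : LinearMap.range e ≃ₗ[A] A) (a : A) :
    summandProj θ (summandIncl θ a) = a := by
  obtain ⟨y, hy⟩ := (θ.symm a).2
  have : e.rangeRestrict (θ.symm a : X) = θ.symm a := Subtype.ext (by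
    rw [LinearMap.codRestrict_apply, ← hy]
    exact congrArg (fun g : Module.End A X => g y) he.eq)
  simp [summandIncl, summandProj, this]

/-- The isomorphism `Aᵒᵖ ≅ End_A(A) ≅ End_A(e(X)) ≅ eEe`, where `E = End_A(X)`, determined by an
isomorphism `e(X) ≅ A`: it sends `a` to `X → e(X) ≅ A → A ≅ e(X) → X`, where the map in the middle
is right multiplication by `a`. -/
def opEquivCorner (O : Type u) [CommRing O] [Algebra O A] [Module O X] [IsScalarTower O A X]
    (he : IsIdempotentElem e) (θ : LinearMap.range e ≃ₗ[A] A) :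
    Aᵐᵒᵖ ≃ₐ[O] he.Corner where
  toFun a := ⟨summandIncl θ ∘ₗ LinearMap.toSpanSingleton A A a.unop ∘ₗ summandProj θ,
    summandIncl θ ∘ₗ LinearMap.toSpanSingleton A A a.unop ∘ₗ summandProj θ, by
      ext x
      simp only [Module.End.mul_apply, LinearMap.comp_apply, ← summandIncl_summandProj θ,
        summandProj_summandIncl he θ]⟩
  invFun x := op (summandProj θ (x.1 (summandIncl θ 1)))
  left_inv a := by
    apply unop_injective
    change summandProj θ (summandIncl θ (summandProj θ (summandIncl θ 1) • a.unop)) = a.unop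
    rw [summandProj_summandIncl he, summandProj_summandIncl he, one_smul]
  right_inv x := Subtype.ext (LinearMap.ext fun y => by
    change summandIncl θ (summandProj θ y • summandProj θ (x.1 (summandIncl θ 1))) = x.1 y
    have h := (Subsemigroup.mem_corner_iff he).mp x.2
    rw [← map_smul, ← map_smul, ← map_smul, smul_eq_mul, mul_one, summandIncl_summandProj,
      summandIncl_summandProj, ← Module.End.mul_apply, ← Module.End.mul_apply, h.1, h.2])
  map_mul' a b := Subtype.ext (LinearMap.ext fun y => by
    change summandIncl θ (summandProj θ y • (b.unop * a.unop)) =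
      summandIncl θ (summandProj θ (summandIncl θ (summandProj θ y • b.unop)) • a.unop)
    rw [summandProj_summandIncl he, smul_eq_mul, smul_eq_mul, smul_eq_mul, mul_assoc])
  map_add' a b := Subtype.ext (LinearMap.ext fun y => by
    change summandIncl θ (summandProj θ y • (a.unop + b.unop)) =
      summandIncl θ (summandProj θ y • a.unop) + summandIncl θ (summandProj θ y • b.unop)
    rw [smul_add, map_add])
  commutes' o := Subtype.ext (LinearMap.ext fun y => by
    change summandIncl θ (summandProj θ y • algebraMap O A o) = o • e y
    rw [smul_eq_mul, ← Algebra.commutes, ← smul_eq_mul, map_smul, algebraMap_smul,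
      summandIncl_summandProj])

/-- The functor `M ↦ eMf` from `E`-`F`-bimodules to `B`-`A`-bimodules, where `E = End_A(X)`,
`F = End_B(Y)`, the left `eEe`-module structure is regarded as a right `A`-module structure through
`Aᵒᵖ ≅ eEe`, and the right `fFf`-module structure as a left `B`-module structure through
`Bᵒᵖ ≅ fFf`. -/
def cornerBimodOp (O : Type u) [CommRing O] [Algebra O A] [Module O X] [IsScalarTower O A X]
    [Algebra O B] [Module O Y] [IsScalarTower O B Y]
    (he : IsIdempotentElem e) (θ : LinearMap.range e ≃ₗ[A] A)
    (hf : IsIdempotentElem f) (η : LinearMap.range f ≃ₗ[B] B) :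
    BimodCat O (Module.End A X) (Module.End B Y) ⥤ BimodCat O B A :=
  cornerBimod O he hf ⋙ ModuleCat.restrictScalars
    ((Algebra.TensorProduct.map (opEquivCorner O he θ).toAlgHom
      (AlgEquiv.opComm.symm (opEquivCorner O hf η)).toAlgHom).comp
      (Algebra.TensorProduct.comm O B Aᵐᵒᵖ).toAlgHom).toRingHom

instance (he : IsIdempotentElem e) (θ : LinearMap.range e ≃ₗ[A] A)
    (hf : IsIdempotentElem f) (η : LinearMap.range f ≃ₗ[B] B) :
    (cornerBimodOp O he θ hf η).Additive :=
  inferInstanceAs (cornerBimod O he hf ⋙ ModuleCat.restrictScalars _).Additive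

instance endFinite [IsNoetherianRing O] [Module.Finite O A] [Module.Finite A X] :
    Module.Finite O (Module.End A X) :=
  haveI : Module.Finite O X := Module.Finite.trans A X
  Module.Finite.of_injective (LinearMap.restrictScalarsₗ O A X X O)
    (LinearMap.restrictScalars_injective O)

end EndCorner

/-! ### Complexes of bimodules, Rickard equivalences, derived equivalences -/

section Complexes

variable (O R S T : Type u) [CommRing O] [Ring R] [Algebra O R] [Ring S] [Algebra O S]
variable [Ring T] [Algebra O T]

/-- The complex of `R`-`T`-bimodules `M ⊗_S N`: the total complex of the double complex with terms
`M^i ⊗_S N^j`. -/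
def tensorComplex (M : CochainComplex (BimodCat O R S) ℤ) (N : CochainComplex (BimodCat O S T) ℤ) :
    CochainComplex (BimodCat O R T) ℤ :=
  CochainComplex.mapBifunctor M N (BimodCat.tensorBifunctor O R S T)

/-- The functor `P ⊗_S -` from complexes of left `S`-modules to complexes of left `R`-modules, for a
complex `P` of `R`-`S`-bimodules; its value at `V` is the total complex of the double complex with
terms `P^i ⊗_S V^j`. -/
def tensorFunctor (P : CochainComplex (BimodCat O R S) ℤ) :
    CochainComplex (ModuleCat.{u} S) ℤ ⥤ CochainComplex (ModuleCat.{u} R) ℤ :=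
  (BimodCat.actBifunctor O R S).map₂CochainComplex.obj P

/-- The regular bimodule `R` as a complex concentrated in degree `0`. -/
def regularComplex : CochainComplex (BimodCat O R R) ℤ :=
  (HomologicalComplex.single (BimodCat O R R) (ComplexShape.up ℤ) 0).obj (BimodCat.regular O R)

variable {O R S}

/-- A complex with only finitely many nonzero terms. -/
def IsBoundedComplex {C : Type*} [Category C] [Limits.HasZeroMorphisms C]
    (K : CochainComplex C ℤ) : Prop :=
  ∃ n : ℕ, ∀ i : ℤ, (n : ℤ) < |i| → Limits.IsZero (K.X i)

/-- A bimodule which is finitely generated projective as a left and as a right module. -/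
structure IsFGProjectiveBimod (M : BimodCat O R S) : Prop where
  left_finite : letI := BimodCat.leftModule M; Module.Finite R M
  left_projective : letI := BimodCat.leftModule M; Module.Projective R M
  right_finite : letI := BimodCat.rightModule M; Module.Finite Sᵐᵒᵖ M
  right_projective : letI := BimodCat.rightModule M; Module.Projective Sᵐᵒᵖ M

/-- A Rickard equivalence between `R` and `S`: bounded complexes `M` of `R`-`S`-bimodules and `N` of
`S`-`R`-bimodules, with terms finitely generated projective as left and as right modules, such that
`M ⊗_S N ≃ R` and `N ⊗_R M ≃ S` in the homotopy categories of complexes of bimodules. -/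
structure IsRickardEquivalence (M : CochainComplex (BimodCat O R S) ℤ)
    (N : CochainComplex (BimodCat O S R) ℤ) : Prop where
  bounded_left : IsBoundedComplex M
  bounded_right : IsBoundedComplex N
  projective_left : ∀ i, IsFGProjectiveBimod (M.X i)
  projective_right : ∀ i, IsFGProjectiveBimod (N.X i)
  homotopyEquiv_left : Nonempty (HomotopyEquiv (tensorComplex O R S R M N) (regularComplex O R))
  homotopyEquiv_right : Nonempty (HomotopyEquiv (tensorComplex O S R S N M) (regularComplex O S))

/-- The functor `G` between the categories of complexes of finitely generated modules is the
restriction of `P ⊗_S -`. As the embeddings of finitely generated modules into all modules are fully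
faithful, `G` is determined by `P` up to a unique isomorphism compatible with this
identification. -/
def IsRestrictionOfTensor (P : CochainComplex (BimodCat O R S) ℤ)
    (G : CochainComplex (FGModuleCat.{u} S) ℤ ⥤ CochainComplex (FGModuleCat.{u} R) ℤ) : Prop :=
  Nonempty (G ⋙ (ModuleCat.isFG.{u} R).ι.mapHomologicalComplex (ComplexShape.up ℤ) ≅
    (ModuleCat.isFG.{u} S).ι.mapHomologicalComplex (ComplexShape.up ℤ) ⋙ tensorFunctor O R S P)

/-- The functors `P ⊗_S -` and `Q ⊗_R -` send complexes of finitely generated modules to complexes of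
finitely generated modules and induce mutually inverse triangulated equivalences between the derived
categories `D(mod(S))` and `D(mod(R))` of the abelian categories of finitely generated left modules,
which restrict to equivalences between the bounded derived categories `D^b(mod(S))` and
`D^b(mod(R))` (the full subcategories of objects with bounded cohomology). -/
def InduceDerivedEquivalence [IsNoetherianRing O] [Module.Finite O R] [Module.Finite O S]
    (P : CochainComplex (BimodCat O R S) ℤ) (Q : CochainComplex (BimodCat O S R) ℤ) : Prop :=
  haveI : IsNoetherianRing R := IsNoetherianRing.of_finite O R
  haveI : IsNoetherianRing S := IsNoetherianRing.of_finite O S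
  letI := HasDerivedCategory.standard (FGModuleCat.{u} R)
  letI := HasDerivedCategory.standard (FGModuleCat.{u} S)
  ∃ (G : CochainComplex (FGModuleCat.{u} S) ℤ ⥤ CochainComplex (FGModuleCat.{u} R) ℤ)
    (H : CochainComplex (FGModuleCat.{u} R) ℤ ⥤ CochainComplex (FGModuleCat.{u} S) ℤ)
    (Φ : DerivedCategory (FGModuleCat.{u} S) ≌ DerivedCategory (FGModuleCat.{u} R))
    (_ : Φ.functor.CommShift ℤ),
    IsRestrictionOfTensor P G ∧ IsRestrictionOfTensor Q H ∧
    Φ.functor.IsTriangulated ∧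
    Nonempty (DerivedCategory.Q ⋙ Φ.functor ≅ G ⋙ DerivedCategory.Q) ∧
    Nonempty (DerivedCategory.Q ⋙ Φ.inverse ≅ H ⋙ DerivedCategory.Q) ∧
    ∀ K : DerivedCategory (FGModuleCat.{u} S),
      DerivedCategory.TStructure.t.bounded K ↔
        DerivedCategory.TStructure.t.bounded (Φ.functor.obj K)

end Complexes

end

/-! Cutting with an idempotent, W ↦ eW, is exact, and V ↦ Ee ⊗_{eEe} V is a one-sided inverse of it:
e(Ee ⊗ V) ≅ V. Moreover eMf ⊗_{fFf} V ≅ e(M ⊗_F (Ff ⊗_{fFf} V)), see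
`CornerComplexEmbedding.tensorFunctorIso`. So eMf ⊗ - is the Rickard equivalence M ⊗_F - seen
through the two corners. It respects quasi-isomorphisms and has fNe ⊗ - as inverse as soon as M ⊗_F
- sends complexes W with fH(W) = 0 to complexes whose cohomology is killed by e, and likewise for N.
For the counit Ff ⊗ fW → W becomes invertible after cutting with f, so its cone is of that kind and
disappears from e(M ⊗_F -).

This transfer of acyclicity is the heart of the proof, and it is where symmetry enters. Since A is
symmetric, eE ≅ Hom_A(X, A) ≅ Hom_O(X, O) is dual to Ee ≅ X, and every linear form on E = End_A(X)
is a sum of forms that factor through eE (`isFrobeniusCorner_end`). Put I = Hom_ℤ(eE, ℚ/ℤ). As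
Hom_E(W, I) is the character group of eW, homotopy classes of maps from W to shifts of I detect
eH(W). The duality shows that N ⊗_E I has no nonzero element killed by fF
(`eq_zero_of_corner_smul_eq_zero`). Now let K be a complex of F-modules with fK = 0, and φ a map
from M ⊗ K to a shift of I. Then N ⊗ φ starts at N ⊗ M ⊗ K ≃ K, so it is null-homotopic; applying M
⊗ - shows the same for φ. Hence eH(M ⊗ K) = 0 (`isCornerAcyclic_of_smul_eq_zero`). For general W the
terms of M are projective on the right, so column i of M ⊗ W has cohomology M^i ⊗ H^j(W) with
fH^j(W) = 0, and boundedness of M reduces the claim to the case just treated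
(`IsCornerAcyclic.tensor`).

Part (ii) exchanges left and right. An E-F-bimodule is also an Fᵒᵖ-Eᵒᵖ-bimodule, flipping turns a
Rickard equivalence into one of opposite algebras, and A is the corner of Eᵒᵖ at `op e`. The duality
conditions are checked for this corner in `isFrobeniusCorner_op_end`; they hold because X is
reflexive over O. `CornerEmbedding` abstracts from the actual corner, so that both parts are
instances of `CornerComplexEmbedding.induceDerivedEquivalence`.

Since the functors on complexes preserve quasi-isomorphisms, no derived functors are needed: they
descend to the localizations, and they are triangulated because they preserve degreewise split
sequences (`exists_derivedEquivalence`). Finite generation and boundedness are inherited from the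
complexes of bimodules. -/

noncomputable section

/-! ### Functors between categories of complexes and derived categories -/

section DerivedFunctors

open Limits Pretriangulated HomologicalComplex CochainComplex

universe v₁ u₁ v₂ u₂ w₁ w₂

variable {C : Type u₁} [Category.{v₁} C] {D : Type u₂} [Category.{v₂} D]

/-- A functor between categories of cochain complexes which preserves degreewise split short exact
sequences together with their connecting morphisms. -/
def PreservesDegreewiseSplit [Preadditive C] [Preadditive D]
    (G : CochainComplex C ℤ ⥤ CochainComplex D ℤ) [G.Additive] [G.CommShift ℤ] : Prop :=
  ∀ (S : ShortComplex (CochainComplex C ℤ)) (σ : ∀ n, (S.map (eval C _ n)).Splitting),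
    ∃ σ' : ∀ n, ((S.map G).map (eval D _ n)).Splitting,
      homOfDegreewiseSplit (S.map G) σ' =
        G.map (homOfDegreewiseSplit S σ) ≫ (G.commShiftIso (1 : ℤ)).hom.app S.X₁

namespace DerivedCategory

variable [Abelian C] [Abelian D] [HasDerivedCategory.{w₁} C] [HasDerivedCategory.{w₂} D]

theorem triangleOfDegreewiseSplit_distinguished (S : ShortComplex (CochainComplex C ℤ))
    (σ : ∀ n, (S.map (eval C _ n)).Splitting) :
    Q.mapTriangle.obj (triangleOfDegreewiseSplit S σ) ∈ distTriang (DerivedCategory C) := by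
  refine isomorphic_distinguished _ (Qh.map_distinguished (trianglehOfDegreewiseSplit S σ) ?_) _
    ((Functor.mapTriangleIso (quotientCompQhIso C)).symm.app _ ≪≫
      (Functor.mapTriangleCompIso (HomotopyCategory.quotient C _) Qh).app _)
  rw [HomotopyCategory.distinguished_iff_iso_trianglehOfDegreewiseSplit]
  exact ⟨S, σ, ⟨Iso.refl _⟩⟩

/-- Distinguished triangles of the derived category come from the homotopy category, where they are
given by degreewise split sequences. Hence a functor can be shown to be triangulated by looking at
such sequences only. -/
theorem exists_iso_triangleOfDegreewiseSplit {T : Triangle (DerivedCategory C)}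
    (hT : T ∈ distTriang (DerivedCategory C)) :
    ∃ (S : ShortComplex (CochainComplex C ℤ)) (σ : ∀ n, (S.map (eval C _ n)).Splitting),
      Nonempty (T ≅ Q.mapTriangle.obj (triangleOfDegreewiseSplit S σ)) := by
  obtain ⟨T', e, hT'⟩ := hT
  rw [HomotopyCategory.distinguished_iff_iso_trianglehOfDegreewiseSplit] at hT'
  obtain ⟨S, σ, ⟨e'⟩⟩ := hT'
  exact ⟨S, σ, ⟨e ≪≫ Qh.mapTriangle.mapIso e' ≪≫
      (Functor.mapTriangleCompIso (HomotopyCategory.quotient C _) Qh).symm.app _ ≪≫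
      (Functor.mapTriangleIso (quotientCompQhIso C)).app _⟩⟩

end DerivedCategory

namespace PreservesDegreewiseSplit

variable [Abelian C] [Abelian D]
variable {G : CochainComplex C ℤ ⥤ CochainComplex D ℤ} [G.Additive] [G.CommShift ℤ]

open DerivedCategory

theorem map_distinguished [HasDerivedCategory.{w₂} D] (hG : PreservesDegreewiseSplit G)
    (S : ShortComplex (CochainComplex C ℤ)) (σ : ∀ n, (S.map (eval C _ n)).Splitting) :
    Q.mapTriangle.obj (G.mapTriangle.obj (triangleOfDegreewiseSplit S σ)) ∈
      distTriang (DerivedCategory D) := by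
  obtain ⟨σ', h⟩ := hG S σ
  refine isomorphic_distinguished _ (triangleOfDegreewiseSplit_distinguished (S.map G) σ') _
    (Q.mapTriangle.mapIso (Triangle.isoMk _ _ (Iso.refl _) (Iso.refl _) (Iso.refl _) ?_ ?_ ?_))
  · exact (Category.comp_id _).trans (Category.id_comp _).symm
  · exact (Category.comp_id _).trans (Category.id_comp _).symm
  · refine (congrArg (_ ≫ ·) (CategoryTheory.Functor.map_id _ _)).trans ((Category.comp_id _).trans ?_)
    exact h.symm.trans (Category.id_comp _).symm

/-- It is the sequence L → cone → K⟦1⟧ that splits in every degree, so the triangle of the cone has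
to be rotated once before the hypothesis applies. -/
theorem map_mappingCone_distinguished [HasDerivedCategory.{w₂} D] (hG : PreservesDegreewiseSplit G)
    {K L : CochainComplex C ℤ} (φ : K ⟶ L) :
    Q.mapTriangle.obj (G.mapTriangle.obj (mappingCone.triangle φ)) ∈
      distTriang (DerivedCategory D) := by
  rw [rotate_distinguished_triangle]
  exact isomorphic_distinguished _ (hG.map_distinguished _ _) _
    (Q.mapTriangleRotateIso.app _ ≪≫ Q.mapTriangle.mapIso (G.mapTriangleRotateIso.app _) ≪≫
      Q.mapTriangle.mapIso
        (G.mapTriangle.mapIso (mappingCone.triangleRotateIsoTriangleOfDegreewiseSplit φ)))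

/-- A criterion that does not ask `φ` to be a quasi-isomorphism: only the image of its cone under
`G` has to be acyclic. It is applied to functors that cut with an idempotent and so kill complexes
that are not acyclic. -/
theorem quasiIso_map (hG : PreservesDegreewiseSplit G) {K L : CochainComplex C ℤ} (φ : K ⟶ L)
    (h : (G.obj (mappingCone φ)).Acyclic) : QuasiIso (G.map φ) := by
  let := HasDerivedCategory.standard D
  rw [← isIso_Q_map_iff_quasiIso]
  refine (Triangle.isZero₃_iff_isIso₁ _ (hG.map_mappingCone_distinguished φ)).1 ?_
  change IsZero (Q.obj (G.obj (mappingCone φ)))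
  -- The zero endomorphism of an acyclic complex is a quasi-isomorphism, so `Q` turns it into an
  -- invertible zero map, and the object vanishes.
  have : QuasiIso (0 : G.obj (mappingCone φ) ⟶ G.obj (mappingCone φ)) :=
    ⟨fun i => (quasiIsoAt_iff_exactAt _ _ (h i)).2 (h i)⟩
  have h0 := (isIso_Q_map_iff_quasiIso _
    (0 : G.obj (mappingCone φ) ⟶ G.obj (mappingCone φ))).2 this
  rw [CategoryTheory.Functor.map_zero] at h0
  exact (IsZero.iff_id_eq_zero _).2 (by
    rw [← cancel_mono (0 : Q.obj (G.obj (mappingCone φ)) ⟶ Q.obj (G.obj (mappingCone φ)))]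
    simp)

end PreservesDegreewiseSplit

/-! ### Descent of functors on complexes to derived categories -/

section Equivalence

variable [Abelian C] [Abelian D] [HasDerivedCategory.{w₁} C] [HasDerivedCategory.{w₂} D]
variable {G : CochainComplex C ℤ ⥤ CochainComplex D ℤ} [G.Additive] [G.CommShift ℤ]
variable {H : CochainComplex D ℤ ⥤ CochainComplex C ℤ}

open DerivedCategory

/-- Both functors preserve quasi-isomorphisms, so they factor through the localizations, where `c`
and `c'` become invertible. Preservation of degreewise split sequences is needed for `G` only,
because it serves to make the forward functor triangulated. -/
theorem exists_derivedEquivalence (hG : PreservesDegreewiseSplit G)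
    (hGq : ∀ ⦃K L : CochainComplex C ℤ⦄ (φ : K ⟶ L), QuasiIso φ → QuasiIso (G.map φ))
    (hHq : ∀ ⦃K L : CochainComplex D ℤ⦄ (φ : K ⟶ L), QuasiIso φ → QuasiIso (H.map φ))
    (c : G ⋙ H ⟶ 𝟭 _) (hc : ∀ K, QuasiIso (c.app K))
    (c' : H ⋙ G ⟶ 𝟭 _) (hc' : ∀ K, QuasiIso (c'.app K)) :
    ∃ (Φ : DerivedCategory C ≌ DerivedCategory D) (_ : Φ.functor.CommShift ℤ),
      Φ.functor.IsTriangulated ∧ Nonempty (Q ⋙ Φ.functor ≅ G ⋙ Q) ∧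
        Nonempty (Q ⋙ Φ.inverse ≅ H ⋙ Q) := by
  have hG' : (quasiIso C (ComplexShape.up ℤ)).IsInvertedBy (G ⋙ Q) := fun K L φ hφ => by
    have := hGq φ hφ
    exact inferInstanceAs (IsIso (Q.map (G.map φ)))
  have hH' : (quasiIso D (ComplexShape.up ℤ)).IsInvertedBy (H ⋙ Q) := fun K L φ hφ => by
    have := hHq φ hφ
    exact inferInstanceAs (IsIso (Q.map (H.map φ)))
  let F := Localization.lift (G ⋙ Q) hG' (Q (C := C))
  let F' := Localization.lift (H ⋙ Q) hH' (Q (C := D))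
  let e : Q ⋙ F ≅ G ⋙ Q := Localization.fac (G ⋙ Q) hG' Q
  let e' : Q ⋙ F' ≅ H ⋙ Q := Localization.fac (H ⋙ Q) hH' Q
  have i : IsIso (Functor.whiskerRight c Q) := by
    have : ∀ K, IsIso ((Functor.whiskerRight c Q).app K) := fun K => by
      have := hc K
      exact inferInstanceAs (IsIso (Q.map (c.app K)))
    exact NatIso.isIso_of_isIso_app _
  have i' : IsIso (Functor.whiskerRight c' Q) := by
    have : ∀ K, IsIso ((Functor.whiskerRight c' Q).app K) := fun K => by
      have := hc' K
      exact inferInstanceAs (IsIso (Q.map (c'.app K)))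
    exact NatIso.isIso_of_isIso_app _
  let η : F ⋙ F' ≅ 𝟭 _ := Localization.liftNatIso (Q (C := C)) (quasiIso C (ComplexShape.up ℤ))
    (Q ⋙ F ⋙ F') Q _ _
    (Functor.isoWhiskerRight e F' ≪≫ Functor.isoWhiskerLeft G e' ≪≫
      asIso (Functor.whiskerRight c Q))
  let ε : F' ⋙ F ≅ 𝟭 _ := Localization.liftNatIso (Q (C := D)) (quasiIso D (ComplexShape.up ℤ))
    (Q ⋙ F' ⋙ F) Q _ _
    (Functor.isoWhiskerRight e' F ≪≫ Functor.isoWhiskerLeft H e ≪≫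
      asIso (Functor.whiskerRight c' Q))
  let : Localization.Lifting Q (quasiIso C (ComplexShape.up ℤ)) (G ⋙ Q) F := ⟨e⟩
  let : F.CommShift ℤ :=
    Functor.commShiftOfLocalization Q (quasiIso C (ComplexShape.up ℤ)) ℤ (G ⋙ Q) F
  have : NatTrans.CommShift e.hom ℤ :=
    inferInstanceAs (NatTrans.CommShift (Localization.Lifting.iso Q
      (quasiIso C (ComplexShape.up ℤ)) (G ⋙ Q) F).hom ℤ)
  refine ⟨CategoryTheory.Equivalence.mk F F' η.symm ε, inferInstanceAs (F.CommShift ℤ), ?_, ⟨e⟩,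
    ⟨e'⟩⟩
  refine (⟨fun T hT => ?_⟩ : F.IsTriangulated)
  obtain ⟨S, σ, ⟨j⟩⟩ := exists_iso_triangleOfDegreewiseSplit hT
  exact isomorphic_distinguished _ (hG.map_distinguished S σ) _
    (F.mapTriangle.mapIso j ≪≫ (Functor.mapTriangleCompIso Q F).symm.app _ ≪≫
      (Functor.mapTriangleIso e).app _ ≪≫ (Functor.mapTriangleCompIso G Q).app _)

end Equivalence

end DerivedFunctors

/-! ### Total complexes attached to bifunctors -/

section FiniteCoproducts

open Limits

variable {C D : Type*} [Category* C] [Category* D] [Preadditive C] [Preadditive D]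

/-- An additive functor preserves coproducts of families with finitely many nonzero terms. -/
theorem preservesColimit_of_finite_support (F : C ⥤ D) [F.Additive] {J : Type*} (X : J → C)
    (s : Finset J) (hs : ∀ j ∉ s, IsZero (X j)) : PreservesColimit (Discrete.functor X) F where
  preserves {c} hc := by
    classical
    let i : ∀ j, X j ⟶ c.pt := fun j => c.ι.app ⟨j⟩
    let p : ∀ j, c.pt ⟶ X j := fun j => hc.desc (Cofan.mk (X j)
      (fun k => if h : k = j then eqToHom (by rw [h]) else 0))
    have hip : ∀ k j, i k ≫ p j = if h : k = j then eqToHom (by rw [h]) else 0 := fun k j =>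
      hc.fac _ ⟨k⟩
    -- As almost all terms vanish, the coproduct is a finite biproduct. This identity expresses it,
    -- and additive functors preserve such identities.
    have hsum : ∑ j ∈ s, p j ≫ i j = 𝟙 c.pt := by
      refine hc.hom_ext fun ⟨k⟩ => ?_
      change i k ≫ _ = i k ≫ _
      rw [Preadditive.comp_sum, Category.comp_id]
      by_cases hk : k ∈ s
      · rw [Finset.sum_eq_single_of_mem k hk, ← Category.assoc, hip, dif_pos rfl, eqToHom_refl,
          Category.id_comp]
        intro j _ hj
        rw [← Category.assoc, hip, dif_neg hj.symm, zero_comp]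
      · exact (hs k hk).eq_of_src _ _
    refine ⟨{ desc := fun t => ∑ j ∈ s, F.map (p j) ≫ t.ι.app ⟨j⟩, fac := ?_, uniq := ?_ }⟩
    · rintro t ⟨k⟩
      change F.map (i k) ≫ _ = _
      by_cases hk : k ∈ s
      · rw [Preadditive.comp_sum, Finset.sum_eq_single_of_mem k hk]
        · rw [← Category.assoc, ← F.map_comp, hip, dif_pos rfl, eqToHom_refl, F.map_id,
            Category.id_comp]
        · intro j _ hj
          rw [← Category.assoc, ← F.map_comp, hip, dif_neg hj.symm, F.map_zero, zero_comp]
      · exact (F.map_isZero (hs k hk)).eq_of_src _ _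
    · intro t m hm
      have h1 : 𝟙 (F.obj c.pt) = ∑ j ∈ s, F.map (p j) ≫ F.map (i j) := by
        simp_rw [← F.map_comp]
        rw [← F.map_sum, hsum, F.map_id]
      change F.obj c.pt ⟶ t.pt at m
      rw [← Category.id_comp m, h1, Preadditive.sum_comp]
      exact Finset.sum_congr rfl fun j _ => by
        rw [Category.assoc]; exact congrArg _ (hm ⟨j⟩)

end FiniteCoproducts

section TotalComplex

open Limits CochainComplex HomologicalComplex

variable {C₁ C₂ D : Type*} [Category* C₁] [Category* C₂] [Category* D]
variable [Preadditive C₁] [Preadditive C₂] [Preadditive D]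
variable (F : C₁ ⥤ C₂ ⥤ D) [F.Additive] [∀ X₁, (F.obj X₁).Additive]

/-- The components of the differential of the total complex. -/
theorem ι_mapBifunctor_d (K₁ : CochainComplex C₁ ℤ) (K₂ : CochainComplex C₂ ℤ)
    [CochainComplex.HasMapBifunctor K₁ K₂ F] (i j n m : ℤ) (h : i + j = n) (hm : n + 1 = m) :
    ιMapBifunctor K₁ K₂ F i j n h ≫ (CochainComplex.mapBifunctor K₁ K₂ F).d n m =
      (F.map (K₁.d i (i + 1))).app (K₂.X j) ≫ ιMapBifunctor K₁ K₂ F (i + 1) j m (by lia) +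
        i.negOnePow • ((F.obj (K₁.X i)).map (K₂.d j (j + 1)) ≫
          ιMapBifunctor K₁ K₂ F i (j + 1) m (by lia)) := by
  rw [mapBifunctor.d_eq, Preadditive.comp_add]
  have h1 := mapBifunctor.ι_D₁ K₁ K₂ F (ComplexShape.up ℤ) n m i j h
  have h2 := mapBifunctor.ι_D₂ K₁ K₂ F (ComplexShape.up ℤ) n m i j h
  rw [mapBifunctor.d₁_eq K₁ K₂ F (ComplexShape.up ℤ) (i₁ := i) (i₁' := i + 1) rfl j m
    (show i + 1 + j = m by lia)] at h1
  rw [mapBifunctor.d₂_eq K₁ K₂ F (ComplexShape.up ℤ) i (i₂ := j) (i₂' := j + 1) rfl m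
    (show i + (j + 1) = m by lia)] at h2
  refine (congrArg₂ (· + ·) h1 h2).trans ?_
  simp [ComplexShape.ε₁, ComplexShape.ε₂]

theorem isZero_obj_of_isZero {X : C₁} (hX : IsZero X) (Y : C₂) : IsZero ((F.obj X).obj Y) := by
  rw [IsZero.iff_id_eq_zero]
  have h := congrArg (fun φ => (F.map φ).app Y) ((IsZero.iff_id_eq_zero X).1 hX)
  simpa using h

variable [∀ (K₁ : CochainComplex C₁ ℤ) (K₂ : CochainComplex C₂ ℤ),
  CochainComplex.HasMapBifunctor K₁ K₂ F]

/-- The total complex of the double complex obtained by applying a bifunctor. -/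
abbrev totalOf (K₁ : CochainComplex C₁ ℤ) (K₂ : CochainComplex C₂ ℤ) : CochainComplex D ℤ :=
  (F.map₂CochainComplex.obj K₁).obj K₂

namespace totalOf

/-- The inclusion of a summand in the total complex. -/
def incl (K₁ : CochainComplex C₁ ℤ) (K₂ : CochainComplex C₂ ℤ) (i j n : ℤ) (h : i + j = n) :
    (F.obj (K₁.X i)).obj (K₂.X j) ⟶ (totalOf F K₁ K₂).X n :=
  ιMapBifunctor K₁ K₂ F i j n h

variable {F}
variable {K₁ : CochainComplex C₁ ℤ} {K₂ : CochainComplex C₂ ℤ}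

theorem hom_ext {n : ℤ} {Z : D} {f g : (totalOf F K₁ K₂).X n ⟶ Z}
    (hfg : ∀ (i j : ℤ) (h : i + j = n), incl F K₁ K₂ i j n h ≫ f = incl F K₁ K₂ i j n h ≫ g) :
    f = g :=
  mapBifunctor.hom_ext hfg

/-- Morphisms from a term of the total complex. -/
def desc {n : ℤ} {Z : D}
    (f : ∀ (i j : ℤ) (_ : i + j = n), (F.obj (K₁.X i)).obj (K₂.X j) ⟶ Z) :
    (totalOf F K₁ K₂).X n ⟶ Z :=
  mapBifunctorDesc f

@[simp]
theorem incl_desc {n : ℤ} {Z : D}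
    (f : ∀ (i j : ℤ) (_ : i + j = n), (F.obj (K₁.X i)).obj (K₂.X j) ⟶ Z) (i j : ℤ)
    (h : i + j = n) : incl F K₁ K₂ i j n h ≫ desc f = f i j h :=
  ι_mapBifunctorDesc _ _ _ _

@[simp]
theorem incl_desc_assoc {n : ℤ} {Z Z' : D}
    (f : ∀ (i j : ℤ) (_ : i + j = n), (F.obj (K₁.X i)).obj (K₂.X j) ⟶ Z) (i j : ℤ)
    (h : i + j = n) (g : Z ⟶ Z') : incl F K₁ K₂ i j n h ≫ desc f ≫ g = f i j h ≫ g := by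
  rw [← Category.assoc, incl_desc]

variable (F K₁ K₂)

theorem incl_d (i j n m : ℤ) (h : i + j = n) (hm : n + 1 = m) :
    incl F K₁ K₂ i j n h ≫ (totalOf F K₁ K₂).d n m =
      (F.map (K₁.d i (i + 1))).app (K₂.X j) ≫ incl F K₁ K₂ (i + 1) j m (by lia) +
        i.negOnePow • ((F.obj (K₁.X i)).map (K₂.d j (j + 1)) ≫
          incl F K₁ K₂ i (j + 1) m (by lia)) :=
  ι_mapBifunctor_d F K₁ K₂ i j n m h hm

theorem incl_d_assoc (i j n m : ℤ) (h : i + j = n) (hm : n + 1 = m) {Z : D}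
    (g : (totalOf F K₁ K₂).X m ⟶ Z) :
    incl F K₁ K₂ i j n h ≫ (totalOf F K₁ K₂).d n m ≫ g =
      ((F.map (K₁.d i (i + 1))).app (K₂.X j) ≫ incl F K₁ K₂ (i + 1) j m (by lia) +
        i.negOnePow • ((F.obj (K₁.X i)).map (K₂.d j (j + 1)) ≫
          incl F K₁ K₂ i (j + 1) m (by lia))) ≫ g := by
  rw [← Category.assoc, incl_d F K₁ K₂ i j n m h hm]

theorem incl_map {K L : CochainComplex C₂ ℤ} (φ : K ⟶ L) (i j n : ℤ) (h : i + j = n) :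
    incl F K₁ K i j n h ≫ ((F.map₂CochainComplex.obj K₁).map φ).f n =
      (F.obj (K₁.X i)).map (φ.f j) ≫ incl F K₁ L i j n h :=
  (ι_mapBifunctorMap _ _ _ _ _ _ _ _).trans (by simp [incl]; rfl)

theorem incl_map_assoc {K L : CochainComplex C₂ ℤ} (φ : K ⟶ L) (i j n : ℤ) (h : i + j = n)
    {Z : D} (g : (totalOf F K₁ L).X n ⟶ Z) :
    incl F K₁ K i j n h ≫ ((F.map₂CochainComplex.obj K₁).map φ).f n ≫ g =
      (F.obj (K₁.X i)).map (φ.f j) ≫ incl F K₁ L i j n h ≫ g := by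
  rw [← Category.assoc, incl_map, Category.assoc]

/-- The projection of the total complex onto a summand. -/
def proj (i j n : ℤ) : (totalOf F K₁ K₂).X n ⟶ (F.obj (K₁.X i)).obj (K₂.X j) :=
  desc fun i' j' _ => if h : i' = i ∧ j' = j then eqToHom (by rw [h.1, h.2]) else 0

variable {i j n : ℤ}

@[simp]
theorem incl_proj_self (h : i + j = n) : incl F K₁ K₂ i j n h ≫ proj F K₁ K₂ i j n = 𝟙 _ := by
  simp [proj]

@[simp]
theorem incl_proj_self_assoc (h : i + j = n) {Z : D} (g : (F.obj (K₁.X i)).obj (K₂.X j) ⟶ Z) :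
    incl F K₁ K₂ i j n h ≫ proj F K₁ K₂ i j n ≫ g = g := by
  rw [← Category.assoc, incl_proj_self, Category.id_comp]

theorem incl_proj_of_ne {i' j' : ℤ} (h : i' + j' = n) (hi : i' ≠ i) :
    incl F K₁ K₂ i' j' n h ≫ proj F K₁ K₂ i j n = 0 := by
  simp [proj, hi]

theorem incl_proj_of_ne_assoc {i' j' : ℤ} (h : i' + j' = n) (hi : i' ≠ i) {Z : D}
    (g : (F.obj (K₁.X i)).obj (K₂.X j) ⟶ Z) :
    incl F K₁ K₂ i' j' n h ≫ proj F K₁ K₂ i j n ≫ g = 0 := by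
  rw [← Category.assoc, incl_proj_of_ne _ _ _ h hi, Limits.zero_comp]

/-- Component (a + 1, b + 1) receives exactly two arrows. In this form the cocycle condition on an
element of the total complex can be read off one component at a time. -/
theorem d_proj (a b n m : ℤ) (hn : n + 1 = m) (h : a + 1 + (b + 1) = m) :
    (totalOf F K₁ K₂).d n m ≫ proj F K₁ K₂ (a + 1) (b + 1) m =
      proj F K₁ K₂ a (b + 1) n ≫ (F.map (K₁.d a (a + 1))).app (K₂.X (b + 1)) +
        (a + 1).negOnePow • (proj F K₁ K₂ (a + 1) b n ≫
          (F.obj (K₁.X (a + 1))).map (K₂.d b (b + 1))) := by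
  refine hom_ext fun i j hij => ?_
  rw [incl_d_assoc F K₁ K₂ i j n m hij hn, Preadditive.add_comp, Category.assoc,
    Linear.units_smul_comp, Category.assoc, Preadditive.comp_add, Linear.comp_units_smul]
  by_cases h1 : i = a
  · obtain rfl := h1
    obtain rfl : j = b + 1 := by lia
    rw [incl_proj_self, incl_proj_of_ne _ _ _ _ (by lia), incl_proj_self_assoc,
      incl_proj_of_ne_assoc _ _ _ _ (by lia)]
    simp
  · by_cases h2 : i = a + 1
    · obtain rfl := h2
      obtain rfl : j = b := by lia
      rw [incl_proj_self, incl_proj_of_ne _ _ _ _ (by lia), incl_proj_self_assoc,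
        incl_proj_of_ne_assoc _ _ _ _ (by lia)]
      simp
    · rw [incl_proj_of_ne _ _ _ _ (by lia), incl_proj_of_ne _ _ _ _ (by lia),
        incl_proj_of_ne_assoc _ _ _ _ (by lia), incl_proj_of_ne_assoc _ _ _ _ (by lia)]
      simp

theorem sum_proj_incl (s : Finset ℤ) (hs : ∀ i ∉ s, IsZero (K₁.X i)) (n : ℤ) :
    ∑ i ∈ s, proj F K₁ K₂ i (n - i) n ≫ incl F K₁ K₂ i (n - i) n (by lia) = 𝟙 _ := by
  refine hom_ext fun i j h => ?_
  obtain rfl : j = n - i := by lia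
  rw [Preadditive.comp_sum, Category.comp_id]
  by_cases hi : i ∈ s
  · rw [Finset.sum_eq_single_of_mem i hi, incl_proj_self_assoc]
    intro k _ hk
    rw [incl_proj_of_ne_assoc _ _ _ _ (Ne.symm hk)]
  · exact (isZero_obj_of_isZero F (hs i hi) _).eq_of_src _ _

end totalOf

instance (K₁ : CochainComplex C₁ ℤ) : (F.map₂CochainComplex.obj K₁).Additive where
  map_add {K L f g} := by
    ext n : 1
    refine totalOf.hom_ext fun i j h => ?_
    rw [HomologicalComplex.add_f_apply, Preadditive.comp_add, totalOf.incl_map, totalOf.incl_map,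
      totalOf.incl_map, HomologicalComplex.add_f_apply, Functor.map_add, Preadditive.add_comp]

/-- The splittings of `S` are applied column by column. In the connecting morphism s ≫ d ≫ r the
part of d coming from `K₁` contributes nothing, because it commutes with s and r and s ≫ r = 0. The
part coming from `S.X₂` carries the sign (-1)^i, which is the sign in the compatibility of the total
complex with a shift of the second variable. -/
theorem preservesDegreewiseSplit_map₂ (K₁ : CochainComplex C₁ ℤ) :
    PreservesDegreewiseSplit (F.map₂CochainComplex.obj K₁) := by
  intro S σ
  let T := F.map₂CochainComplex.obj K₁
  let r₀ : ∀ j, S.X₂.X j ⟶ S.X₁.X j := fun j => (σ j).r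
  let s₀ : ∀ j, S.X₃.X j ⟶ S.X₂.X j := fun j => (σ j).s
  have fr : ∀ j, S.f.f j ≫ r₀ j = 𝟙 _ := fun j => (σ j).f_r
  have sg : ∀ j, s₀ j ≫ S.g.f j = 𝟙 _ := fun j => (σ j).s_g
  have sr : ∀ j, s₀ j ≫ r₀ j = 0 := fun j => (σ j).s_r
  have idd : ∀ j, r₀ j ≫ S.f.f j + S.g.f j ≫ s₀ j = 𝟙 _ := fun j => (σ j).id
  have hδ : ∀ j, (homOfDegreewiseSplit S σ).f j = s₀ j ≫ S.X₂.d j (j + 1) ≫ r₀ (j + 1) :=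
    fun j => homOfDegreewiseSplit_f S σ j
  let r : ∀ n, (T.obj S.X₂).X n ⟶ (T.obj S.X₁).X n := fun n =>
    totalOf.desc fun i j h => (F.obj (K₁.X i)).map (r₀ j) ≫ totalOf.incl F K₁ S.X₁ i j n h
  let s : ∀ n, (T.obj S.X₃).X n ⟶ (T.obj S.X₂).X n := fun n =>
    totalOf.desc fun i j h => (F.obj (K₁.X i)).map (s₀ j) ≫ totalOf.incl F K₁ S.X₂ i j n h
  have hr : ∀ (i j n : ℤ) (h : i + j = n), totalOf.incl F K₁ S.X₂ i j n h ≫ r n =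
      (F.obj (K₁.X i)).map (r₀ j) ≫ totalOf.incl F K₁ S.X₁ i j n h := fun i j n h =>
    totalOf.incl_desc _ _ _ _
  have hs : ∀ (i j n : ℤ) (h : i + j = n), totalOf.incl F K₁ S.X₃ i j n h ≫ s n =
      (F.obj (K₁.X i)).map (s₀ j) ≫ totalOf.incl F K₁ S.X₂ i j n h := fun i j n h =>
    totalOf.incl_desc _ _ _ _
  have h1 : ∀ n, (T.map S.f).f n ≫ r n = 𝟙 ((T.obj S.X₁).X n) := fun n =>
    totalOf.hom_ext fun i j h => by
      rw [totalOf.incl_map_assoc, hr, ← Functor.map_comp_assoc, fr, CategoryTheory.Functor.map_id,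
        Category.id_comp, Category.comp_id]
  have h2 : ∀ n, s n ≫ (T.map S.g).f n = 𝟙 ((T.obj S.X₃).X n) := fun n =>
    totalOf.hom_ext fun i j h => by
      rw [reassoc_of% (hs i j n h), totalOf.incl_map, ← Functor.map_comp_assoc, sg,
        CategoryTheory.Functor.map_id, Category.id_comp, Category.comp_id]
  have h3 : ∀ n, r n ≫ (T.map S.f).f n + (T.map S.g).f n ≫ s n = 𝟙 ((T.obj S.X₂).X n) := fun n =>
    totalOf.hom_ext fun i j h => by
      rw [Preadditive.comp_add, totalOf.incl_map_assoc, hs, reassoc_of% (hr i j n h),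
        totalOf.incl_map, ← Functor.map_comp_assoc, ← Functor.map_comp_assoc,
        ← Preadditive.add_comp, ← Functor.map_add, idd, CategoryTheory.Functor.map_id,
        Category.id_comp, Category.comp_id]
  refine ⟨fun n => { r := r n, s := s n, f_r := h1 n, s_g := h2 n, id := h3 n }, ?_⟩
  -- Shifting the second factor past degree i of the first costs the sign (-1)^i.
  have h4 : ∀ (i j n : ℤ) (h : i + j = n), totalOf.incl F K₁ (S.X₁⟦(1 : ℤ)⟧) i j n h ≫
      ((T.commShiftIso (1 : ℤ)).hom.app S.X₁).f n =
      i.negOnePow • totalOf.incl F K₁ S.X₁ i (j + 1) (n + 1) (by lia) := fun i j n h => by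
    have h5 := ι_mapBifunctorShift₂Iso_hom_f K₁ S.X₁ F 1 i j n h (j + 1) (n + 1) rfl rfl
    refine h5.trans ?_
    simp only [shiftFunctorObjXIso, mul_one, Iso.refl_inv, HomologicalComplex.XIsoOfEq_rfl]
    refine congrArg _ ?_
    refine (congrArg₂ (· ≫ ·) ((F.obj (K₁.X i)).map_id _) (Category.comp_id _)).trans ?_
    exact Category.id_comp _
  ext n : 1
  refine totalOf.hom_ext fun i j h => ?_
  change _ ≫ (homOfDegreewiseSplit (S.map T) _).f n =
    _ ≫ (T.map (homOfDegreewiseSplit S σ)).f n ≫ ((T.commShiftIso (1 : ℤ)).hom.app S.X₁).f n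
  rw [homOfDegreewiseSplit_f]
  change _ ≫ (s n ≫ (T.obj S.X₂).d n (n + 1) ≫ r (n + 1)) = _
  rw [reassoc_of% (hs i j n h), totalOf.incl_map_assoc, h4,
    totalOf.incl_d_assoc F K₁ S.X₂ i j n (n + 1) h rfl, hδ]
  simp only [Preadditive.add_comp, Preadditive.comp_add, Category.assoc, hr,
    Linear.units_smul_comp, Linear.comp_units_smul]
  -- Naturality moves the differential of `K₁` aside, and `s₀ ≫ r₀ = 0` removes its contribution.
  rw [NatTrans.naturality_assoc, ← Functor.map_comp_assoc, ← Functor.map_comp_assoc, sr,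
    Functor.map_zero, Limits.zero_comp, Limits.comp_zero, zero_add]
  simp

/-! ### Additive functors applied to total complexes -/

section MapTotalIso

variable {C₁' C₂' D' : Type*} [Category* C₁'] [Category* C₂'] [Category* D']
variable [Preadditive C₁'] [Preadditive C₂'] [Preadditive D']
variable (F' : C₁' ⥤ C₂' ⥤ D') [F'.Additive] [∀ X₁, (F'.obj X₁).Additive]
variable [∀ (K₁ : CochainComplex C₁' ℤ) (K₂ : CochainComplex C₂' ℤ),
  CochainComplex.HasMapBifunctor K₁ K₂ F']
variable (G : D ⥤ D') [G.Additive]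
variable {F F' G}
variable {K₁ : CochainComplex C₁ ℤ} {K₂ : CochainComplex C₂ ℤ}
variable {L₁ : CochainComplex C₁' ℤ} {L₂ : CochainComplex C₂' ℤ}
variable (α : ∀ i j, (F'.obj (L₁.X i)).obj (L₂.X j) ≅ G.obj ((F.obj (K₁.X i)).obj (K₂.X j)))

namespace totalOf

/-- The components of `totalOf.mapIso`. -/
def mapIsoHom (n : ℤ) : (totalOf F' L₁ L₂).X n ⟶ G.obj ((totalOf F K₁ K₂).X n) :=
  desc fun i j h => (α i j).hom ≫ G.map (incl F K₁ K₂ i j n h)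

theorem incl_mapIsoHom (i j n : ℤ) (h : i + j = n) :
    incl F' L₁ L₂ i j n h ≫ mapIsoHom α n = (α i j).hom ≫ G.map (incl F K₁ K₂ i j n h) :=
  incl_desc _ _ _ _

theorem incl_mapIsoHom_assoc (i j n : ℤ) (h : i + j = n) {Z : D'}
    (g : G.obj ((totalOf F K₁ K₂).X n) ⟶ Z) :
    incl F' L₁ L₂ i j n h ≫ mapIsoHom α n ≫ g =
      (α i j).hom ≫ G.map (incl F K₁ K₂ i j n h) ≫ g :=
  (incl_desc_assoc _ _ _ _ _).trans (Category.assoc _ _ _)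

theorem mapIsoHom_comp_sum (s : Finset ℤ) (hs : ∀ i ∉ s, IsZero (K₁.X i)) (n : ℤ) :
    mapIsoHom α n ≫
      (∑ i ∈ s, G.map (proj F K₁ K₂ i (n - i) n) ≫ (α i (n - i)).inv ≫
        incl F' L₁ L₂ i (n - i) n (by lia)) = 𝟙 _ := by
  refine hom_ext fun i j h => ?_
  obtain rfl : j = n - i := by lia
  rw [incl_mapIsoHom_assoc, Preadditive.comp_sum, Preadditive.comp_sum, Category.comp_id]
  by_cases hi : i ∈ s
  · rw [Finset.sum_eq_single_of_mem i hi]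
    · rw [← G.map_comp_assoc, incl_proj_self, CategoryTheory.Functor.map_id,
        Category.id_comp, Iso.hom_inv_id_assoc]
    · intro k _ hk
      rw [← G.map_comp_assoc, incl_proj_of_ne _ _ _ _ (Ne.symm hk),
        CategoryTheory.Functor.map_zero, Limits.zero_comp, Limits.comp_zero]
  · exact ((G.map_isZero (isZero_obj_of_isZero F (hs i hi) _)).of_iso (α i (n - i))).eq_of_src _ _

theorem sum_comp_mapIsoHom (s : Finset ℤ) (hs : ∀ i ∉ s, IsZero (K₁.X i)) (n : ℤ) :
    (∑ i ∈ s, G.map (proj F K₁ K₂ i (n - i) n) ≫ (α i (n - i)).inv ≫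
        incl F' L₁ L₂ i (n - i) n (by lia)) ≫ mapIsoHom α n = 𝟙 _ := by
  rw [Preadditive.sum_comp, ← G.map_id, ← sum_proj_incl F K₁ K₂ s hs n, G.map_sum]
  exact Finset.sum_congr rfl fun i _ => by simp [incl_mapIsoHom]

variable (h₁ : ∀ i j, (F'.map (L₁.d i (i + 1))).app (L₂.X j) ≫ (α (i + 1) j).hom =
      (α i j).hom ≫ G.map ((F.map (K₁.d i (i + 1))).app (K₂.X j)))
    (h₂ : ∀ i j, (F'.obj (L₁.X i)).map (L₂.d j (j + 1)) ≫ (α i (j + 1)).hom =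
      (α i j).hom ≫ G.map ((F.obj (K₁.X i)).map (K₂.d j (j + 1))))

include h₁ h₂ in
theorem mapIsoHom_comm (n : ℤ) :
    mapIsoHom α n ≫ G.map ((totalOf F K₁ K₂).d n (n + 1)) =
      (totalOf F' L₁ L₂).d n (n + 1) ≫ mapIsoHom α (n + 1) := by
  refine hom_ext fun i j h => ?_
  rw [incl_mapIsoHom_assoc, incl_d_assoc F' L₁ L₂ i j n _ h rfl, Preadditive.add_comp,
    Category.assoc, incl_mapIsoHom, Linear.units_smul_comp, Category.assoc, incl_mapIsoHom,
    reassoc_of% (h₁ i j), reassoc_of% (h₂ i j), ← G.map_comp, incl_d F K₁ K₂ i j n _ h rfl,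
    G.map_add, Functor.map_units_smul, G.map_comp, G.map_comp, Preadditive.comp_add,
    Linear.comp_units_smul]

theorem mapIsoHom_naturality {K₂' : CochainComplex C₂ ℤ} {L₂' : CochainComplex C₂' ℤ}
    (α' : ∀ i j, (F'.obj (L₁.X i)).obj (L₂'.X j) ≅ G.obj ((F.obj (K₁.X i)).obj (K₂'.X j)))
    (φ : L₂ ⟶ L₂') (ψ : K₂ ⟶ K₂')
    (h : ∀ i j, (F'.obj (L₁.X i)).map (φ.f j) ≫ (α' i j).hom =
      (α i j).hom ≫ G.map ((F.obj (K₁.X i)).map (ψ.f j))) (n : ℤ) :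
    ((F'.map₂CochainComplex.obj L₁).map φ).f n ≫ mapIsoHom α' n =
      mapIsoHom α n ≫ G.map (((F.map₂CochainComplex.obj K₁).map ψ).f n) := by
  refine hom_ext fun i j hij => ?_
  rw [incl_map_assoc, incl_mapIsoHom, incl_mapIsoHom_assoc, reassoc_of% (h i j), ← G.map_comp,
    ← G.map_comp, incl_map]

/-- An additive functor commutes with the formation of total complexes of double complexes with
finitely many nonzero columns. -/
def mapIso (s : Finset ℤ) (hs : ∀ i ∉ s, IsZero (K₁.X i)) :
    totalOf F' L₁ L₂ ≅ (G.mapHomologicalComplex (ComplexShape.up ℤ)).obj (totalOf F K₁ K₂) :=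
  HomologicalComplex.Hom.isoOfComponents (fun n =>
    { hom := mapIsoHom α n
      inv := ∑ i ∈ s, G.map (proj F K₁ K₂ i (n - i) n) ≫ (α i (n - i)).inv ≫
        incl F' L₁ L₂ i (n - i) n (by lia)
      hom_inv_id := mapIsoHom_comp_sum α s hs n
      inv_hom_id := sum_comp_mapIsoHom α s hs n }) (by
    rintro n m rfl
    exact mapIsoHom_comm α h₁ h₂ n)

end totalOf

end MapTotalIso

end TotalComplex

/-! ### Associativity of total complexes -/

section Associator

open Limits CochainComplex HomologicalComplex

variable {C₁ C₂ C₁₂ C₂₃ C₃ C₄ : Type*}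
  [Category* C₁] [Category* C₂] [Category* C₃] [Category* C₄] [Category* C₁₂] [Category* C₂₃]
  [Preadditive C₁] [Preadditive C₂] [Preadditive C₃]
  [Preadditive C₁₂] [Preadditive C₂₃] [Preadditive C₄]
  {F₁₂ : C₁ ⥤ C₂ ⥤ C₁₂} {G : C₁₂ ⥤ C₃ ⥤ C₄}
  {F : C₁ ⥤ C₂₃ ⥤ C₄} {G₂₃ : C₂ ⥤ C₃ ⥤ C₂₃}
  [F₁₂.Additive] [∀ X₁, (F₁₂.obj X₁).Additive] [G.Additive] [∀ X, (G.obj X).Additive]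
  [F.Additive] [∀ X₁, (F.obj X₁).Additive] [G₂₃.Additive] [∀ X, (G₂₃.obj X).Additive]
  (α : bifunctorComp₁₂ F₁₂ G ≅ bifunctorComp₂₃ F G₂₃)
  (K₁ : CochainComplex C₁ ℤ) (K₂ : CochainComplex C₂ ℤ)

/-- The components of an associator between bifunctors. -/
def associatorApp (X : C₁) (Y : C₂) (Z : C₃) :
    (G.obj ((F₁₂.obj X).obj Y)).obj Z ⟶ (F.obj X).obj ((G₂₃.obj Y).obj Z) :=
  ((α.hom.app X).app Y).app Z

theorem map_associatorApp (X : C₁) (Y : C₂) {Z Z' : C₃} (φ : Z ⟶ Z') :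
    (G.obj ((F₁₂.obj X).obj Y)).map φ ≫ associatorApp α X Y Z' =
      associatorApp α X Y Z ≫ (F.obj X).map ((G₂₃.obj Y).map φ) :=
  ((α.hom.app X).app Y).naturality φ

theorem finite_fiber_of_finset (t : Finset ℤ) {c : ℤ} :
    {x : (fun p : ℤ × ℤ => p.1 + p.2) ⁻¹' {c} | x.1.1 ∈ t}.Finite := by
  refine Set.Finite.of_finite_image (f := fun x => x.1.1) (t.finite_toSet.subset ?_) ?_
  · rintro _ ⟨x, hx, rfl⟩; exact hx
  · rintro ⟨⟨a, b⟩, h⟩ _ ⟨⟨a', b'⟩, h'⟩ _ hh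
    simp at h h' hh
    ext <;> dsimp <;> lia

/-- Associativity requires the outer bifunctor to commute with the coproducts that define the inner
total complex. Boundedness of `K₁` makes these coproducts finite, and then additivity suffices. -/
theorem hasGoodTrifunctor₁₂Obj_of_finite (s : Finset ℤ) (hs : ∀ i ∉ s, IsZero (K₁.X i))
    (K₃ : CochainComplex C₃ ℤ) :
    HasGoodTrifunctor₁₂Obj F₁₂ G K₁ K₂ K₃ (ComplexShape.up ℤ) (ComplexShape.up ℤ) := by
  intro a b
  have : (G.flip.obj (K₃.X b)).Additive := ⟨fun {X Y f g} => by simp⟩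
  exact preservesColimit_of_finite_support _ _ (finite_fiber_of_finset s).toFinset
    fun j hj => isZero_obj_of_isZero F₁₂ (hs _ fun h => hj ((finite_fiber_of_finset s).mem_toFinset.2 h)) _

theorem hasGoodTrifunctor₂₃Obj_of_finite (s : Finset ℤ) (hs : ∀ i ∉ s, IsZero (K₂.X i))
    (K₃ : CochainComplex C₃ ℤ) :
    HasGoodTrifunctor₂₃Obj F G₂₃ K₁ K₂ K₃ (ComplexShape.up ℤ) (ComplexShape.up ℤ) 
      (ComplexShape.up ℤ) := by
  intro a b
  exact preservesColimit_of_finite_support _ _ (finite_fiber_of_finset s).toFinset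
    fun j hj => isZero_obj_of_isZero G₂₃ (hs _ fun h => hj ((finite_fiber_of_finset s).mem_toFinset.2 h)) _

variable [∀ (K : CochainComplex C₁ ℤ) (L : CochainComplex C₂ ℤ), CochainComplex.HasMapBifunctor K L F₁₂]
  [∀ (K : CochainComplex C₁₂ ℤ) (L : CochainComplex C₃ ℤ), CochainComplex.HasMapBifunctor K L G]
  [∀ (K : CochainComplex C₁ ℤ) (L : CochainComplex C₂₃ ℤ), CochainComplex.HasMapBifunctor K L F]
  [∀ (K : CochainComplex C₂ ℤ) (L : CochainComplex C₃ ℤ), CochainComplex.HasMapBifunctor K L G₂₃]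

variable {K₁ K₂} in
/-- Associativity of the formation of total complexes. -/
def totalOf.associator (s : Finset ℤ) (hs : ∀ i ∉ s, IsZero (K₁.X i)) (t : Finset ℤ)
    (ht : ∀ i ∉ t, IsZero (K₂.X i)) (K₃ : CochainComplex C₃ ℤ) :
    totalOf G (totalOf F₁₂ K₁ K₂) K₃ ≅ totalOf F K₁ (totalOf G₂₃ K₂ K₃) :=
  haveI := hasGoodTrifunctor₁₂Obj_of_finite (F₁₂ := F₁₂) (G := G) K₁ K₂ s hs K₃
  haveI := hasGoodTrifunctor₂₃Obj_of_finite (F := F) (G₂₃ := G₂₃) K₁ K₂ t ht K₃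
  HomologicalComplex.mapBifunctorAssociator α K₁ K₂ K₃ (ComplexShape.up ℤ) (ComplexShape.up ℤ)
    (ComplexShape.up ℤ)

variable {K₁ K₂} in
theorem totalOf.incl_associator_hom (s : Finset ℤ) (hs : ∀ i ∉ s, IsZero (K₁.X i)) (t : Finset ℤ)
    (ht : ∀ i ∉ t, IsZero (K₂.X i)) (K₃ : CochainComplex C₃ ℤ)
    (i j k a b n : ℤ) (ha : i + j = a) (hb : j + k = b) (h : a + k = n) :
    (G.map (totalOf.incl F₁₂ K₁ K₂ i j a ha)).app (K₃.X k) ≫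
      totalOf.incl G (totalOf F₁₂ K₁ K₂) K₃ a k n h ≫ 
        (totalOf.associator α s hs t ht K₃).hom.f n = 
      associatorApp α (K₁.X i) (K₂.X j) (K₃.X k) ≫
        (F.obj (K₁.X i)).map (totalOf.incl G₂₃ K₂ K₃ j k b hb) ≫ 
          totalOf.incl F K₁ (totalOf G₂₃ K₂ K₃) i b n (by lia) := by
  have := hasGoodTrifunctor₁₂Obj_of_finite (F₁₂ := F₁₂) (G := G) K₁ K₂ s hs K₃
  have := hasGoodTrifunctor₂₃Obj_of_finite (F := F) (G₂₃ := G₂₃) K₁ K₂ t ht K₃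
  have h1 := mapBifunctor₁₂.ι_eq F₁₂ G K₁ K₂ K₃ (ComplexShape.up ℤ) (ComplexShape.up ℤ) i j k a n
    ha h
  have h2 := mapBifunctor₂₃.ι_eq F G₂₃ K₁ K₂ K₃ (ComplexShape.up ℤ) (ComplexShape.up ℤ)
    (ComplexShape.up ℤ) i j k b n hb (show i + b = n by lia)
  have h3 := ι_mapBifunctorAssociatorX_hom α K₁ K₂ K₃ (ComplexShape.up ℤ) (ComplexShape.up ℤ)
    (ComplexShape.up ℤ) i j k n (show i + j + k = n by lia)
  rw [h1, h2] at h3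
  exact (Category.assoc _ _ _).symm.trans h3

variable {K₁ K₂} in
theorem totalOf.incl_associator_hom_assoc (s : Finset ℤ) (hs : ∀ i ∉ s, IsZero (K₁.X i))
    (t : Finset ℤ) (ht : ∀ i ∉ t, IsZero (K₂.X i)) (K₃ : CochainComplex C₃ ℤ)
    (i j k a b n : ℤ) (ha : i + j = a) (hb : j + k = b) (h : a + k = n) {Z : C₄}
    (g : (totalOf F K₁ (totalOf G₂₃ K₂ K₃)).X n ⟶ Z) :
    (G.map (totalOf.incl F₁₂ K₁ K₂ i j a ha)).app (K₃.X k) ≫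
      totalOf.incl G (totalOf F₁₂ K₁ K₂) K₃ a k n h ≫
        (totalOf.associator α s hs t ht K₃).hom.f n ≫ g =
      associatorApp α (K₁.X i) (K₂.X j) (K₃.X k) ≫
        (F.obj (K₁.X i)).map (totalOf.incl G₂₃ K₂ K₃ j k b hb) ≫
          totalOf.incl F K₁ (totalOf G₂₃ K₂ K₃) i b n (by lia) ≫ g := by
  have h1 := totalOf.incl_associator_hom α s hs t ht K₃ i j k a b n ha hb h
  simpa only [Category.assoc] using congrArg (· ≫ g) h1

variable {K₁ K₂} in
theorem totalOf.hom_ext₁₂ (s : Finset ℤ) (hs : ∀ i ∉ s, IsZero (K₁.X i))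
    (K₃ : CochainComplex C₃ ℤ) {n : ℤ} {Z : C₄}
    {f g : (totalOf G (totalOf F₁₂ K₁ K₂) K₃).X n ⟶ Z}
    (hfg : ∀ (i j k a : ℤ) (ha : i + j = a) (h : a + k = n),
      (G.map (totalOf.incl F₁₂ K₁ K₂ i j a ha)).app (K₃.X k) ≫
        totalOf.incl G (totalOf F₁₂ K₁ K₂) K₃ a k n h ≫ f =
      (G.map (totalOf.incl F₁₂ K₁ K₂ i j a ha)).app (K₃.X k) ≫
        totalOf.incl G (totalOf F₁₂ K₁ K₂) K₃ a k n h ≫ g) : f = g := by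
  have := hasGoodTrifunctor₁₂Obj_of_finite (F₁₂ := F₁₂) (G := G) K₁ K₂ s hs K₃
  refine mapBifunctor₁₂.hom_ext fun i j k h => ?_
  have h1 := mapBifunctor₁₂.ι_eq F₁₂ G K₁ K₂ K₃ (ComplexShape.up ℤ) (ComplexShape.up ℤ) i j k
    (i + j) n rfl h
  rw [h1]
  exact (Category.assoc _ _ _).trans ((hfg i j k (i + j) rfl h).trans (Category.assoc _ _ _).symm)

variable {K₁ K₂} in
/-- Naturality of `totalOf.associator` -/
theorem totalOf.associator_naturality (s : Finset ℤ) (hs : ∀ i ∉ s, IsZero (K₁.X i)) (t : Finset ℤ)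
    (ht : ∀ i ∉ t, IsZero (K₂.X i)) {K₃ L₃ : CochainComplex C₃ ℤ} (φ : K₃ ⟶ L₃) :
    (G.map₂CochainComplex.obj (totalOf F₁₂ K₁ K₂)).map φ ≫
      (totalOf.associator α s hs t ht L₃).hom =
    (totalOf.associator α s hs t ht K₃).hom ≫
      (F.map₂CochainComplex.obj K₁).map ((G₂₃.map₂CochainComplex.obj K₂).map φ) := by
  ext n : 1
  refine totalOf.hom_ext₁₂ s hs K₃ fun i j k a ha h => ?_
  rw [comp_f, comp_f, totalOf.incl_map_assoc, ← NatTrans.naturality_assoc,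
    totalOf.incl_associator_hom α s hs t ht L₃ i j k a (j + k) n ha rfl h,
    totalOf.incl_associator_hom_assoc α s hs t ht K₃ i j k a (j + k) n ha rfl h,
    totalOf.incl_map, ← Functor.map_comp_assoc, totalOf.incl_map]
  rw [reassoc_of% (map_associatorApp α (K₁.X i) (K₂.X j) (φ.f k)), Functor.map_comp_assoc]

end Associator

/-! ### Double complexes with one column -/

section SingleColumn

open Limits CochainComplex HomologicalComplex

variable {C₁ C₂ D : Type*} [Category* C₁] [Category* C₂] [Category* D]
variable [Preadditive C₁] [Preadditive C₂] [Preadditive D]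
variable {F : C₁ ⥤ C₂ ⥤ D} [F.Additive] [∀ X₁, (F.obj X₁).Additive]
variable [∀ (K₁ : CochainComplex C₁ ℤ) (K₂ : CochainComplex C₂ ℤ),
  CochainComplex.HasMapBifunctor K₁ K₂ F]
variable {K₁ : CochainComplex C₁ ℤ} {K₂ : CochainComplex C₂ ℤ} {L : CochainComplex D ℤ}

/-- The total complex of a double complex with a single nonzero column. -/
def totalOf.isoOfSingle (α : ∀ j, L.X j ≅ (F.obj (K₁.X 0)).obj (K₂.X j))
    (h₁ : ∀ i ∉ ({0} : Finset ℤ), IsZero (K₁.X i))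
    (h₂ : ∀ j, L.d j (j + 1) ≫ (α (j + 1)).hom =
      (α j).hom ≫ (F.obj (K₁.X 0)).map (K₂.d j (j + 1))) : L ≅ totalOf F K₁ K₂ :=
  HomologicalComplex.Hom.isoOfComponents (fun n =>
    { hom := (α n).hom ≫ totalOf.incl F K₁ K₂ 0 n n (zero_add n)
      inv := totalOf.proj F K₁ K₂ 0 n n ≫ (α n).inv
      hom_inv_id := by simp
      inv_hom_id := by
        rw [Category.assoc, Iso.inv_hom_id_assoc]
        refine Eq.trans ?_ (totalOf.sum_proj_incl F K₁ K₂ {0} h₁ n)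
        have : ∀ (a b : ℤ) (h : a = b) (h' : 0 + b = n),
            totalOf.proj F K₁ K₂ 0 a n ≫ totalOf.incl F K₁ K₂ 0 a n (by lia) =
              totalOf.proj F K₁ K₂ 0 b n ≫ totalOf.incl F K₁ K₂ 0 b n h' := by
          rintro a _ rfl _; rfl
        rw [Finset.sum_singleton]
        exact this _ _ (by lia) _ }) (by
    rintro n m rfl
    dsimp only
    rw [Category.assoc, totalOf.incl_d F K₁ K₂ 0 n n _ (zero_add n) rfl, reassoc_of% (h₂ n),
      -- The neighbouring column vanishes, and in column 0 the sign of the remaining differential is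
      -- trivial.
      (h₁ (0 + 1) (by simp)).eq_of_tgt (K₁.d 0 (0 + 1)) 0]
    simp)

end SingleColumn

/-! ### Pure tensors -/

namespace BalancedTensor

variable {O S : Type u} [CommRing O] [Ring S]
variable {M N : Type u} [AddCommGroup M] [Module O M] [Module Sᵐᵒᵖ M] [SMulCommClass O Sᵐᵒᵖ M]
variable [AddCommGroup N] [Module O N] [Module S N]
variable {P : Type*} [AddCommGroup P]

/-- The additive map from `M ⊗_S N` determined by a balanced biadditive map. -/
def liftAdd (f : M →+ N →+ P) (ho : ∀ (o : O) m n, f (o • m) n = f m (o • n))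
    (hs : ∀ (s : S) m n, f (op s • m) n = f m (s • n)) : BalancedTensor O S M N →+ P :=
  QuotientAddGroup.lift (balancedRel O S M N).toAddSubgroup (TensorProduct.liftAddHom f ho) (by
    intro x hx
    rw [Submodule.mem_toAddSubgroup, balancedRel, ← Submodule.mem_toAddSubmonoid, Submodule.span_eq_closure] at hx
    induction hx using AddSubmonoid.closure_induction with
    | zero => exact map_zero _
    | add x y _ _ hx hy => exact (map_add _ _ _).trans (by rw [hx, hy, add_zero])
    | mem x hx =>
      obtain ⟨o, -, _, ⟨m, s, n, rfl⟩, rfl⟩ := hx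
      -- `P` carries no `O`-action, so the span has been unfolded into sums of `O`-multiples of
      -- relations. Such a multiple is absorbed into the left factor, where it commutes with `S`,
      -- and is a relation again.
      change TensorProduct.liftAddHom f ho (o • (_ - _)) = 0
      rw [smul_sub, TensorProduct.smul_tmul', TensorProduct.smul_tmul', map_sub,
        TensorProduct.liftAddHom_tmul, TensorProduct.liftAddHom_tmul, smul_comm, hs, sub_self])

theorem mk_smul_tmul (s : S) (m : M) (n : N) :
    mk O S M N ((op s • m) ⊗ₜ n) = mk O S M N (m ⊗ₜ (s • n)) :=
  (Submodule.Quotient.eq _).2 (Submodule.subset_span ⟨m, s, n, rfl⟩)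

end BalancedTensor

namespace BimodCat

variable {O R S T : Type u} [CommRing O] [Ring R] [Algebra O R] [Ring S] [Algebra O S]
variable [Ring T] [Algebra O T]

attribute [local instance] baseModule leftModule rightModule
attribute [local instance] smulCommClass isScalarTower_base isScalarTower_left isScalarTower_right

section Act

variable (M : BimodCat O R S) (V : ModuleCat.{u} S)

/-- The biadditive map `(m, v) ↦ m ⊗ v` to `M ⊗_S V`. -/
def actTmul : M →+ V →+ actObj M V :=
  AddMonoidHom.mk' (fun m => AddMonoidHom.mk' (fun v => BalancedTensor.mk O S M V (m ⊗ₜ v))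
    fun v w => by
      rw [TensorProduct.tmul_add]; exact map_add _ _ _) fun m m' => by
    ext v
    exact (congrArg (BalancedTensor.mk O S M V) (TensorProduct.add_tmul m m' v)).trans
      (map_add _ _ _)

variable {M V}

theorem smul_actTmul (r : R) (m : M) (v : V) :
    r • actTmul M V m v = actTmul M V ((r ⊗ₜ[O] (1 : Sᵐᵒᵖ)) • m) v := rfl

theorem actTmul_smul (s : S) (m : M) (v : V) :
    actTmul M V (((1 : R) ⊗ₜ[O] op s) • m) v = actTmul M V m (s • v) :=
  BalancedTensor.mk_smul_tmul s m v

@[elab_as_elim]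
theorem act_induction {motive : actObj M V → Prop}
    (tmul : ∀ m v, motive (actTmul M V m v))
    (add : ∀ x y, motive x → motive y → motive (x + y)) (x : actObj M V) : motive x :=
  BalancedTensor.induction (motive := motive) tmul add x

theorem act_addHom_ext {P : Type*} [AddCommGroup P] {f g : actObj M V →+ P}
    (h : ∀ m v, f (actTmul M V m v) = g (actTmul M V m v)) : f = g := by
  ext x
  induction x using act_induction with
  | tmul m v => exact h m v
  | add x y hx hy => rw [map_add, map_add, hx, hy]

theorem act_hom_ext {P : ModuleCat.{u} R} {f g : actObj M V ⟶ P}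
    (h : ∀ m v, f.hom (actTmul M V m v) = g.hom (actTmul M V m v)) : f = g :=
  actObj_hom_ext h

/-- The additive map from `M ⊗_S V` determined by a balanced biadditive map. -/
def actLiftAdd {P : Type*} [AddCommGroup P] (f : M →+ V →+ P)
    (hf : ∀ (s : S) m v, f (((1 : R) ⊗ₜ[O] op s) • m) v = f m (s • v)) : actObj M V →+ P :=
  BalancedTensor.liftAdd f (fun o m v => by
    have := hf (algebraMap O S o) m v
    rw [← base_smul_def V o v] at this
    rw [← this, base_smul_def, Algebra.TensorProduct.algebraMap_apply' ]
    rfl) hf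

@[simp]
theorem actLiftAdd_tmul {P : Type*} [AddCommGroup P] (f : M →+ V →+ P)
    (hf : ∀ (s : S) m v, f (((1 : R) ⊗ₜ[O] op s) • m) v = f m (s • v)) (m : M) (v : V) :
    actLiftAdd f hf (actTmul M V m v) = f m v := rfl

theorem actLiftAdd_smul {W : ModuleCat.{u} R} (f : M →+ V →+ W)
    (hs : ∀ (s : S) m v, f (((1 : R) ⊗ₜ[O] op s) • m) v = f m (s • v))
    (hr : ∀ (r : R) m v, f ((r ⊗ₜ[O] (1 : Sᵐᵒᵖ)) • m) v = r • f m v) (r : R) (x : actObj M V) :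
    actLiftAdd f hs (r • x) = r • actLiftAdd f hs x :=
  DFunLike.congr_fun (act_addHom_ext
    (f := (actLiftAdd f hs).comp (DistribSMul.toAddMonoidHom (actObj M V) r))
    (g := (DistribSMul.toAddMonoidHom W r).comp (actLiftAdd f hs)) (hr r)) x

/-- The homomorphism from `M ⊗_S V` determined by a balanced biadditive map. -/
def actLift {W : ModuleCat.{u} R} (f : M →+ V →+ W)
    (hs : ∀ (s : S) m v, f (((1 : R) ⊗ₜ[O] op s) • m) v = f m (s • v))
    (hr : ∀ (r : R) m v, f ((r ⊗ₜ[O] (1 : Sᵐᵒᵖ)) • m) v = r • f m v) : actObj M V ⟶ W :=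
  ModuleCat.ofHom (X := actObj M V) (Y := W)
    { toFun := actLiftAdd f hs
      map_add' := map_add _
      map_smul' := actLiftAdd_smul f hs hr }

@[simp]
theorem actLift_tmul {W : ModuleCat.{u} R} (f : M →+ V →+ W)
    (hs : ∀ (s : S) m v, f (((1 : R) ⊗ₜ[O] op s) • m) v = f m (s • v))
    (hr : ∀ (r : R) m v, f ((r ⊗ₜ[O] (1 : Sᵐᵒᵖ)) • m) v = r • f m v) (m : M) (v : V) :
    (actLift f hs hr).hom (actTmul M V m v) = f m v := rfl

end Act

section Tensor

variable (M : BimodCat O R S) (N : BimodCat O S T)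

/-- The biadditive map `(m, n) ↦ m ⊗ n` to `M ⊗_S N`. -/
def tmul : M →+ N →+ tensorObj M N :=
  AddMonoidHom.mk' (fun m => AddMonoidHom.mk' (fun n => BalancedTensor.mk O S M N (m ⊗ₜ n))
    fun v w => by
      rw [TensorProduct.tmul_add]; exact map_add _ _ _) fun m m' => by
    ext v
    exact (congrArg (BalancedTensor.mk O S M N) (TensorProduct.add_tmul m m' v)).trans
      (map_add _ _ _)

variable {M N}

theorem smul_tmul (r : R) (t : Tᵐᵒᵖ) (m : M) (n : N) :
    (r ⊗ₜ[O] t) • tmul M N m n =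
      tmul M N ((r ⊗ₜ[O] (1 : Sᵐᵒᵖ)) • m) (((1 : S) ⊗ₜ[O] t) • n) := rfl

theorem tmul_smul (s : S) (m : M) (n : N) :
    tmul M N (((1 : R) ⊗ₜ[O] op s) • m) n = tmul M N m ((s ⊗ₜ[O] (1 : Tᵐᵒᵖ)) • n) :=
  BalancedTensor.mk_smul_tmul s m n

theorem left_smul_tmul (r : R) (m : M) (n : N) :
    (r ⊗ₜ[O] (1 : Tᵐᵒᵖ)) • tmul M N m n = tmul M N ((r ⊗ₜ[O] (1 : Sᵐᵒᵖ)) • m) n := by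
  rw [smul_tmul, ← Algebra.TensorProduct.one_def, one_smul]

theorem right_smul_tmul (t : Tᵐᵒᵖ) (m : M) (n : N) :
    ((1 : R) ⊗ₜ[O] t) • tmul M N m n = tmul M N m (((1 : S) ⊗ₜ[O] t) • n) := by
  rw [smul_tmul, ← Algebra.TensorProduct.one_def, one_smul]

@[elab_as_elim]
theorem tensor_induction {motive : tensorObj M N → Prop}
    (tmul : ∀ m n, motive (tmul M N m n))
    (add : ∀ x y, motive x → motive y → motive (x + y)) (x : tensorObj M N) : motive x :=
  BalancedTensor.induction (motive := motive) tmul add x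

/-- The additive map from `M ⊗_S N` determined by a balanced biadditive map. -/
def tensorLiftAdd {P : Type*} [AddCommGroup P] (f : M →+ N →+ P)
    (hf : ∀ (s : S) m n, f (((1 : R) ⊗ₜ[O] op s) • m) n = f m ((s ⊗ₜ[O] (1 : Tᵐᵒᵖ)) • n)) :
    tensorObj M N →+ P :=
  BalancedTensor.liftAdd f (fun o m n => by
    have := hf (algebraMap O S o) m n
    rw [base_smul_def N, Algebra.TensorProduct.algebraMap_apply, ← this, base_smul_def M,
      Algebra.TensorProduct.algebraMap_apply']
    rfl) hf

@[simp]
theorem tensorLiftAdd_tmul {P : Type*} [AddCommGroup P] (f : M →+ N →+ P)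
    (hf : ∀ (s : S) m n, f (((1 : R) ⊗ₜ[O] op s) • m) n = f m ((s ⊗ₜ[O] (1 : Tᵐᵒᵖ)) • n)) 
    (m : M) (n : N) : tensorLiftAdd f hf (tmul M N m n) = f m n := rfl

end Tensor

/-! ### Associativity of the action of bimodules on modules -/

section Assoc

variable (M : BimodCat O R S) (N : BimodCat O S T) (V : ModuleCat.{u} T)

/-- The biadditive map `(x, v) ↦ m ⊗ (n ⊗ v)` for `x = m ⊗ n`. -/
def actAssocAux : tensorObj M N →+ V →+ actObj M (actObj N V) :=
  tensorLiftAdd (AddMonoidHom.mk' (fun m => AddMonoidHom.mk'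
      (fun n => (actTmul M (actObj N V) m).comp (actTmul N V n))
      (fun n n' => by ext v; simp)) (fun m m' => by ext n v; simp))
    (fun s m n => by
      ext v
      exact (actTmul_smul s m (actTmul N V n v)).trans
        (congrArg _ (smul_actTmul s n v)))

@[simp]
theorem actAssocAux_tmul (m : M) (n : N) (v : V) :
    actAssocAux M N V (tmul M N m n) v = actTmul M _ m (actTmul N V n v) := rfl

attribute [local irreducible] actObj tensorObj in
/-- The homomorphism `(m ⊗ n) ⊗ v ↦ m ⊗ (n ⊗ v)`. -/
def actAssocHom : actObj (tensorObj M N) V ⟶ actObj M (actObj N V) :=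
  actLift (actAssocAux M N V)
    (fun t x v => by
      induction x using tensor_induction with
      | tmul m n =>
        rw [right_smul_tmul, actAssocAux_tmul, actAssocAux_tmul, actTmul_smul]
      | add x y hx hy =>
        rw [smul_add, map_add, map_add, AddMonoidHom.add_apply, AddMonoidHom.add_apply, hx, hy])
    (fun r x v => by
      induction x using tensor_induction with
      | tmul m n => rw [left_smul_tmul, actAssocAux_tmul, actAssocAux_tmul, smul_actTmul]
      | add x y hx hy =>
        rw [smul_add, map_add, map_add, AddMonoidHom.add_apply, AddMonoidHom.add_apply, hx, hy,
          smul_add])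

/-- The biadditive map `(m, x) ↦ (m ⊗ n) ⊗ v` for `x = n ⊗ v`. -/
def actAssocInvAux : M →+ actObj N V →+ actObj (tensorObj M N) V :=
  AddMonoidHom.mk' (fun m => actLiftAdd ((actTmul (tensorObj M N) V).comp (tmul M N m))
      (fun t n v => by
        exact (congrArg (fun y => actTmul _ V y v) (right_smul_tmul (op t) m n).symm).trans
          (actTmul_smul t (tmul M N m n) v)))
      (fun m m' => act_addHom_ext fun n v => by simp)

@[simp]
theorem actAssocInvAux_tmul (m : M) (n : N) (v : V) :
    actAssocInvAux M N V m (actTmul N V n v) = actTmul _ V (tmul M N m n) v := rfl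

attribute [local irreducible] actObj tensorObj in
/-- The homomorphism `m ⊗ (n ⊗ v) ↦ (m ⊗ n) ⊗ v`. -/
def actAssocInv : actObj M (actObj N V) ⟶ actObj (tensorObj M N) V :=
  actLift (actAssocInvAux M N V)
    (fun s m x => by
      induction x using act_induction with
      | tmul n v => rw [smul_actTmul, actAssocInvAux_tmul, actAssocInvAux_tmul, tmul_smul]
      | add x y hx hy => rw [smul_add, map_add, map_add, hx, hy])
    (fun r m x => by
      induction x using act_induction with
      | tmul n v => rw [actAssocInvAux_tmul, actAssocInvAux_tmul, smul_actTmul, left_smul_tmul]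
      | add x y hx hy => rw [map_add, map_add, hx, hy, smul_add])

variable {M N V} in
theorem actAct_hom_ext {P : ModuleCat.{u} R} {f g : actObj M (actObj N V) ⟶ P}
    (h : ∀ m n v, f.hom (actTmul M _ m (actTmul N V n v)) =
      g.hom (actTmul M _ m (actTmul N V n v))) : f = g :=
  act_hom_ext fun m x => by
    induction x using act_induction with
    | tmul n v => exact h m n v
    | add x y hx hy => rw [map_add, map_add, hx, hy, map_add]

variable {M N V} in
theorem tensorAct_hom_ext {P : ModuleCat.{u} R} {f g : actObj (tensorObj M N) V ⟶ P}
    (h : ∀ m n v, f.hom (actTmul _ V (tmul M N m n) v) = g.hom (actTmul _ V (tmul M N m n) v)) :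
    f = g :=
  act_hom_ext fun x v => by
    induction x using tensor_induction with
    | tmul m n => exact h m n v
    | add x y hx hy =>
      rw [map_add, AddMonoidHom.add_apply, map_add, hx, hy, map_add]

/-- Associativity `(M ⊗ N) ⊗ V ≅ M ⊗ (N ⊗ V)`. -/
def actAssoc : actObj (tensorObj M N) V ≅ actObj M (actObj N V) where
  hom := actAssocHom M N V
  inv := actAssocInv M N V
  hom_inv_id := tensorAct_hom_ext fun _ _ _ => rfl
  inv_hom_id := actAct_hom_ext fun _ _ _ => rfl

variable (O R S T) in
/-- The associativity isomorphism as an isomorphism of trifunctors. -/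
def actAssociator : bifunctorComp₁₂ (tensorBifunctor O R S T) (actBifunctor O R T) ≅
    bifunctorComp₂₃ (actBifunctor O R S) (actBifunctor O S T) :=
  NatIso.ofComponents (fun M => NatIso.ofComponents (fun N => NatIso.ofComponents
    (fun V => actAssoc M N V) fun _ => tensorAct_hom_ext fun _ _ _ => rfl)
    fun _ => NatTrans.ext (funext fun V => tensorAct_hom_ext fun _ _ _ => rfl))
    fun _ => NatTrans.ext (funext fun N => NatTrans.ext (funext fun V =>
      tensorAct_hom_ext fun _ _ _ => rfl))

end Assoc

/-! ### The regular bimodule as a unit -/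

section Unit

variable (O R) in
/-- An element of the algebra `R` as an element of the regular bimodule. -/
def toRegular : R →+ regular O R := AddMonoidHom.id R

theorem smul_toRegular (r : R) (s : Rᵐᵒᵖ) (x : R) :
    (r ⊗ₜ[O] s) • toRegular O R x = toRegular O R (r * (x * s.unop)) :=
  TensorProduct.Algebra.smul_def r s x

attribute [local irreducible] actObj in
/-- The homomorphism `v ↦ 1 ⊗ v`. -/
def actUnitHom (V : ModuleCat.{u} R) : V ⟶ actObj (regular O R) V :=
  ModuleCat.ofHom (Y := actObj (regular O R) V)
    { toFun := actTmul (regular O R) V (toRegular O R 1)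
      map_add' := map_add _
      map_smul' := fun r v => by
        rw [← actTmul_smul, RingHom.id_apply, smul_actTmul, smul_toRegular, smul_toRegular]
        simp }

/-- The homomorphism `r ⊗ v ↦ r • v`. -/
def actUnitInv (V : ModuleCat.{u} R) : actObj (regular O R) V ⟶ V :=
  actLift (AddMonoidHom.mk' (fun r => DistribSMul.toAddMonoidHom V (show R from r))
    (fun r s => by ext v; exact add_smul (show R from r) s v))
    (fun s x v => by
      change R at x
      have := smul_toRegular (O := O) 1 (op s) x
      refine (congrArg (fun y : R => y • v) this).trans ?_
      change (1 * (x * s)) • v = x • s • v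
      rw [one_mul, mul_smul])
    (fun s x v => by
      change R at x
      have := smul_toRegular (O := O) s 1 x
      refine (congrArg (fun y : R => y • v) this).trans ?_
      change (s * (x * 1)) • v = s • x • v
      rw [mul_one, mul_smul])

variable (O) in
/-- The isomorphism `V ≅ R ⊗ V`. -/
def actUnit (V : ModuleCat.{u} R) : V ≅ actObj (regular O R) V where
  hom := actUnitHom V
  inv := actUnitInv V
  hom_inv_id := by
    ext v
    exact one_smul R v
  inv_hom_id := act_hom_ext fun r v => by
    change actTmul (regular O R) V (toRegular O R 1) ((show R from r) • v) = actTmul _ V r v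
    rw [← actTmul_smul]
    congr 2
    refine (smul_toRegular 1 (op (show R from r)) 1).trans ?_
    simp
    rfl

end Unit

end BimodCat

/-! ### Tensoring with complexes of bimodules -/

section TensorFunctor

open Limits BimodCat CochainComplex

variable {O R S T : Type u} [CommRing O] [Ring R] [Algebra O R] [Ring S] [Algebra O S]
variable [Ring T] [Algebra O T]

theorem IsBoundedComplex.exists_finset {C : Type*} [Category* C] [HasZeroMorphisms C]
    {K : CochainComplex C ℤ} (hK : IsBoundedComplex K) :
    ∃ s : Finset ℤ, ∀ i ∉ s, IsZero (K.X i) := by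
  obtain ⟨n, hn⟩ := hK
  exact ⟨Finset.Icc (-n) n, fun i hi => hn i (by
    rw [Finset.mem_Icc, ← abs_le] at hi; lia)⟩

instance (M : CochainComplex (BimodCat O R S) ℤ) : (tensorFunctor O R S M).Additive :=
  inferInstanceAs ((actBifunctor O R S).map₂CochainComplex.obj M).Additive

instance (M : CochainComplex (BimodCat O R S) ℤ) : (tensorFunctor O R S M).CommShift ℤ :=
  inferInstanceAs (((actBifunctor O R S).map₂CochainComplex.obj M).CommShift ℤ)

theorem preservesDegreewiseSplit_tensorFunctor (M : CochainComplex (BimodCat O R S) ℤ) :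
    PreservesDegreewiseSplit (tensorFunctor O R S M) :=
  preservesDegreewiseSplit_map₂ _ M

/-- The functor `M ⊗ -` is natural in `M`. -/
def tensorFunctorMap {M M' : CochainComplex (BimodCat O R S) ℤ} (φ : M ⟶ M') :
    tensorFunctor O R S M ⟶ tensorFunctor O R S M' :=
  (actBifunctor O R S).map₂CochainComplex.map φ

/-- Homotopic morphisms of complexes of bimodules induce homotopic morphisms. -/
def tensorFunctorHomotopy {M M' : CochainComplex (BimodCat O R S) ℤ} {φ ψ : M ⟶ M'}
    (h : Homotopy φ ψ) (K : CochainComplex (ModuleCat.{u} S) ℤ) :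
    Homotopy ((tensorFunctorMap φ).app K) ((tensorFunctorMap ψ).app K) :=
  HomologicalComplex.mapBifunctorMapHomotopy₁ h (𝟙 K) (actBifunctor O R S) (ComplexShape.up ℤ)

/-- The functor `M ⊗ -` sends homotopic morphisms to homotopic morphisms. -/
def homotopyTensorFunctorMap (M : CochainComplex (BimodCat O R S) ℤ)
    {K L : CochainComplex (ModuleCat.{u} S) ℤ} {φ ψ : K ⟶ L} (h : Homotopy φ ψ) :
    Homotopy ((tensorFunctor O R S M).map φ) ((tensorFunctor O R S M).map ψ) :=
  HomologicalComplex.mapBifunctorMapHomotopy₂ (𝟙 M) h (actBifunctor O R S) (ComplexShape.up ℤ)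

/-- Associativity of tensor products of complexes. -/
def tensorFunctorComp (M : CochainComplex (BimodCat O R S) ℤ) (N : CochainComplex (BimodCat O S T) ℤ)
    (s : Finset ℤ) (hs : ∀ i ∉ s, IsZero (M.X i)) (t : Finset ℤ)
    (ht : ∀ i ∉ t, IsZero (N.X i)) :
    tensorFunctor O R T (tensorComplex O R S T M N) ≅
      tensorFunctor O S T N ⋙ tensorFunctor O R S M :=
  NatIso.ofComponents (fun K => totalOf.associator (actAssociator O R S T) s hs t ht K)
    fun φ => totalOf.associator_naturality (actAssociator O R S T) s hs t ht φ

variable (O R) in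
/-- The terms of the isomorphism `K ≅ R ⊗ K`. -/
def regularTensorIsoX (V : ModuleCat.{u} R) :
    V ≅ ((actBifunctor O R R).obj ((regularComplex O R).X 0)).obj V :=
  actUnit O V ≪≫ ((actBifunctor O R R).mapIso
    (HomologicalComplex.singleObjXSelf (ComplexShape.up ℤ) 0 (regular O R)).symm).app V

theorem regularTensorIsoX_naturality {V W : ModuleCat.{u} R} (φ : V ⟶ W) :
    φ ≫ (regularTensorIsoX O R W).hom = (regularTensorIsoX O R V).hom ≫
      ((actBifunctor O R R).obj ((regularComplex O R).X 0)).map φ := by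
  have h := ((actBifunctor O R R).map
    (HomologicalComplex.singleObjXSelf (ComplexShape.up ℤ) 0 (regular O R)).inv).naturality φ
  change φ ≫ (actUnit O W).hom ≫ _ = ((actUnit O V).hom ≫ _) ≫ _
  exact (congrArg ((actUnit O V).hom ≫ ·) h).trans (Category.assoc _ _ _).symm

theorem isZero_regularComplex_X (i : ℤ) (hi : i ∉ ({0} : Finset ℤ)) :
    IsZero ((regularComplex O R).X i) :=
  HomologicalComplex.isZero_single_obj_X _ _ _ _ (by simpa using hi)

/-- The isomorphism `K ≅ R ⊗ K`. -/
def regularTensorIso (K : CochainComplex (ModuleCat.{u} R) ℤ) :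
    K ≅ totalOf (actBifunctor O R R) (regularComplex O R) K :=
  totalOf.isoOfSingle (fun n => regularTensorIsoX O R (K.X n)) isZero_regularComplex_X
    fun j => regularTensorIsoX_naturality _

variable (O R) in
/-- The natural isomorphism `K ≅ R ⊗ K`. -/
def regularTensorNatIso : 𝟭 _ ≅ tensorFunctor O R R (regularComplex O R) :=
  NatIso.ofComponents regularTensorIso fun {K L} φ => by
    ext n : 1
    change φ.f n ≫ (regularTensorIsoX O R (L.X n)).hom ≫
      totalOf.incl (actBifunctor O R R) _ L 0 n n (zero_add n) =
        ((regularTensorIsoX O R (K.X n)).hom ≫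
      totalOf.incl (actBifunctor O R R) _ K 0 n n (zero_add n)) ≫ 
        (((actBifunctor O R R).map₂CochainComplex.obj (regularComplex O R)).map φ).f n
    rw [Category.assoc, totalOf.incl_map, reassoc_of% (regularTensorIsoX_naturality (φ.f n))]

theorem tensorFunctorMap_comp {M M' M'' : CochainComplex (BimodCat O R S) ℤ} (φ : M ⟶ M')
    (ψ : M' ⟶ M'') (K : CochainComplex (ModuleCat.{u} S) ℤ) :
    (tensorFunctorMap φ).app K ≫ (tensorFunctorMap ψ).app K = (tensorFunctorMap (φ ≫ ψ)).app K := by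
  rw [tensorFunctorMap, tensorFunctorMap, tensorFunctorMap, Functor.map_comp]; rfl

theorem tensorFunctorMap_id (M : CochainComplex (BimodCat O R S) ℤ)
    (K : CochainComplex (ModuleCat.{u} S) ℤ) : (tensorFunctorMap (𝟙 M)).app K = 𝟙 _ := by
  rw [tensorFunctorMap, CategoryTheory.Functor.map_id]; rfl

/-- A homotopy equivalence of complexes of bimodules induces homotopy equivalences. -/
def tensorFunctorHomotopyEquiv {M M' : CochainComplex (BimodCat O R S) ℤ} (h : HomotopyEquiv M M')
    (K : CochainComplex (ModuleCat.{u} S) ℤ) :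
    HomotopyEquiv ((tensorFunctor O R S M).obj K) ((tensorFunctor O R S M').obj K) where
  hom := (tensorFunctorMap h.hom).app K
  inv := (tensorFunctorMap h.inv).app K
  homotopyHomInvId := (Homotopy.ofEq (tensorFunctorMap_comp _ _ K)).trans
    ((tensorFunctorHomotopy h.homotopyHomInvId K).trans (Homotopy.ofEq (tensorFunctorMap_id _ K)))
  homotopyInvHomId := (Homotopy.ofEq (tensorFunctorMap_comp _ _ K)).trans
    ((tensorFunctorHomotopy h.homotopyInvHomId K).trans (Homotopy.ofEq (tensorFunctorMap_id _ K)))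

/-- A homotopy equivalence `M ⊗ N ≃ R` induces a natural transformation from `M ⊗ (N ⊗ -)` to the
identity functor, whose components are homotopy equivalences. -/
theorem exists_counit (M : CochainComplex (BimodCat O R S) ℤ)
    (N : CochainComplex (BimodCat O S R) ℤ) (hM : IsBoundedComplex M) (hN : IsBoundedComplex N)
    (h : HomotopyEquiv (tensorComplex O R S R M N) (regularComplex O R)) :
    ∃ c : tensorFunctor O S R N ⋙ tensorFunctor O R S M ⟶ 𝟭 _,
      ∀ K, ∃ e : HomotopyEquiv ((tensorFunctor O R S M).obj ((tensorFunctor O S R N).obj K)) K,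
        e.hom = c.app K := by
  obtain ⟨s, hs⟩ := hM.exists_finset
  obtain ⟨t, ht⟩ := hN.exists_finset
  let α := tensorFunctorComp M N s hs t ht
  let β := regularTensorNatIso O R
  refine ⟨α.inv ≫ tensorFunctorMap h.hom ≫ β.inv, fun K => ?_⟩
  exact ⟨((HomotopyEquiv.ofIso (α.symm.app K)).trans (tensorFunctorHomotopyEquiv h K)).trans
    (HomotopyEquiv.ofIso (β.symm.app K)), Category.assoc _ _ _⟩

end TensorFunctor

/-! ### Dual bases and exactness of tensor products -/

section DualBasis

open BimodCat

variable {O R S T : Type u} [CommRing O] [Ring R] [Algebra O R] [Ring S] [Algebra O S]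
variable [Ring T] [Algebra O T]

namespace BimodCat

/-- A right linear map from a bimodule to the algebra acting on the right. -/
structure RightDual (M : BimodCat O R S) where
  /-- The underlying additive map. -/
  toFun : M →+ S
  map_smul (s : S) (m : M) : toFun (((1 : R) ⊗ₜ[O] op s) • m) = toFun m * s

/-- A left linear map from a bimodule to the algebra acting on the left. -/
structure LeftDual (M : BimodCat O R S) where
  /-- The underlying additive map. -/
  toFun : M →+ R
  map_smul (r : R) (m : M) : toFun ((r ⊗ₜ[O] (1 : Sᵐᵒᵖ)) • m) = r * toFun m

/-- The vectors are the images of the standard basis under a surjection from a free module, and the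
forms are the coordinates of a section of it. -/
theorem exists_dualBasis {A V : Type*} [Ring A] [AddCommGroup V] [Module A V] [Module.Finite A V]
    [Module.Projective A V] :
    ∃ (n : ℕ) (v : Fin n → V) (q : Fin n → V →ₗ[A] A), ∀ x, x = ∑ k, q k x • v k := by
  obtain ⟨n, g, hg⟩ := Module.Finite.exists_fin' A V
  obtain ⟨h, hh⟩ := Module.projective_lifting_property g LinearMap.id hg
  refine ⟨n, fun k => g (Pi.single k 1), fun k => LinearMap.proj k ∘ₗ h, fun x => ?_⟩
  have h1 := LinearMap.congr_fun hh x
  conv_lhs => rw [← LinearMap.id_apply (R := A) x, ← h1, LinearMap.comp_apply,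
    pi_eq_sum_univ' (h x)]
  rw [map_sum]
  refine Finset.sum_congr rfl fun k _ => ?_
  rw [map_smul]
  rfl

theorem exists_rightDualBasis {M : BimodCat O R S} (hM : IsFGProjectiveBimod M) :
    ∃ (n : ℕ) (v : Fin n → M) (q : Fin n → RightDual M),
      ∀ x, x = ∑ k, ((1 : R) ⊗ₜ[O] op ((q k).toFun x)) • v k := by
  let := rightModule M
  have := hM.right_finite
  have := hM.right_projective
  obtain ⟨n, v, q, h⟩ := exists_dualBasis (A := Sᵐᵒᵖ) (V := M)
  exact ⟨n, v, fun k => ⟨(opAddEquiv (α := S)).symm.toAddMonoidHom.comp (q k).toAddMonoidHom,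
    fun s m => congrArg unop ((q k).map_smul (op s) m)⟩, h⟩

theorem exists_leftDualBasis {M : BimodCat O R S} (hM : IsFGProjectiveBimod M) :
    ∃ (n : ℕ) (v : Fin n → M) (q : Fin n → LeftDual M),
      ∀ x, x = ∑ k, (((q k).toFun x) ⊗ₜ[O] (1 : Sᵐᵒᵖ)) • v k := by
  let := leftModule M
  have := hM.left_finite
  have := hM.left_projective
  obtain ⟨n, v, q, h⟩ := exists_dualBasis (A := R) (V := M)
  exact ⟨n, v, fun k => ⟨(q k).toAddMonoidHom, fun s m => (q k).map_smul s m⟩, h⟩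

variable {M : BimodCat O R S} {V W : ModuleCat.{u} S}

/-- The contraction `m ⊗ v ↦ q m • v`. -/
def contract (q : RightDual M) (V : ModuleCat.{u} S) : actObj M V →+ V :=
  actLiftAdd ((smulAddHom S V).comp q.toFun) (fun s m v => by
    simp [q.map_smul, mul_smul])

@[simp]
theorem contract_tmul (q : RightDual M) (m : M) (v : V) :
    contract q V (actTmul M V m v) = q.toFun m • v := rfl

theorem contract_map (q : RightDual M) (g : V ⟶ W) (x : actObj M V) :
    contract q W ((actMap (𝟙 M) g).hom x) = g.hom (contract q V x) := by
  induction x using act_induction with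
  | tmul m v => 
    exact (g.hom.map_smul (q.toFun m) v).symm
  | add x y hx hy => rw [map_add, map_add, map_add, map_add, hx, hy]

/-- A dual basis of `M` presents M ⊗ V as a direct summand of V^n, naturally in `V`. This replaces
flatness in all later arguments: exactness and vanishing are tested on the coordinates in `V`. -/
theorem eq_sum_contract {n : ℕ} {v : Fin n → M} {q : Fin n → RightDual M}
    (h : ∀ x, x = ∑ k, ((1 : R) ⊗ₜ[O] op ((q k).toFun x)) • v k) (x : actObj M V) :
    x = ∑ k, actTmul M V (v k) (contract (q k) V x) := by
  induction x using act_induction with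
  | tmul m w =>
    conv_lhs => rw [h m, map_sum, AddMonoidHom.finsetSum_apply]
    exact Finset.sum_congr rfl fun k _ => by rw [actTmul_smul, contract_tmul]
  | add x y hx hy =>
    conv_lhs => rw [hx, hy]
    simp only [map_add, Finset.sum_add_distrib]

/-- Tensoring with a bimodule which is finitely generated projective on the right is exact. -/
theorem act_exact (hM : IsFGProjectiveBimod M) {U V W : ModuleCat.{u} S} (f : U ⟶ V) (g : V ⟶ W)
    (hfg : ∀ v, g.hom v = 0 → ∃ w, f.hom w = v) (x : actObj M V)
    (hx : (actMap (𝟙 M) g).hom x = 0) :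
    ∃ y, (actMap (𝟙 M) f).hom y = x := by
  obtain ⟨n, v, q, h⟩ := exists_rightDualBasis hM
  -- Contraction commutes with `g`, so every coordinate of `x` lies in the kernel of `g` and can be
  -- lifted separately.
  choose w hw using fun k => hfg (contract (q k) V x) (by rw [← contract_map, hx, map_zero])
  refine ⟨∑ k, actTmul M U (v k) (w k), ?_⟩
  rw [map_sum]
  conv_rhs => rw [eq_sum_contract h x]
  exact Finset.sum_congr rfl fun k _ => congrArg (actTmul M V (v k)) (hw k)

theorem act_injective (hM : IsFGProjectiveBimod M) (g : V ⟶ W)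
    (hg : Function.Injective g.hom) :
    Function.Injective (actMap (𝟙 M) g).hom := by
  rw [injective_iff_map_eq_zero]
  intro x hx
  obtain ⟨y, rfl⟩ := act_exact hM (0 : V ⟶ V) g (fun v hv => 
    ⟨0, (map_zero _).trans ((injective_iff_map_eq_zero _).1 hg v hv).symm⟩) x hx
  exact congrArg (fun φ => φ.hom y)
    (((actBifunctor O R S).obj M).map_zero V V)

theorem act_surjective (M : BimodCat O R S) (g : V ⟶ W)
    (hg : Function.Surjective g.hom) :
    Function.Surjective (actMap (𝟙 M) g).hom := by
  intro x
  induction x using act_induction with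
  | tmul m v => 
    obtain ⟨w, rfl⟩ := hg v
    exact ⟨actTmul M V m w, rfl⟩
  | add x y hx hy => 
    obtain ⟨a, rfl⟩ := hx
    obtain ⟨b, rfl⟩ := hy
    exact ⟨a + b, map_add _ a b⟩

end BimodCat

end DualBasis

/-! ### Frobenius corners -/

section Frobenius

variable {O E F : Type u} [CommRing O] [Ring E] [Algebra O E] [Ring F] [Algebra O F]

/-- For an idempotent `e` of `E`, the right `E`-module `eE` is isomorphic to the `O`-dual of `Ee`,
and every linear form on `E` is a sum of linear forms which factor through left multiplication by
an element of `eE`. -/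
structure IsFrobeniusCorner (O : Type u) [CommRing O] [Algebra O E] (e : E) : Prop where
  exists_form : ∃ s : E →ₗ[O] O, (∀ l : E →ₗ[O] O, ∃ a, e * a = a ∧ ∀ b, s (a * b * e) = l (b * e)) ∧
    ∀ a, e * a = a → (∀ b, s (a * b * e) = 0) → a = 0
  exists_sum : ∀ l : E →ₗ[O] O, ∃ (n : ℕ) (μ : Fin n → E →ₗ[O] O) (b : Fin n → E),
    ∀ c, l c = ∑ t, μ t (e * b t * c)

open BimodCat

/-- The additive characters `ψ` of `E` such that `ψ (e * a) = ψ a` for all `a`. -/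
def cornerCharacters (e : E) : AddSubgroup (E →+ AddCircle (1 : ℚ)) where
  carrier := {ψ | ∀ a, ψ (e * a) = ψ a}
  zero_mem' _ := rfl
  add_mem' h h' a := congrArg₂ (· + ·) (h a) (h' a)
  neg_mem' h a := congrArg (- ·) (h a)

instance (e : E) : Module E (cornerCharacters e) where
  smul x ψ := ⟨ψ.1.comp (AddMonoidHom.mulRight x), fun a => by
    simpa [mul_assoc] using ψ.2 (a * x)⟩
  one_smul ψ := by ext a; exact congrArg ψ.1 (mul_one a)
  mul_smul x y ψ := by ext a; exact congrArg ψ.1 (mul_assoc a x y).symm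
  smul_zero x := rfl
  smul_add x ψ ψ' := rfl
  add_smul x y ψ := by ext a; exact (congrArg ψ.1 (mul_add a x y)).trans (map_add ψ.1 _ _)
  zero_smul ψ := by ext a; exact (congrArg ψ.1 (mul_zero a)).trans (map_zero ψ.1)

/-- The injective module of additive characters of `eE`. -/
def cornerCharacterModule (e : E) : ModuleCat.{u} E := ModuleCat.of E (cornerCharacters e)

/-- The evaluation of a character. -/
def evalCharacter (e : E) (a : E) : cornerCharacterModule e →+ AddCircle (1 : ℚ) where
  toFun ψ := ψ.1 a
  map_zero' := rfl
  map_add' _ _ := rfl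

theorem evalCharacter_mul (e : E) (a : E) (ψ : cornerCharacterModule e) :
    evalCharacter e (e * a) ψ = evalCharacter e a ψ := ψ.2 a

theorem evalCharacter_smul (e : E) (a x : E) (ψ : cornerCharacterModule e) :
    evalCharacter e a (x • ψ) = evalCharacter e (a * x) ψ := rfl

theorem evalCharacter_add (e : E) (a b : E) :
    evalCharacter e (a + b) = evalCharacter e a + evalCharacter e b := by
  ext ψ; exact map_add ψ.1 a b

theorem evalCharacter_ext {e : E} {ψ : cornerCharacterModule e}
    (h : ∀ a, evalCharacter e a ψ = 0) : ψ = 0 :=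
  Subtype.ext (AddMonoidHom.ext h)

variable {e : E} {f : F} {N : BimodCat O F E}

/-- The evaluation `n ⊗ ψ ↦ ψ (q n)`. -/
def evalRightDual (q : RightDual N) : actObj N (cornerCharacterModule e) →+ AddCircle (1 : ℚ) :=
  actLiftAdd (AddMonoidHom.mk' (fun n => evalCharacter e (q.toFun n)) fun n n' => by
      rw [map_add, evalCharacter_add])
    fun x n ψ => by
      change evalCharacter e (q.toFun _) ψ = evalCharacter e (q.toFun n) (x • ψ)
      rw [q.map_smul, evalCharacter_smul]

theorem evalRightDual_tmul (q : RightDual N) (n : N) (ψ : cornerCharacterModule e) :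
    evalRightDual q (actTmul N _ n ψ) = evalCharacter e (q.toFun n) ψ := rfl

/-- Decomposing a right dual into right duals precomposed with left multiplications transfers these
multiplications to `z`. If all `x k` annihilate `z`, the evaluation vanishes. -/
theorem evalRightDual_eq_sum {ι : Type*} [Fintype ι] (q : RightDual N) (q' : ι → RightDual N)
    (x : ι → F)
    (h : ∀ n, q.toFun n = ∑ k, (q' k).toFun ((x k ⊗ₜ[O] (1 : Eᵐᵒᵖ)) • n))
    (z : actObj N (cornerCharacterModule e)) :
    evalRightDual q z = ∑ k, evalRightDual (q' k) (x k • z) := by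
  induction z using act_induction with
  | tmul n ψ =>
    simp only [smul_actTmul, evalRightDual_tmul, h]
    exact map_sum (AddMonoidHom.mk' (fun a => evalCharacter e a ψ)
      fun a b => by rw [evalCharacter_add]; rfl) _ _
  | add x y hx hy => simp only [map_add, smul_add, hx, hy, Finset.sum_add_distrib]

/-- By a dual basis, `z` is determined by its contractions, which are characters of eE. The value of
such a character at a is the evaluation of `z` at the right dual n ↦ e a q(n), whose values lie in
eE. -/
theorem eq_zero_of_evalRightDual (he : IsIdempotentElem e) (hN : IsFGProjectiveBimod N)
    (z : actObj N (cornerCharacterModule e))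
    (h' : ∀ q : RightDual N, (∀ n, e * q.toFun n = q.toFun n) → evalRightDual q z = 0) : z = 0 := by
  obtain ⟨m, v, q, hq⟩ := exists_rightDualBasis hN
  rw [eq_sum_contract hq z]
  refine Finset.sum_eq_zero fun k _ => ?_
  have h1 (a : E) : evalCharacter e a (contract (q k) _ z) = evalRightDual
      (⟨(AddMonoidHom.mulLeft (e * a)).comp (q k).toFun, fun s m => by
        simp [(q k).map_smul, mul_assoc]⟩ : RightDual N) z := by
    rw [← evalCharacter_mul]
    clear h'
    induction z using act_induction with
    | tmul n ψ => rfl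
    | add x y hx hy => rw [map_add, map_add, map_add, hx, hy]
  have h2 : contract (q k) _ z = 0 := evalCharacter_ext fun a => by
    rw [h1 a]
    refine h' _ fun n => ?_
    change e * (e * a * (q k).toFun n) = e * a * (q k).toFun n
    rw [← mul_assoc, ← mul_assoc, he.eq]
  rw [h2, map_zero]

section Linear

attribute [local instance] baseModule isScalarTower_base

/-- The orbit map `c ↦ c • n`. -/
def leftOrbit (n : N) : F →ₗ[O] N where
  toFun c := (c ⊗ₜ[O] (1 : Eᵐᵒᵖ)) • n
  map_add' c d := by rw [TensorProduct.add_tmul, add_smul]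
  map_smul' o c := by rw [← TensorProduct.smul_tmul', smul_assoc]; rfl

/-- The orbit map `c ↦ n • c`. -/
def rightOrbit (n : N) : E →ₗ[O] N where
  toFun c := ((1 : F) ⊗ₜ[O] op c) • n
  map_add' c d := by rw [MulOpposite.op_add, TensorProduct.tmul_add, add_smul]
  map_smul' o c := by rw [op_smul, TensorProduct.tmul_smul, smul_assoc]; rfl

theorem LeftDual.map_base_smul (p : LeftDual N) (o : O) (n : N) :
    p.toFun (o • n) = o • p.toFun n := by
  rw [Algebra.smul_def, ← p.map_smul]; rfl

theorem RightDual.map_base_smul (p : RightDual N) (o : O) (n : N) :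
    p.toFun (o • n) = o • p.toFun n := by
  rw [Algebra.smul_def, Algebra.commutes, ← p.map_smul, base_smul_def,
    Algebra.TensorProduct.algebraMap_apply']
  rfl

/-- Since eE is dual to Ee, right linear maps N → eE correspond to linear forms on N ⊗_E Ee = Ne.
Existence in `hs` defines the map pointwise, and the uniqueness given by `hs0` makes it additive and
linear. -/
theorem exists_rightDual_of_form {s : E →ₗ[O] O}
    (hs : ∀ l : E →ₗ[O] O, ∃ a, e * a = a ∧ ∀ b, s (a * b * e) = l (b * e))
    (hs0 : ∀ a, e * a = a → (∀ b, s (a * b * e) = 0) → a = 0) (ν : N →ₗ[O] O) :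
    ∃ q : RightDual N, (∀ n, e * q.toFun n = q.toFun n) ∧
      ∀ n b, s (q.toFun n * b * e) = ν (((1 : F) ⊗ₜ[O] op (b * e)) • n) := by
  choose q hq hq' using fun n : N => hs (ν ∘ₗ rightOrbit n)
  have ext (a a' : E) (ha : e * a = a) (ha' : e * a' = a')
      (h : ∀ b, s (a * b * e) = s (a' * b * e)) : a = a' :=
    sub_eq_zero.1 (hs0 _ (by rw [mul_sub, ha, ha']) fun b => by
      rw [sub_mul, sub_mul, map_sub, h, sub_self])
  refine ⟨⟨AddMonoidHom.mk' q fun n n' => ext _ _ (hq _) (by rw [mul_add, hq, hq]) fun b => ?_,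
    fun x n => ext _ _ (hq _) ((mul_assoc e (q n) x).symm.trans (by rw [hq]; rfl)) fun b => ?_⟩, hq, hq'⟩
  · rw [add_mul, add_mul, map_add, hq', hq', hq']
    exact (congrArg ν (smul_add _ _ _)).trans (map_add ν _ _)
  · change _ = s (q n * x * b * e)
    rw [mul_assoc (q n), hq']
    refine (hq' _ _).trans (congrArg ν ?_)
    change ((1 : F) ⊗ₜ[O] op (b * e)) • ((1 : F) ⊗ₜ[O] op x) • n =
      ((1 : F) ⊗ₜ[O] op (x * b * e)) • n
    rw [← mul_smul, Algebra.TensorProduct.tmul_mul_tmul, one_mul, ← op_mul, mul_assoc]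

/-- An element of `N ⊗_E (eE)^*` which is annihilated by `fF` vanishes. -/
theorem eq_zero_of_corner_smul_eq_zero (hE : IsFrobeniusCorner O e) (hF : IsFrobeniusCorner O f)
    (he : IsIdempotentElem e) (hN : IsFGProjectiveBimod N)
    (z : actObj N (cornerCharacterModule e)) (hz : ∀ b, (f * b) • z = 0) : z = 0 := by
  refine eq_zero_of_evalRightDual he hN z fun q hq => ?_
  obtain ⟨s, hs, hs0⟩ := hE.exists_form
  obtain ⟨m, v, p, hp⟩ := exists_leftDualBasis hN
  -- The right dual `q` is encoded by the linear form `l`, which can be decomposed on the side of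
  -- `F`.
  let l : N →ₗ[O] O := 
    { toFun := fun n => s (q.toFun n * e)
      map_add' := fun n n' => by rw [map_add, add_mul, map_add]
      map_smul' := fun o n => by
        rw [RightDual.map_base_smul, smul_mul_assoc, map_smul]; rfl }
  -- With a left dual basis, `l` is determined by the forms c ↦ l (c • v i) on `F`. The second
  -- Frobenius condition makes each of them factor through multiplications by elements of fF.
  choose k μ b hμ using fun i => hF.exists_sum (l ∘ₗ leftOrbit (v i))
  let ν (i : Fin m) (t : Fin (k i)) : N →ₗ[O] O := μ i t ∘ₗ
    { toFun := (p i).toFun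
      map_add' := map_add _
      map_smul' := LeftDual.map_base_smul _ }
  choose q' hq' hq'' using fun i t => exists_rightDual_of_form hs hs0 (ν i t)
  have hl (n : N) : l n = ∑ x : (i : Fin m) × Fin (k i),
      ν x.1 x.2 (((f * b x.1 x.2) ⊗ₜ[O] (1 : Eᵐᵒᵖ)) • n) := by
    rw [Fintype.sum_sigma]
    conv_lhs => rw [hp n, map_sum]
    refine Finset.sum_congr rfl fun i _ => (hμ i ((p i).toFun n)).trans ?_
    exact Finset.sum_congr rfl fun t _ => congrArg (μ i t) ((p i).map_smul _ n).symm
  -- Translated back into right duals, `q` becomes a sum of terms in which `n` is first multiplied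
  -- by some `f * b`, and these elements annihilate `z`.
  rw [evalRightDual_eq_sum q (fun x : (i : Fin m) × Fin (k i) => q' x.1 x.2)
    (fun x => f * b x.1 x.2)]
  · simp [hz]
  · intro n
    refine sub_eq_zero.1 (hs0 _ ?_ fun c => ?_)
    · simp [mul_sub, hq, Finset.mul_sum, hq']
    · rw [sub_mul, sub_mul, map_sub, sub_eq_zero, Finset.sum_mul, Finset.sum_mul, map_sum]
      simp only [hq'']
      have h1 : l (((1 : F) ⊗ₜ[O] op (c * e)) • n) = s (q.toFun n * c * e) := by
        change s (q.toFun _ * e) = _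
        rw [q.map_smul, mul_assoc, mul_assoc, mul_assoc, he.eq]
      rw [← h1, hl]
      refine Finset.sum_congr rfl fun x _ => congrArg (ν x.1 x.2) ?_
      rw [← mul_smul, ← mul_smul, Algebra.TensorProduct.tmul_mul_tmul,
        Algebra.TensorProduct.tmul_mul_tmul, mul_one, one_mul, mul_one, one_mul]

end Linear

end Frobenius

/-! ### Acyclicity of corners -/

section CornerAcyclic

open BimodCat Limits CochainComplex

variable {O R S : Type u} [CommRing O] [Ring R] [Algebra O R] [Ring S] [Algebra O S]

/-- The cohomology of `K` is annihilated by the idempotent `e`. -/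
def IsCornerAcyclic (e : R) (K : CochainComplex (ModuleCat.{u} R) ℤ) : Prop :=
  ∀ (n : ℤ) (x : K.X (n + 1)), e • x = x → (K.d (n + 1) (n + 1 + 1)).hom x = 0 →
    ∃ y, (K.d n (n + 1)).hom y = x

namespace totalOf

variable (M : CochainComplex (BimodCat O R S) ℤ) (W : CochainComplex (ModuleCat.{u} S) ℤ)

/-- The inclusion of a summand in the tensor product. -/
abbrev ι (i j n : ℤ) (h : i + j = n) : actObj (M.X i) (W.X j) ⟶ (tensorFunctor O R S M |>.obj W).X n :=
  incl (actBifunctor O R S) M W i j n h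

/-- The projection of the tensor product to a summand. -/
abbrev π (i j n : ℤ) : (tensorFunctor O R S M |>.obj W).X n ⟶ actObj (M.X i) (W.X j) :=
  proj (actBifunctor O R S) M W i j n

theorem d_ι (i j n m : ℤ) (h : i + j = n) (hm : n + 1 = m) (x : actObj (M.X i) (W.X j)) :
    ((tensorFunctor O R S M |>.obj W).d n m).hom ((ι M W i j n h).hom x) =
      (ι M W (i + 1) j m (by lia)).hom ((actMap (M.d i (i + 1)) (𝟙 (W.X j))).hom x) +
        i.negOnePow • (ι M W i (j + 1) m (by lia)).hom
          ((actMap (𝟙 (M.X i)) (W.d j (j + 1))).hom x) :=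
  congrArg (fun φ => φ.hom x) (incl_d (actBifunctor O R S) M W i j n m h hm)

theorem π_d (a b n m : ℤ) (hn : n + 1 = m) (h : a + 1 + (b + 1) = m)
    (x : (tensorFunctor O R S M |>.obj W).X n) :
    (π M W (a + 1) (b + 1) m).hom (((tensorFunctor O R S M |>.obj W).d n m).hom x) =
      (actMap (M.d a (a + 1)) (𝟙 (W.X (b + 1)))).hom ((π M W a (b + 1) n).hom x) +
        (a + 1).negOnePow • (actMap (𝟙 (M.X (a + 1))) (W.d b (b + 1))).hom
          ((π M W (a + 1) b n).hom x) :=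
  congrArg (fun φ => φ.hom x) (d_proj (actBifunctor O R S) M W a b n m hn h)

theorem π_ι_self (i j n : ℤ) (h : i + j = n) (x : actObj (M.X i) (W.X j)) :
    (π M W i j n).hom ((ι M W i j n h).hom x) = x :=
  congrArg (fun φ => φ.hom x) (incl_proj_self (actBifunctor O R S) M W h)

theorem π_ι_of_ne (i j n i' j' : ℤ) (h : i + j = n) (hi : i ≠ i') (x : actObj (M.X i) (W.X j)) :
    (π M W i' j' n).hom ((ι M W i j n h).hom x) = 0 :=
  congrArg (fun φ => φ.hom x) (incl_proj_of_ne (j := j') (actBifunctor O R S) M W h hi)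

theorem eq_zero_of_π (s : Finset ℤ) (hs : ∀ i ∉ s, IsZero (M.X i)) (n : ℤ)
    (x : (tensorFunctor O R S M |>.obj W).X n) (h : ∀ i ∈ s, (π M W i (n - i) n).hom x = 0) :
    x = 0 := by
  have h1 : (∑ i ∈ s, (π M W i (n - i) n ≫ ι M W i (n - i) n (by lia)).hom) x = x := by
    rw [← ModuleCat.hom_sum]
    exact congrArg (fun φ => φ.hom x) (sum_proj_incl (actBifunctor O R S) M W s hs n)
  rw [← h1, LinearMap.sum_apply]
  exact Finset.sum_eq_zero fun i hi => (congrArg (ι M W i (n - i) n (by lia)).hom (h i hi)).trans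
    (map_zero (ι M W i (n - i) n (by lia)).hom)

end totalOf

/-! ### Removing one component of a cocycle -/

section Zigzag

variable {M₁ M₂ M₃ : BimodCat O R S} (α : M₁ ⟶ M₂) (β : M₂ ⟶ M₃)

theorem actMap_comm {M M' : BimodCat O R S} {V V' : ModuleCat.{u} S} (α : M ⟶ M') (g : V ⟶ V')
    (x : actObj M V) :
    (actMap (𝟙 M') g).hom ((actMap α (𝟙 V)).hom x) = (actMap α (𝟙 V')).hom ((actMap (𝟙 M) g).hom x) :=
  congrArg (fun φ => φ.hom x) (((actBifunctor O R S).map α).naturality g).symm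

theorem actMap_comp_apply {M : BimodCat O R S} {V V' V'' : ModuleCat.{u} S} (g : V ⟶ V')
    (g' : V' ⟶ V'') (x : actObj M V) :
    (actMap (𝟙 M) g').hom ((actMap (𝟙 M) g).hom x) = (actMap (𝟙 M) (g ≫ g')).hom x :=
  (congrArg (fun φ => φ.hom x) (((actBifunctor O R S).obj M).map_comp g g')).symm

/-- A diagram chase in the double complex `M ⊗ W`. -/
theorem exists_of_actMap_eq (h₂ : IsFGProjectiveBimod M₂) (h₃ : IsFGProjectiveBimod M₃)
    {W₁ W₂ W₃ : ModuleCat.{u} S} (δ : W₁ ⟶ W₂) (ε : W₂ ⟶ W₃) (w : δ ≫ ε = 0) {e : R} {f : S}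
    (hW : ∀ v, f • v = v → ε.hom v = 0 → ∃ v', δ.hom v' = v) (hf : IsIdempotentElem f)
    (hD : ∀ V : ModuleCat.{u} S, (∀ v : V, f • v = 0) → ∀ x : actObj M₂ V, e • x = x →
      (actMap β (𝟙 V)).hom x = 0 → ∃ y, (actMap α (𝟙 V)).hom y = x)
    (z : actObj M₂ W₂) (hez : e • z = z) (hz : (actMap (𝟙 M₂) ε).hom z = 0)
    (y : actObj M₃ W₁) (hy : (actMap β (𝟙 W₂)).hom z = (actMap (𝟙 M₃) δ).hom y) :
    ∃ (y : actObj M₁ W₂) (u : actObj M₂ W₁), (actMap (𝟙 M₁) ε).hom y = 0 ∧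
      z = (actMap α (𝟙 W₂)).hom y + (actMap (𝟙 M₂) δ).hom u := by
  -- Cocycles `Z` and cohomology `H` at the middle term; by `hW` the idempotent `f` annihilates `H`.
  let Z := ModuleCat.of S (LinearMap.ker ε.hom)
  let i : Z ⟶ W₂ := ModuleCat.ofHom (LinearMap.ker ε.hom).subtype
  let b : W₁ ⟶ Z := ModuleCat.ofHom (δ.hom.codRestrict _ fun v =>
    LinearMap.mem_ker.2 (congrArg (fun φ => φ.hom v) w))
  let H := ModuleCat.of S (Z ⧸ LinearMap.range b.hom)
  let p : Z ⟶ H := ModuleCat.ofHom (LinearMap.range b.hom).mkQ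
  have hbi : b ≫ i = δ := rfl
  have hi : Function.Injective i.hom := Subtype.val_injective
  have hie : i ≫ ε = 0 := by ext v; exact v.2
  have hbp : b ≫ p = 0 := by
    ext v; exact (Submodule.Quotient.mk_eq_zero _).2 ⟨v, rfl⟩
  have hH : ∀ v : H, f • v = 0 := by
    intro v
    obtain ⟨v, rfl⟩ := Submodule.mkQ_surjective _ v
    obtain ⟨v', h'⟩ := hW (f • v.1) (by rw [← mul_smul, hf.eq])
      (by rw [map_smul]; exact (congrArg (f • ·) v.2).trans (smul_zero f))
    exact (Submodule.Quotient.mk_eq_zero _).2 ⟨v', Subtype.ext h'⟩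
  -- Tensoring with `M₂` is exact, so `z` comes from M₂ ⊗ Z.
  obtain ⟨z', rfl⟩ := act_exact h₂ i ε (fun v hv => ⟨⟨v, hv⟩, rfl⟩) z hz
  have hez' : e • z' = z' := act_injective h₂ i hi ((map_smul _ _ _).trans hez)
  have h1 : (actMap β (𝟙 Z)).hom z' = (actMap (𝟙 M₃) b).hom y :=
    act_injective h₃ i hi ((actMap_comm β i z').trans (hy.trans (by
      rw [actMap_comp_apply, hbi])))
  -- The class of `z` in M₂ ⊗ H is a horizontal cocycle fixed by `e`, because its horizontal
  -- differential comes from coboundaries. As `f` kills `H`, the hypothesis `hD` makes it a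
  -- horizontal boundary.
  obtain ⟨y₀, hy₀⟩ := hD H hH ((actMap (𝟙 M₂) p).hom z') (by rw [← map_smul, hez']) (by
    rw [← actMap_comm, h1, actMap_comp_apply, hbp]
    exact congrArg (fun φ => φ.hom y) (((actBifunctor O R S).obj M₃).map_zero W₁ H))
  obtain ⟨y₁, rfl⟩ := act_surjective M₁ p (Submodule.mkQ_surjective _) y₀
  -- After a lift of `y₀` along the surjection onto M₁ ⊗ H, the remaining difference dies in M₂ ⊗ H,
  -- so it comes from M₂ ⊗ W₁ by exactness.
  obtain ⟨u, hu⟩ := act_exact h₂ b p (fun v hv => (Submodule.Quotient.mk_eq_zero _).1 hv)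
    (z' - (actMap α (𝟙 Z)).hom y₁) (by rw [map_sub, actMap_comm, hy₀, sub_self])
  refine ⟨(actMap (𝟙 M₁) i).hom y₁, u, ?_, ?_⟩
  · rw [actMap_comp_apply, hie]
    exact congrArg (fun φ => φ.hom y₁) (((actBifunctor O R S).obj M₁).map_zero Z W₃)
  · rw [← hbi, ← actMap_comp_apply, hu, ← actMap_comm, ← map_add, add_sub_cancel]

end Zigzag

/-! ### Induction over the columns of the double complex -/

section Induction

variable {M : CochainComplex (BimodCat O R S) ℤ} {W : CochainComplex (ModuleCat.{u} S) ℤ}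
variable {e : R} {f : S}

open totalOf

/-- The first nonzero column of a cocycle can be cleared by subtracting a boundary. The cocycle
condition says that the component in column a + 1 is a vertical cocycle and that its horizontal
differential is a vertical boundary, as `exists_of_actMap_eq` requires. The primitive lives in
columns a and a + 1, and its differential does not reach back into column a. -/
theorem exists_sub_d_eq_zero (hM : ∀ i, IsFGProjectiveBimod (M.X i)) (hf : IsIdempotentElem f)
    (hW : IsCornerAcyclic f W)
    (hD : ∀ V : ModuleCat.{u} S, (∀ v : V, f • v = 0) → ∀ (a : ℤ) (x : actObj (M.X (a + 1)) V),
      e • x = x → (actMap (M.d (a + 1) (a + 1 + 1)) (𝟙 V)).hom x = 0 →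
        ∃ y, (actMap (M.d a (a + 1)) (𝟙 V)).hom y = x)
    (a j n : ℤ) (h : a + 1 + j = n) (x : ((tensorFunctor O R S M).obj W).X (n + 1))
    (hex : e • x = x) (hdx : (((tensorFunctor O R S M).obj W).d (n + 1) (n + 1 + 1)).hom x = 0)
    (hx : ∀ i k, i + k = n + 1 → i < a + 1 → (π M W i k (n + 1)).hom x = 0) :
    ∃ y, ∀ i k, i + k = n + 1 → i < a + 1 + 1 → (π M W i k (n + 1)).hom
      (x - (((tensorFunctor O R S M).obj W).d n (n + 1)).hom y) = 0 := by
  have h1 := π_d M W a (j + 1) (n + 1) (n + 1 + 1) rfl (by omega) x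
  rw [hdx, map_zero, hx _ _ (by omega) (by omega), map_zero, zero_add, eq_comm,
    smul_eq_zero_iff_eq] at h1
  have h2 := π_d M W (a + 1) j (n + 1) (n + 1 + 1) rfl (by omega) x
  rw [hdx, map_zero, eq_comm, add_eq_zero_iff_eq_neg] at h2
  obtain ⟨y, u, hy, hz⟩ := exists_of_actMap_eq (M.d a (a + 1)) (M.d (a + 1) (a + 1 + 1)) (hM _)
    (hM _) (W.d j (j + 1)) (W.d (j + 1) (j + 1 + 1)) (W.d_comp_d _ _ _) (hW j) hf
    (fun V hV => hD V hV a) ((π M W (a + 1) (j + 1) (n + 1)).hom x) (by rw [← map_smul, hex]) h1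
    (-((a + 1 + 1).negOnePow • (π M W (a + 1 + 1) j (n + 1)).hom x)) (by
      rw [h2, map_neg, Units.smul_def, Units.smul_def, map_zsmul])
  -- The sign on `u` cancels that of the vertical differential in column a + 1.
  refine ⟨(ι M W a (j + 1) n (by omega)).hom y +
    (a + 1).negOnePow • (ι M W (a + 1) j n (by omega)).hom u, fun i k hik hi => ?_⟩
  have h3 : (((tensorFunctor O R S M).obj W).d n (n + 1)).hom
      ((a + 1).negOnePow • (ι M W (a + 1) j n (by omega)).hom u) =
      (a + 1).negOnePow • (((tensorFunctor O R S M).obj W).d n (n + 1)).hom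
        ((ι M W (a + 1) j n (by omega)).hom u) := by
    rw [Units.smul_def, Units.smul_def, map_zsmul]
  rw [map_add, h3, d_ι M W a (j + 1) n (n + 1) (by omega) rfl, d_ι M W (a + 1) j n (n + 1) (by omega) rfl,
    hy, map_zero, smul_zero, add_zero, smul_add, smul_smul, Int.units_mul_self, one_smul,
    map_sub, map_add, map_add, Units.smul_def, map_zsmul,
    π_ι_of_ne M W (a + 1 + 1) j (n + 1) i k _ (by omega), smul_zero,
    zero_add]
  by_cases hia : i = a + 1
  · obtain rfl := hia
    obtain rfl : k = j + 1 := by omega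
    rw [π_ι_self, π_ι_self, hz, sub_self]
  · rw [hx i k hik (by omega), π_ι_of_ne _ _ _ _ _ i k _ (by omega), π_ι_of_ne _ _ _ _ _ i k _ (by omega),
      add_zero, sub_zero]

/-- An elementary form of a spectral sequence argument. Taking vertical cohomology first gives the
complexes M^• ⊗ H^j(W), whose cohomology is killed by `e` thanks to `hD`; boundedness of `M` gives
convergence. -/
theorem IsCornerAcyclic.tensor (hMb : IsBoundedComplex M) (hM : ∀ i, IsFGProjectiveBimod (M.X i))
    (he : IsIdempotentElem e) (hf : IsIdempotentElem f) (hW : IsCornerAcyclic f W)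
    (hD : ∀ V : ModuleCat.{u} S, (∀ v : V, f • v = 0) → ∀ (a : ℤ) (x : actObj (M.X (a + 1)) V),
      e • x = x → (actMap (M.d (a + 1) (a + 1 + 1)) (𝟙 V)).hom x = 0 →
        ∃ y, (actMap (M.d a (a + 1)) (𝟙 V)).hom y = x) :
    IsCornerAcyclic e ((tensorFunctor O R S M).obj W) := by
  obtain ⟨N, hN⟩ := hMb
  intro n
  have hπ (x : ((tensorFunctor O R S M).obj W).X (n + 1))
      (h : ∀ i k, i + k = n + 1 → |i| ≤ N → (π M W i k (n + 1)).hom x = 0) : x = 0 :=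
    eq_zero_of_π M W (Finset.Icc (-N) N) (fun i hi => hN i (by
      rw [Finset.mem_Icc, ← abs_le] at hi; omega)) _ _ fun i hi =>
        h _ _ (by omega) (by rwa [Finset.mem_Icc, ← abs_le] at hi)
  -- Here `k` counts the columns, from the right end `N`, that may still be nonzero. For `k = 0`
  -- nothing is left.
  have key (k : ℕ) : ∀ x : ((tensorFunctor O R S M).obj W).X (n + 1), e • x = x →
      (((tensorFunctor O R S M).obj W).d (n + 1) (n + 1 + 1)).hom x = 0 →
      (∀ i j, i + j = n + 1 → i < N + 1 - k → (π M W i j (n + 1)).hom x = 0) →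
      ∃ y, (((tensorFunctor O R S M).obj W).d n (n + 1)).hom y = x := by
    induction k with
    | zero =>
      intro x _ _ hx
      exact ⟨0, (map_zero _).trans (hπ x fun i k hik hi => hx i k hik (by
        have := le_abs_self i; omega)).symm⟩
    | succ k ih =>
      intro x hex hdx hx
      obtain ⟨y, hy⟩ := exists_sub_d_eq_zero hM hf hW hD (N - k - 1) (n - (N - k)) n (by omega) x hex hdx
        fun i j hij hi => hx i j hij (by push_cast; omega)
      -- Replacing `y` by `e • y` keeps the corrected cocycle fixed by `e`, so that the induction
      -- can continue.
      have h1 : e • (x - (((tensorFunctor O R S M).obj W).d n (n + 1)).hom y) =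
          x - (((tensorFunctor O R S M).obj W).d n (n + 1)).hom (e • y) := by
        rw [smul_sub, hex, map_smul]
      have h2 : (((tensorFunctor O R S M).obj W).d (n + 1) (n + 1 + 1)).hom
          ((((tensorFunctor O R S M).obj W).d n (n + 1)).hom (e • y)) = 0 :=
        congrArg (fun φ => φ.hom (e • y)) (((tensorFunctor O R S M).obj W).d_comp_d n (n + 1) (n + 1 + 1))
      obtain ⟨y', hy'⟩ := ih (x - (((tensorFunctor O R S M).obj W).d n (n + 1)).hom (e • y))
        (by rw [← h1, ← mul_smul, he.eq]) (by rw [map_sub, hdx, h2, sub_zero])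
        fun i j hij hi => by
          rw [← h1, map_smul, hy i j hij (by omega), smul_zero]
      exact ⟨e • y + y', by rw [map_add, hy', add_sub_cancel]⟩
  intro x hex hdx
  -- Of the columns of `M`, only the 2N + 1 from -N to N can be nonzero.
  refine key (2 * N + 1) x hex hdx fun i j hij hi => ?_
  have hz : IsZero (actObj (M.X i) (W.X j)) :=
    isZero_obj_of_isZero (actBifunctor O R S) (hN i (by rw [lt_abs]; push_cast at hi; omega)) (W.X j)
  exact congrArg (fun φ => φ.hom x) (hz.eq_of_tgt (π M W i j (n + 1)) 0)

end Induction

end CornerAcyclic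

/-! ### Rickard equivalences and corners -/

section RickardCorner

open BimodCat Limits CochainComplex

variable {O E F : Type u} [CommRing O] [Ring E] [Algebra O E] [Ring F] [Algebra O F]
variable {e : E} {f : F}
variable {M : CochainComplex (BimodCat O E F) ℤ} {N : CochainComplex (BimodCat O F E) ℤ}

theorem eq_zero_of_corner_smul_of_iso (hE : IsFrobeniusCorner O e) (hF : IsFrobeniusCorner O f)
    (he : IsIdempotentElem e) {N : BimodCat O F E} (hN : IsFGProjectiveBimod N) {V : ModuleCat.{u} E}
    (α : V ≅ cornerCharacterModule e) (z : actObj N V) (hz : ∀ b, (f * b) • z = 0) : z = 0 := by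
  have h := eq_zero_of_corner_smul_eq_zero hE hF he hN ((actMap (𝟙 N) α.hom).hom z) fun b => by
    rw [← map_smul, hz, map_zero]
  have h1 := actMap_comp_apply α.hom α.inv z
  rw [h, map_zero, α.hom_inv_id] at h1
  exact ((congrArg (fun φ => φ.hom z) (((actBifunctor O F E).obj N).map_id V)).symm.trans h1.symm)

theorem eq_zero_of_corner_smul_tensor (hE : IsFrobeniusCorner O e) (hF : IsFrobeniusCorner O f)
    (he : IsIdempotentElem e) (hNb : IsBoundedComplex N) (hN : ∀ i, IsFGProjectiveBimod (N.X i))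
    (k n : ℤ) (z : ((tensorFunctor O F E N).obj ((HomologicalComplex.single _ (ComplexShape.up ℤ)
      k).obj (cornerCharacterModule e))).X n) (hz : ∀ b, (f * b) • z = 0) : z = 0 := by
  obtain ⟨s, hs⟩ := hNb.exists_finset
  refine totalOf.eq_zero_of_π _ _ s hs _ _ fun i _ => ?_
  by_cases h : n - i = k
  · obtain rfl := h
    exact eq_zero_of_corner_smul_of_iso hE hF he (hN i)
      (HomologicalComplex.singleObjXSelf (ComplexShape.up ℤ) (n - i) _) _ fun b => by
        rw [← map_smul, hz, map_zero]
  · have h0 : IsZero (((actBifunctor O F E).obj (N.X i)).obj (((HomologicalComplex.single _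
        (ComplexShape.up ℤ) k).obj (cornerCharacterModule e)).X (n - i))) :=
      Functor.map_isZero _ (HomologicalComplex.isZero_single_obj_X _ _ _ _ h)
    exact congrArg (fun φ => φ.hom z) (h0.eq_of_tgt (totalOf.π N _ i (n - i) n) 0)

/-- Linear maps from W^n to the character module of eE are characters of eW^n, so chain maps to a
shift of that module see the part of the cohomology fixed by `e`. A character that vanishes on
boundaries but not on `x` gives the required map. -/
theorem not_homotopic_of_not_boundary {W : CochainComplex (ModuleCat.{u} E) ℤ}
    (he : IsIdempotentElem e) (n : ℤ) (x : W.X (n + 1)) (hex : e • x = x)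
    (hdx : (W.d (n + 1) (n + 1 + 1)).hom x = 0) (hx : ∀ y, (W.d n (n + 1)).hom y ≠ x) :
    ∃ φ : W ⟶ (HomologicalComplex.single _ (ComplexShape.up ℤ) (n + 1)).obj
      (cornerCharacterModule e), IsEmpty (Homotopy φ 0) := by
  let Z := W.X (n + 1) ⧸ LinearMap.range (W.d n (n + 1)).hom
  obtain ⟨c, hc⟩ := CharacterModule.exists_character_apply_ne_zero_of_ne_zero
    (a := (Submodule.Quotient.mk x : Z)) fun h => by
      obtain ⟨y, hy⟩ := (Submodule.Quotient.mk_eq_zero _).1 h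
      exact hx y hy
  let c' : W.X (n + 1) →+ AddCircle (1 : ℚ) :=
    (show Z →+ AddCircle (1 : ℚ) from c).comp (Submodule.mkQ _).toAddMonoidHom
  have hc' : ∀ y, c' ((W.d n (n + 1)).hom y) = 0 := fun y => by
    refine (congrArg (show Z →+ AddCircle (1 : ℚ) from c)
      ((Submodule.Quotient.mk_eq_zero _).2 ⟨y, rfl⟩)).trans (map_zero _)
  -- The linear map adjoint to the restriction of `c'`. Evaluating ψ x at 1 returns c'(ex) = c'(x).
  let ψ : W.X (n + 1) ⟶ cornerCharacterModule e := ModuleCat.ofHom (Y := cornerCharacters e)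
    { toFun := fun w => ⟨AddMonoidHom.mk' (fun a => c' ((e * a) • w)) fun a b => by
        rw [mul_add, add_smul, map_add], fun a => by
          change c' ((e * (e * a)) • w) = c' ((e * a) • w)
          rw [← mul_assoc, he.eq]⟩
      map_add' := fun v w => by
        ext a
        change c' ((e * a) • (v + w)) = c' ((e * a) • v) + c' ((e * a) • w)
        rw [smul_add, map_add]
      map_smul' := fun b w => by
        ext a
        change c' ((e * a) • b • w) = c' ((e * (a * b)) • w)
        rw [← mul_assoc, mul_smul (e * a)] }
  have hψ : W.d n (n + 1) ≫ ψ = 0 := by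
    ext w : 2
    refine Subtype.ext (AddMonoidHom.ext fun a => ?_)
    change c' ((e * a) • (W.d n (n + 1)).hom w) = 0
    rw [← map_smul, hc']
  let φ : W ⟶ (HomologicalComplex.single _ (ComplexShape.up ℤ) (n + 1)).obj
      (cornerCharacterModule e) := HomologicalComplex.mkHomToSingle ψ (fun i hi => by
        obtain rfl : i = n := by simpa using hi
        exact hψ)
  refine ⟨φ, ⟨fun h => ?_⟩⟩
  -- The target has zero differential, so a null-homotopic map factors through the differential
  -- leaving `W.X (n + 1)` and must kill the cocycle `x`.
  have h1 := h.comm (n + 1)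
  rw [dNext_eq h.hom (show (ComplexShape.up ℤ).Rel (n + 1) (n + 1 + 1) from rfl),
    prevD_eq h.hom (show (ComplexShape.up ℤ).Rel n (n + 1) from rfl),
    HomologicalComplex.single_obj_d, comp_zero, add_zero, HomologicalComplex.zero_f, add_zero,
    HomologicalComplex.mkHomToSingle_f] at h1
  have h2 : (ψ ≫ (HomologicalComplex.singleObjXSelf (ComplexShape.up ℤ) (n + 1)
      (cornerCharacterModule e)).inv).hom x = 0 := by
    rw [h1]
    exact (congrArg (h.hom (n + 1 + 1) (n + 1)).hom hdx).trans (map_zero _)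
  have h3 : ψ.hom x = 0 := by
    let γ := HomologicalComplex.singleObjXSelf (ComplexShape.up ℤ) (n + 1)
      (cornerCharacterModule e)
    have h5 : (ψ ≫ γ.inv) ≫ γ.hom = ψ := by rw [Category.assoc, γ.inv_hom_id, Category.comp_id]
    rw [← h5]
    exact (congrArg γ.hom.hom h2).trans (map_zero _)
  have h4 : c' ((e * 1) • x) = 0 := congrArg (evalCharacter e 1) h3
  rw [mul_one, hex] at h4
  exact hc h4

/-- If the cohomology of M ⊗ K had a nonzero part fixed by `e`, some map φ to a shifted character
module would not be null-homotopic. But N ⊗ φ is a map out of N ⊗ M ⊗ K ≃ K into a complex in which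
nothing nonzero is killed by fF, while `f` kills `K`. -/
theorem isCornerAcyclic_of_smul_eq_zero (hE : IsFrobeniusCorner O e) (hF : IsFrobeniusCorner O f)
    (he : IsIdempotentElem e) (hMN : IsRickardEquivalence M N)
    (K : CochainComplex (ModuleCat.{u} F) ℤ) (hK : ∀ j (v : K.X j), f • v = 0) :
    IsCornerAcyclic e ((tensorFunctor O E F M).obj K) := by
  obtain ⟨c, hc⟩ := exists_counit M N hMN.bounded_left hMN.bounded_right
    hMN.homotopyEquiv_left.some
  obtain ⟨c', hc'⟩ := exists_counit N M hMN.bounded_right hMN.bounded_left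
    hMN.homotopyEquiv_right.some
  intro n x hex hdx
  by_contra! hx
  obtain ⟨φ, hφ⟩ := not_homotopic_of_not_boundary he n x hex hdx hx
  let TM := tensorFunctor O E F M
  let TN := tensorFunctor O F E N
  obtain ⟨α, -⟩ := hc' K
  obtain ⟨β, hβ⟩ := hc (TM.obj K)
  -- Every element of `K` is killed by all `f * b`, hence so is its image in the tensor product of
  -- `N` with the character module, and that image is zero.
  have h1 : α.inv ≫ TN.map φ = 0 := by
    ext m v
    refine eq_zero_of_corner_smul_tensor hE hF he hMN.bounded_right hMN.projective_right _ _ _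
      fun b => ?_
    rw [← map_smul, mul_smul, hK, map_zero]
  have h2 : Homotopy (TN.map φ) 0 :=
    (Homotopy.ofEq (Category.id_comp _).symm).trans
      ((α.homotopyHomInvId.symm.compRight (TN.map φ)).trans
        (Homotopy.ofEq (by rw [Category.assoc, h1, comp_zero])))
  have h3 : Homotopy (TM.map (TN.map φ)) 0 :=
    (homotopyTensorFunctorMap M h2).trans (Homotopy.ofEq (TM.map_zero _ _))
  -- Naturality of the counit recovers φ, up to homotopy, from M ⊗ N ⊗ φ.
  have h4 : β.hom ≫ φ = TM.map (TN.map φ) ≫ c.app _ := hβ ▸ (c.naturality φ).symm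
  exact hφ.false <| (Homotopy.ofEq (Category.id_comp _).symm).trans
      ((β.homotopyInvHomId.symm.compRight φ).trans
        ((Homotopy.ofEq (by rw [Category.assoc, h4])).trans
          (((h3.compRight (c.app _)).compLeft β.inv).trans (Homotopy.ofEq (by simp)))))

theorem exists_actMap_d_eq (hE : IsFrobeniusCorner O e) (hF : IsFrobeniusCorner O f)
    (he : IsIdempotentElem e) (hMN : IsRickardEquivalence M N) (V : ModuleCat.{u} F)
    (hV : ∀ v : V, f • v = 0) (a : ℤ) (x : actObj (M.X (a + 1)) V) (hex : e • x = x)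
    (hdx : (actMap (M.d (a + 1) (a + 1 + 1)) (𝟙 V)).hom x = 0) :
    ∃ y, (actMap (M.d a (a + 1)) (𝟙 V)).hom y = x := by
  -- Concentrating `V` in one degree turns M ⊗ K into M^• ⊗ V. The degree is written `0 + 1` to fit
  -- the shape of the indices in `totalOf.π_d`.
  let K := (HomologicalComplex.single (ModuleCat.{u} F) (ComplexShape.up ℤ) (0 + 1)).obj V
  let γ : K.X (0 + 1) ≅ V := HomologicalComplex.singleObjXSelf (ComplexShape.up ℤ) (0 + 1) V
  have hK (j : ℤ) (v : K.X j) : f • v = 0 := by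
    by_cases hj : j = 0 + 1
    · subst hj
      have h1 : γ.inv.hom (γ.hom.hom v) = v := congrArg (fun φ => φ.hom v) γ.hom_inv_id
      rw [← h1, ← map_smul, hV, map_zero]
    · have h0 := HomologicalComplex.isZero_single_obj_X (ComplexShape.up ℤ) (0 + 1) V j hj
      exact congrArg (fun φ => φ.hom (f • v)) (h0.eq_of_src (𝟙 _) 0)
  have hKd (i j : ℤ) : K.d i j = 0 := HomologicalComplex.single_obj_d _ _ _ _ _
  have h0 {i j k : ℤ} (x : actObj (M.X i) (K.X j)) : (actMap (𝟙 (M.X i)) (K.d j k)).hom x = 0 := by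
    rw [hKd]
    exact congrArg (fun φ => φ.hom x) (((actBifunctor O E F).obj (M.X i)).map_zero (K.X j) (K.X k))
  obtain ⟨y, hy⟩ := isCornerAcyclic_of_smul_eq_zero hE hF he hMN K hK (a + 1)
    ((totalOf.ι M K (a + 1) (0 + 1) (a + 1 + 1) (by omega)).hom
      ((actMap (𝟙 (M.X (a + 1))) γ.inv).hom x))
    (by rw [← map_smul, ← map_smul, hex])
    (by rw [totalOf.d_ι _ _ _ _ _ _ _ rfl, h0, map_zero, smul_zero, add_zero, ← actMap_comm, hdx, map_zero,
      map_zero])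
  have h1 := congrArg (totalOf.π M K (a + 1) (0 + 1) (a + 1 + 1)).hom hy
  rw [totalOf.π_d _ _ _ _ _ _ rfl (by omega), h0, smul_zero, add_zero, totalOf.π_ι_self] at h1
  refine ⟨(actMap (𝟙 (M.X a)) γ.hom).hom ((totalOf.π M K a (0 + 1) (a + 1)).hom y), ?_⟩
  rw [← actMap_comm, h1, actMap_comp_apply, γ.inv_hom_id]
  exact congrArg (fun φ => φ.hom x) (((actBifunctor O E F).obj (M.X (a + 1))).map_id V)

theorem IsCornerAcyclic.tensor_of_isRickardEquivalence (hE : IsFrobeniusCorner O e)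
    (hF : IsFrobeniusCorner O f) (he : IsIdempotentElem e) (hf : IsIdempotentElem f)
    (hMN : IsRickardEquivalence M N) {W : CochainComplex (ModuleCat.{u} F) ℤ}
    (hW : IsCornerAcyclic f W) : IsCornerAcyclic e ((tensorFunctor O E F M).obj W) :=
  hW.tensor hMN.bounded_left hMN.projective_left he hf
    (fun V hV a x => exists_actMap_d_eq hE hF he hMN V hV a x)

end RickardCorner

/-! ### Restriction to corners and induction from corners -/

section CornerModules

open BimodCat Limits

/-- An isomorphism of the algebra `R` with the corner algebra `eEe`. -/
structure CornerEmbedding (O : Type u) [CommRing O] (R : Type u) [Ring R] [Algebra O R]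
    {E : Type u} [Ring E] [Algebra O E] (e : E) extends R →ₗ[O] E where
  map_mul' (r s : R) : toFun (r * s) = toFun r * toFun s
  map_one' : toFun 1 = e
  injective' : Function.Injective toFun
  exists_eq' (x : E) (h : e * x = x) (h' : x * e = x) : ∃ r, toFun r = x

variable {O R E : Type u} [CommRing O] [Ring R] [Algebra O R] [Ring E] [Algebra O E] {e : E}

namespace CornerEmbedding

instance : CoeFun (CornerEmbedding O R e) fun _ => R → E := ⟨fun ρ => ρ.toLinearMap⟩

variable (ρ : CornerEmbedding O R e)

theorem map_mul (r s : R) : ρ (r * s) = ρ r * ρ s := ρ.map_mul' r s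
theorem map_one : ρ 1 = e := ρ.map_one'
theorem injective : Function.Injective ρ := ρ.injective'
theorem exists_eq (x : E) (h : e * x = x) (h' : x * e = x) : ∃ r, ρ r = x := ρ.exists_eq' x h h'

include ρ in
theorem isIdempotentElem : IsIdempotentElem e := by
  rw [IsIdempotentElem, ← ρ.map_one, ← ρ.map_mul, one_mul]

theorem left_mul (r : R) : e * ρ r = ρ r := by
  have h := ρ.map_mul 1 r
  rwa [one_mul, ρ.map_one, eq_comm] at h
theorem mul_right (r : R) : ρ r * e = ρ r := by
  have h := ρ.map_mul r 1
  rwa [mul_one, ρ.map_one, eq_comm] at h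

/-- The element of `R` corresponding to `exe`. -/
def preimage (x : E) : R :=
  (ρ.exists_eq (e * x * e) (by rw [mul_assoc, ← mul_assoc e e, ρ.isIdempotentElem.eq])
    (by rw [mul_assoc, ρ.isIdempotentElem.eq])).choose

theorem apply_preimage (x : E) : ρ (ρ.preimage x) = e * x * e :=
  (ρ.exists_eq (e * x * e) (by rw [mul_assoc, ← mul_assoc e e, ρ.isIdempotentElem.eq])
    (by rw [mul_assoc, ρ.isIdempotentElem.eq])).choose_spec

theorem preimage_add (x y : E) : ρ.preimage (x + y) = ρ.preimage x + ρ.preimage y :=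
  ρ.injective (by
    rw [ρ.apply_preimage, map_add ρ.toLinearMap, ρ.apply_preimage, ρ.apply_preimage, mul_add,
      add_mul])

theorem preimage_mul (x : E) (r : R) : ρ.preimage (x * ρ r) = ρ.preimage x * r :=
  ρ.injective (by
    rw [ρ.apply_preimage, ρ.map_mul, ρ.apply_preimage, mul_assoc e, mul_assoc x, mul_assoc (e * x),
      ρ.left_mul, ρ.mul_right, mul_assoc])

/-- The elements of `W` fixed by the idempotent `e`. -/
def cornerPart (e : E) (W : ModuleCat.{u} E) : AddSubgroup W where
  carrier := {w | e • w = w}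
  zero_mem' := smul_zero e
  add_mem' {v w} hv hw := (smul_add e v w).trans (congrArg₂ (· + ·) hv hw)
  neg_mem' {w} hw := (smul_neg e w).trans (congrArg Neg.neg hw)

theorem smul_coe_cornerPart {W : ModuleCat.{u} E} (w : cornerPart e W) : e • w.1 = w.1 := w.2

/-- The `R`-module `eW`. -/
@[reducible] def cornerPartModule (W : ModuleCat.{u} E) : Module R (cornerPart e W) where
  smul r w := ⟨ρ r • w.1, by
    change e • ρ r • w.1 = ρ r • w.1
    rw [← mul_smul, ρ.left_mul]⟩
  one_smul w := Subtype.ext (by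
    change ρ 1 • w.1 = w.1
    rw [ρ.map_one, smul_coe_cornerPart])
  mul_smul r s w := Subtype.ext (by
    change ρ (r * s) • w.1 = ρ r • ρ s • w.1
    rw [ρ.map_mul, mul_smul])
  smul_zero r := Subtype.ext (smul_zero (ρ r))
  smul_add r v w := Subtype.ext (smul_add (ρ r) v.1 w.1)
  add_smul r s w := Subtype.ext (by
    change ρ (r + s) • w.1 = ρ r • w.1 + ρ s • w.1
    rw [map_add ρ.toLinearMap, add_smul])
  zero_smul w := Subtype.ext (by
    change ρ 0 • w.1 = 0
    rw [map_zero ρ.toLinearMap, zero_smul])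

/-- The functor `W ↦ eW`. -/
def res : ModuleCat.{u} E ⥤ ModuleCat.{u} R where
  obj W :=
    letI := ρ.cornerPartModule W
    ModuleCat.of R (cornerPart e W)
  map {V W} φ :=
    letI := ρ.cornerPartModule V
    letI := ρ.cornerPartModule W
    ModuleCat.ofHom
      { toFun := fun v => (⟨φ.hom v.1, (map_smul φ.hom e v.1).symm.trans
          (congrArg φ.hom v.2)⟩ : cornerPart e W)
        map_add' := fun v w => Subtype.ext (map_add φ.hom v.1 w.1)
        map_smul' := fun r v => Subtype.ext (map_smul φ.hom (ρ r) v.1) }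

instance : ρ.res.Additive where
  map_add := rfl

/-- The inclusion of `eW` in `W`. -/
def coe (W : ModuleCat.{u} E) : ρ.res.obj W →+ W := (cornerPart e W).subtype

variable {W : ModuleCat.{u} E}

theorem coe_injective : Function.Injective (ρ.coe W) := Subtype.val_injective

theorem smul_coe (w : ρ.res.obj W) : e • ρ.coe W w = ρ.coe W w := w.2

theorem coe_smul (r : R) (w : ρ.res.obj W) : ρ.coe W (r • w) = ρ r • ρ.coe W w := rfl

theorem coe_map {W' : ModuleCat.{u} E} (φ : W ⟶ W') (w : ρ.res.obj W) :
    ρ.coe W' ((ρ.res.map φ).hom w) = φ.hom (ρ.coe W w) := rfl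

/-- An element of `eW`. -/
def elem (w : W) (hw : e • w = w) : ρ.res.obj W := (⟨w, hw⟩ : cornerPart e W)

theorem coe_elem (w : W) (hw : e • w = w) : ρ.coe W (ρ.elem w hw) = w := rfl

/-- Cutting with `e` is exact, so H(eK) = eH(K). In the backward direction a primitive `y` of an
element fixed by `e` is replaced by `e • y`. -/
theorem acyclic_res_iff (K : CochainComplex (ModuleCat.{u} E) ℤ) :
    ((ρ.res.mapHomologicalComplex (ComplexShape.up ℤ)).obj K).Acyclic ↔ IsCornerAcyclic e K := by
  have key (n : ℤ) : ((ρ.res.mapHomologicalComplex (ComplexShape.up ℤ)).obj K).ExactAt (n + 1) ↔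
      ∀ x : K.X (n + 1), e • x = x → (K.d (n + 1) (n + 1 + 1)).hom x = 0 →
        ∃ y, (K.d n (n + 1)).hom y = x := by
    rw [HomologicalComplex.exactAt_iff' _ n (n + 1) (n + 1 + 1) (by simp) (by simp),
      ShortComplex.moduleCat_exact_iff]
    constructor
    · intro h x hex hdx
      obtain ⟨y, hy⟩ := h (ρ.elem x hex) (ρ.coe_injective hdx)
      exact ⟨ρ.coe _ y, congrArg (ρ.coe _) hy⟩
    · intro h x hdx
      obtain ⟨y, hy⟩ := h (ρ.coe _ x) (ρ.smul_coe x) (congrArg (ρ.coe _) hdx)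
      refine ⟨ρ.elem (e • y) (by rw [← mul_smul, ρ.isIdempotentElem.eq]), ρ.coe_injective ?_⟩
      refine (map_smul (K.d n (n + 1)).hom e y).trans ?_
      exact (congrArg (e • ·) hy).trans (ρ.smul_coe (W := K.X (n + 1)) x)
  constructor
  · intro h n
    exact (key n).1 (h (n + 1))
  · intro h n
    obtain ⟨m, rfl⟩ : ∃ m, n = m + 1 := ⟨n - 1, by omega⟩
    exact (key m).2 (h m)

/-- The left ideal `Ee`. -/
def leftIdeal (e : E) : Submodule E E where
  carrier := {x | x * e = x}
  zero_mem' := zero_mul e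
  add_mem' {x y} hx hy := (add_mul x y e).trans (congrArg₂ (· + ·) hx hy)
  smul_mem' r x hx := (mul_assoc r x e).trans (congrArg (r * ·) hx)

theorem coe_leftIdeal_mul (x : leftIdeal e) : x.1 * e = x.1 := x.2

/-- The right action of `R` on `Ee`. -/
@[reducible] def leftIdealRightModule : Module Rᵐᵒᵖ (leftIdeal e) where
  smul r x := ⟨x.1 * ρ r.unop, by
    change x.1 * ρ r.unop * e = _
    rw [mul_assoc, ρ.mul_right]⟩
  one_smul x := Subtype.ext (by
    change x.1 * ρ 1 = x.1
    rw [ρ.map_one, coe_leftIdeal_mul])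
  mul_smul r s x := Subtype.ext (by
    change x.1 * ρ (s.unop * r.unop) = x.1 * ρ s.unop * ρ r.unop
    rw [ρ.map_mul, mul_assoc])
  smul_zero r := Subtype.ext (zero_mul _)
  smul_add r x y := Subtype.ext (add_mul x.1 y.1 _)
  add_smul r s x := Subtype.ext (by
    change x.1 * ρ (r.unop + s.unop) = x.1 * ρ r.unop + x.1 * ρ s.unop
    rw [map_add ρ.toLinearMap, mul_add])
  zero_smul x := Subtype.ext (by
    change x.1 * ρ 0 = 0
    rw [map_zero ρ.toLinearMap, mul_zero])

/-- The `E`-`R`-bimodule structure of `Ee`. -/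
@[reducible] def leftIdealModule : Module (E ⊗[O] Rᵐᵒᵖ) (leftIdeal e) :=
  letI := ρ.leftIdealRightModule
  haveI : IsScalarTower O Rᵐᵒᵖ (leftIdeal e) := ⟨fun o r x => Subtype.ext (by
    change x.1 * ρ (o • r.unop) = o • (x.1 * ρ r.unop)
    rw [map_smul ρ.toLinearMap, mul_smul_comm])⟩
  haveI : SMulCommClass E Rᵐᵒᵖ (leftIdeal e) := ⟨fun a r x => Subtype.ext
    (mul_assoc a x.1 (ρ r.unop)).symm⟩
  TensorProduct.Algebra.module

/-- The `E`-`R`-bimodule `Ee`. -/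
def ideal : BimodCat O E R :=
  letI := ρ.leftIdealModule
  ModuleCat.of (E ⊗[O] Rᵐᵒᵖ) (leftIdeal e)

/-- The inclusion of `Ee` in `E`. -/
def idealCoe : ρ.ideal →+ E := (leftIdeal e).subtype.toAddMonoidHom

/-- The element `xe` of `Ee`. -/
def idealElem : E →+ ρ.ideal where
  toFun x := (⟨x * e, by
    change x * e * e = x * e
    rw [mul_assoc, ρ.isIdempotentElem.eq]⟩ : leftIdeal e)
  map_zero' := Subtype.ext (zero_mul e)
  map_add' x y := Subtype.ext (add_mul x y e)

theorem idealElem_coe (x : ρ.ideal) : ρ.idealElem (ρ.idealCoe x) = x := Subtype.ext x.2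

theorem smul_idealElem (a : E) (r : R) (x : E) :
    (a ⊗ₜ[O] op r) • ρ.idealElem x = ρ.idealElem (a * x * ρ r) :=
  Subtype.ext (by
    change a * (x * e * ρ r) = a * x * ρ r * e
    rw [mul_assoc x, ρ.left_mul, mul_assoc (a * x), ρ.mul_right, mul_assoc])

/-- The induction functor `V ↦ Ee ⊗_R V`. -/
def ind : ModuleCat.{u} R ⥤ ModuleCat.{u} E := (actBifunctor O E R).obj ρ.ideal

instance : ρ.ind.Additive := inferInstanceAs ((actBifunctor O E R).obj ρ.ideal).Additive

/-- The element `xe ⊗ v` of `Ee ⊗_R V`. -/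
def indTmul (V : ModuleCat.{u} R) : E →+ V →+ ρ.ind.obj V := (actTmul ρ.ideal V).comp ρ.idealElem

variable {V : ModuleCat.{u} R}

theorem smul_indTmul (a x : E) (v : V) : a • ρ.indTmul V x v = ρ.indTmul V (a * x) v :=
  (smul_actTmul a (ρ.idealElem x) v).trans (congrArg (fun y => actTmul ρ.ideal V y v)
    ((ρ.smul_idealElem a 1 x).trans (by rw [ρ.map_one]; exact Subtype.ext (by
      change a * x * e * e = a * x * e
      rw [mul_assoc, ρ.isIdempotentElem.eq]))))

theorem indTmul_smul (x : E) (r : R) (v : V) : ρ.indTmul V x (r • v) = ρ.indTmul V (x * ρ r) v :=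
  (actTmul_smul r (ρ.idealElem x) v).symm.trans (congrArg (fun y => actTmul ρ.ideal V y v)
    ((ρ.smul_idealElem 1 r x).trans (by rw [one_mul])))

theorem indTmul_mul_right (x : E) (v : V) : ρ.indTmul V (x * e) v = ρ.indTmul V x v := by
  have h := ρ.indTmul_smul x 1 v
  rwa [ρ.map_one, one_smul, eq_comm] at h

@[elab_as_elim]
theorem ind_induction {motive : ρ.ind.obj V → Prop}
    (tmul : ∀ x v, motive (ρ.indTmul V x v))
    (add : ∀ x y, motive x → motive y → motive (x + y)) (x : ρ.ind.obj V) : motive x :=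
  act_induction (M := ρ.ideal) (motive := motive)
    (fun x v => by
      have h : ρ.indTmul V (ρ.idealCoe x) v = actTmul ρ.ideal V x v :=
        congrArg (fun y => actTmul ρ.ideal V y v) (ρ.idealElem_coe x)
      exact h ▸ tmul (ρ.idealCoe x) v) add x

/-- The additive map from `Ee ⊗_R V` determined by a balanced biadditive map. -/
def indLiftAdd {P : Type*} [AddCommGroup P] (f : E →+ V →+ P)
    (hf : ∀ (r : R) x v, f (x * ρ r) v = f x (r • v)) : ρ.ind.obj V →+ P :=
  actLiftAdd (M := ρ.ideal) (f.comp ρ.idealCoe) fun r x v => by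
    refine (congrArg (fun y => f y v) ?_).trans (hf r (ρ.idealCoe x) v)
    exact one_mul _

theorem indLiftAdd_tmul {P : Type*} [AddCommGroup P] (f : E →+ V →+ P)
    (hf : ∀ (r : R) x v, f (x * ρ r) v = f x (r • v)) (x : E) (v : V) :
    ρ.indLiftAdd f hf (ρ.indTmul V x v) = f x v := by
  have h := hf 1 x v
  rw [ρ.map_one, one_smul] at h
  exact h

theorem indLiftAdd_smul (f : E →+ V →+ W) (hf : ∀ (r : R) x v, f (x * ρ r) v = f x (r • v))
    (hs : ∀ (a : E) x v, f (a * x) v = a • f x v) (a : E) (z : ρ.ind.obj V) :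
    ρ.indLiftAdd f hf (a • z) = a • ρ.indLiftAdd f hf z := by
  induction z using ρ.ind_induction with
  | tmul x v => rw [smul_indTmul, indLiftAdd_tmul, indLiftAdd_tmul, hs]
  | add x y hx hy => rw [smul_add, map_add, map_add, hx, hy, smul_add]

/-- The linear map from `Ee ⊗_R V` determined by a balanced biadditive map. -/
def indLift (f : E →+ V →+ W) (hf : ∀ (r : R) x v, f (x * ρ r) v = f x (r • v))
    (hs : ∀ (a : E) x v, f (a * x) v = a • f x v) : ρ.ind.obj V ⟶ W :=
  ModuleCat.ofHom (X := ρ.ind.obj V) (Y := W)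
    { toFun := ρ.indLiftAdd f hf
      map_add' := map_add _
      map_smul' := ρ.indLiftAdd_smul f hf hs }

theorem indLift_tmul (f : E →+ V →+ W) (hf : ∀ (r : R) x v, f (x * ρ r) v = f x (r • v))
    (hs : ∀ (a : E) x v, f (a * x) v = a • f x v) (x : E) (v : V) :
    (ρ.indLift f hf hs).hom (ρ.indTmul V x v) = f x v :=
  ρ.indLiftAdd_tmul f hf x v

theorem ind_hom_ext {φ ψ : ρ.ind.obj V ⟶ W}
    (h : ∀ x v, φ.hom (ρ.indTmul V x v) = ψ.hom (ρ.indTmul V x v)) : φ = ψ := by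
  ext z
  induction z using ρ.ind_induction with
  | tmul x v => exact h x v
  | add x y hx hy => rw [map_add, map_add, hx, hy]

/-- The homomorphism `Ee ⊗_R eW → W`, `x ⊗ w ↦ xw`. -/
def counitApp (W : ModuleCat.{u} E) : ρ.ind.obj (ρ.res.obj W) ⟶ W :=
  ρ.indLift (AddMonoidHom.mk' (fun x => (DistribSMul.toAddMonoidHom W x).comp (ρ.coe W))
      fun x y => by ext w; exact add_smul x y (ρ.coe W w))
    (fun r x w => by
      change (x * ρ r) • ρ.coe W w = x • ρ.coe W (r • w)
      rw [coe_smul, mul_smul])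
    (fun a x w => mul_smul a x (ρ.coe W w))

theorem counitApp_tmul (x : E) (w : ρ.res.obj W) :
    (ρ.counitApp W).hom (ρ.indTmul _ x w) = x • ρ.coe W w :=
  ρ.indLift_tmul _ _ _ x w

/-- The counit of the adjunction between induction and restriction. -/
def counit : ρ.res ⋙ ρ.ind ⟶ 𝟭 (ModuleCat.{u} E) where
  app W := ρ.counitApp W
  naturality {W W'} φ := ρ.ind_hom_ext fun x w => by
    change (ρ.counitApp W').hom (ρ.indTmul _ x ((ρ.res.map φ).hom w)) =
      φ.hom ((ρ.counitApp W).hom (ρ.indTmul _ x w))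
    rw [counitApp_tmul, counitApp_tmul, coe_map, map_smul]

/-- In e(Ee ⊗ eW) every tensor ex ⊗ w equals e ⊗ exw, because exe can be moved across. Elements
fixed by `e` are therefore recovered from their image under the counit. -/
theorem smul_eq_indTmul_counit (z : ρ.ind.obj (ρ.res.obj W))
    (h : e • e • (ρ.counitApp W).hom z = e • (ρ.counitApp W).hom z) :
    e • z = ρ.indTmul _ 1 (ρ.elem (e • (ρ.counitApp W).hom z) h) := by
  induction z using ρ.ind_induction with
  | tmul x w =>
    rw [smul_indTmul, ← indTmul_mul_right, ← ρ.apply_preimage, ← one_mul (ρ _), ← indTmul_smul]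
    congr 1
    refine ρ.coe_injective ?_
    rw [coe_smul, ρ.apply_preimage, coe_elem, counitApp_tmul, mul_smul, smul_coe, mul_smul]
  | add x y hx hy =>
    have h' (z : ρ.ind.obj (ρ.res.obj W)) :
        e • e • (ρ.counitApp W).hom z = e • (ρ.counitApp W).hom z := by
      rw [← mul_smul, ρ.isIdempotentElem.eq]
    rw [smul_add, hx (h' x), hy (h' y), ← map_add]
    congr 1
    refine ρ.coe_injective ?_
    rw [map_add, coe_elem, coe_elem, coe_elem, map_add, smul_add]

/-- The counit need not be invertible, but it is so after cutting with `e`. For complexes this makes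
its cone invisible to the corner, which is all that the comparison of M ⊗ Ff ⊗ f(-) with M ⊗ -
requires. -/
theorem isIso_res_counitApp (W : ModuleCat.{u} E) : IsIso (ρ.res.map (ρ.counitApp W)) := by
  rw [ConcreteCategory.isIso_iff_bijective]
  constructor
  · rw [injective_iff_map_eq_zero (ρ.res.map (ρ.counitApp W)).hom]
    intro z hz
    have hz' : (ρ.counitApp W).hom (ρ.coe _ z) = 0 := congrArg (ρ.coe W) hz
    refine ρ.coe_injective ?_
    rw [← ρ.smul_coe, ρ.smul_eq_indTmul_counit _ (by rw [hz']; simp), map_zero]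
    refine (congrArg _ (ρ.coe_injective ?_)).trans (map_zero _)
    rw [coe_elem, hz', smul_zero, map_zero]
  · intro w
    refine ⟨ρ.elem (ρ.indTmul _ e w) (by rw [smul_indTmul, ρ.isIdempotentElem.eq]),
      ρ.coe_injective ?_⟩
    exact (ρ.counitApp_tmul e w).trans (ρ.smul_coe w)

/-- The map `V → e(Ee ⊗_R V)`, `v ↦ e ⊗ v`. -/
def unitFun (V : ModuleCat.{u} R) (v : V) : ρ.res.obj (ρ.ind.obj V) :=
  ρ.elem (ρ.indTmul V 1 v) (by
    rw [smul_indTmul, mul_one, ← indTmul_mul_right, ← ρ.indTmul_mul_right 1, one_mul,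
      ρ.isIdempotentElem.eq])

theorem coe_unitFun (v : V) : ρ.coe _ (ρ.unitFun V v) = ρ.indTmul V 1 v := rfl

attribute [local irreducible] res in
/-- The homomorphism `V → e(Ee ⊗_R V)`, `v ↦ e ⊗ v`. -/
def unitApp (V : ModuleCat.{u} R) : V ⟶ ρ.res.obj (ρ.ind.obj V) :=
  ModuleCat.ofHom (Y := ρ.res.obj (ρ.ind.obj V))
    { toFun := ρ.unitFun V
      map_add' := fun v w => ρ.coe_injective (by
        rw [map_add, coe_unitFun, coe_unitFun, coe_unitFun, map_add])
      map_smul' := fun r v => ρ.coe_injective (by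
        rw [RingHom.id_apply, coe_smul, coe_unitFun, coe_unitFun, indTmul_smul, smul_indTmul,
          one_mul, mul_one]) }

theorem coe_unitApp (v : V) : ρ.coe _ ((ρ.unitApp V).hom v) = ρ.indTmul V 1 v := rfl

/-- The map `Ee ⊗_R V → V`, `x ⊗ v ↦ (ex) • v`. -/
def unitInv (V : ModuleCat.{u} R) : ρ.ind.obj V →+ V :=
  ρ.indLiftAdd (AddMonoidHom.mk' (fun x => DistribSMul.toAddMonoidHom V (ρ.preimage x))
      fun x y => by ext v; change ρ.preimage (x + y) • v = _; rw [preimage_add, add_smul]; rfl)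
    (fun r x v => by
      change ρ.preimage (x * ρ r) • v = ρ.preimage x • r • v
      rw [preimage_mul, mul_smul])

theorem unitInv_tmul (x : E) (v : V) : ρ.unitInv V (ρ.indTmul V x v) = ρ.preimage x • v :=
  ρ.indLiftAdd_tmul _ _ x v

theorem preimage_one : ρ.preimage 1 = 1 :=
  ρ.injective (by rw [apply_preimage, mul_one, ρ.isIdempotentElem.eq, ρ.map_one])

theorem indTmul_unitInv (z : ρ.ind.obj V) : ρ.indTmul V 1 (ρ.unitInv V z) = e • z := by
  induction z using ρ.ind_induction with
  | tmul x v =>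
    rw [unitInv_tmul, indTmul_smul, one_mul, apply_preimage, indTmul_mul_right, smul_indTmul]
  | add x y hx hy => rw [map_add, map_add, hx, hy, smul_add]

instance isIso_unitApp (V : ModuleCat.{u} R) : IsIso (ρ.unitApp V) := by
  rw [ConcreteCategory.isIso_iff_bijective]
  constructor
  · intro v w h
    have h' := congrArg (ρ.unitInv V) (congrArg (ρ.coe _) h)
    refine (?_ : v = _).trans (h'.trans ?_)
    · exact (by rw [coe_unitApp, unitInv_tmul, preimage_one, one_smul] :
        ρ.unitInv V (ρ.coe _ ((ρ.unitApp V).hom v)) = v).symm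
    · exact (by rw [coe_unitApp, unitInv_tmul, preimage_one, one_smul] :
        ρ.unitInv V (ρ.coe _ ((ρ.unitApp V).hom w)) = w)
  · intro z
    refine ⟨ρ.unitInv V (ρ.coe _ z), ρ.coe_injective ?_⟩
    exact (ρ.indTmul_unitInv _).trans (ρ.smul_coe z)

/-- The unit of the adjunction between induction and restriction. -/
def unitIso : 𝟭 (ModuleCat.{u} R) ≅ ρ.ind ⋙ ρ.res :=
  NatIso.ofComponents (fun V =>
    (asIso (ρ.unitApp V) : V ≅ ρ.res.obj (ρ.ind.obj V))) fun {V V'} φ => by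
    ext v
    exact ρ.coe_injective rfl

end CornerEmbedding

end CornerModules

/-! ### Tensor products with corner bimodules -/

section CornerTensor

open BimodCat Limits

variable {O R S E F : Type u} [CommRing O] [Ring R] [Algebra O R] [Ring S] [Algebra O S]
variable [Ring E] [Algebra O E] [Ring F] [Algebra O F] {e : E} {f : F}

/-- An isomorphism of the `R`-`S`-bimodule `P` with the corner `eMf`, for isomorphisms of `R` and
`S` with `eEe` and `fFf`. -/
structure CornerBimodEmbedding (ρ : CornerEmbedding O R e) (σ : CornerEmbedding O S f)
    (P : BimodCat O R S) (M : BimodCat O E F) where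
  toHom : P →+ M
  map_smul (r : R) (s : S) (p : P) : toHom ((r ⊗ₜ[O] op s) • p) = (ρ r ⊗ₜ[O] op (σ s)) • toHom p
  injective : Function.Injective toHom
  exists_eq (m : M) (h : (e ⊗ₜ[O] op f) • m = m) : ∃ p, toHom p = m

namespace CornerBimodEmbedding

variable {ρ : CornerEmbedding O R e} {σ : CornerEmbedding O S f}
variable {P : BimodCat O R S} {M : BimodCat O E F} (j : CornerBimodEmbedding ρ σ P M)

theorem tmul_smul_smul (M : BimodCat O E F) (a b : E) (x y : F) (m : M) :
    (a ⊗ₜ[O] op x) • (b ⊗ₜ[O] op y) • m = ((a * b) ⊗ₜ[O] op (y * x)) • m := by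
  rw [← mul_smul, Algebra.TensorProduct.tmul_mul_tmul, ← op_mul]

theorem smul_toHom (p : P) : (e ⊗ₜ[O] op f) • j.toHom p = j.toHom p := by
  have h := j.map_smul 1 1 p
  rw [ρ.map_one, σ.map_one] at h
  rw [← h, op_one, ← Algebra.TensorProduct.one_def, one_smul]

theorem left_smul_toHom (p : P) : (e ⊗ₜ[O] op (1 : F)) • j.toHom p = j.toHom p := by
  rw [← j.smul_toHom, tmul_smul_smul, ρ.isIdempotentElem.eq, mul_one]

theorem right_smul_toHom (p : P) : ((1 : E) ⊗ₜ[O] op f) • j.toHom p = j.toHom p := by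
  rw [← j.smul_toHom, tmul_smul_smul, σ.isIdempotentElem.eq, one_mul]

include j in
theorem exists_toHom_eq (m : M) : ∃ p, j.toHom p = (e ⊗ₜ[O] op f) • m :=
  j.exists_eq _ (by rw [tmul_smul_smul, ρ.isIdempotentElem.eq, σ.isIdempotentElem.eq])

/-- The element of `P` corresponding to `emf`. -/
def preimage (m : M) : P := (j.exists_toHom_eq m).choose

theorem toHom_preimage (m : M) : j.toHom (j.preimage m) = (e ⊗ₜ[O] op f) • m :=
  (j.exists_toHom_eq m).choose_spec

theorem preimage_add (m m' : M) : j.preimage (m + m') = j.preimage m + j.preimage m' :=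
  j.injective (by rw [map_add, toHom_preimage, toHom_preimage, toHom_preimage, smul_add])

theorem preimage_toHom (p : P) : j.preimage (j.toHom p) = p :=
  j.injective (by rw [toHom_preimage, smul_toHom])

theorem preimage_right_smul (m : M) (s : S) :
    j.preimage (((1 : E) ⊗ₜ[O] op (σ s)) • m) = ((1 : R) ⊗ₜ[O] op s) • j.preimage m :=
  j.injective (by
    rw [toHom_preimage, j.map_smul, toHom_preimage, tmul_smul_smul, tmul_smul_smul, ρ.map_one,
      ρ.isIdempotentElem.eq, mul_one, σ.left_mul, σ.mul_right])

variable (V : ModuleCat.{u} S)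

/-- The element `m ⊗ (x ⊗ v)` of `M ⊗_F (Ff ⊗_S V)`. -/
theorem actTmul_indTmul (m : M) (x : F) (v : V) :
    actTmul M (σ.ind.obj V) m (σ.indTmul V x v) =
      actTmul M (σ.ind.obj V) (((1 : E) ⊗ₜ[O] op x) • m) (σ.indTmul V 1 v) := by
  rw [actTmul_smul, σ.smul_indTmul, mul_one]

theorem smul_actTmul_toHom (p : P) (z : σ.ind.obj V) :
    e • actTmul M (σ.ind.obj V) (j.toHom p) z = actTmul M (σ.ind.obj V) (j.toHom p) z := by
  rw [smul_actTmul, ← op_one, left_smul_toHom]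

/-- The map `P ⊗_S V → e(M ⊗_F (Ff ⊗_S V))` on pure tensors. -/
def tensorFun (p : P) (v : V) : ρ.res.obj (actObj M (σ.ind.obj V)) :=
  ρ.elem (actTmul M (σ.ind.obj V) (j.toHom p) (σ.indTmul V 1 v)) (j.smul_actTmul_toHom V p _)

theorem coe_tensorFun (p : P) (v : V) : ρ.coe _ (j.tensorFun V p v) =
    actTmul M (σ.ind.obj V) (j.toHom p) (σ.indTmul V 1 v) := rfl

/-- The homomorphism `P ⊗_S V → e(M ⊗_F (Ff ⊗_S V))`. -/
def tensorHom : actObj P V ⟶ ρ.res.obj (actObj M (σ.ind.obj V)) :=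
  actLift (AddMonoidHom.mk' (fun p => AddMonoidHom.mk' (j.tensorFun V p)
      fun v w => ρ.coe_injective (by
        rw [map_add, coe_tensorFun, coe_tensorFun, coe_tensorFun, map_add, map_add]))
      fun p q => by
        ext v
        refine ρ.coe_injective ?_
        change ρ.coe _ (j.tensorFun V _ v) = ρ.coe _ (j.tensorFun V p v + j.tensorFun V q v)
        rw [map_add, coe_tensorFun, coe_tensorFun, coe_tensorFun, map_add, map_add,
          AddMonoidHom.add_apply])
    (fun s p v => by
      refine ρ.coe_injective ?_
      change ρ.coe _ (j.tensorFun V _ v) = ρ.coe _ (j.tensorFun V p _)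
      rw [coe_tensorFun, coe_tensorFun, j.map_smul, σ.indTmul_smul, one_mul,
        actTmul_indTmul (x := σ s),
        ← j.left_smul_toHom, tmul_smul_smul, tmul_smul_smul, ρ.map_one, ρ.isIdempotentElem.eq,
        one_mul, one_mul])
    (fun r p v => by
      refine ρ.coe_injective ?_
      change ρ.coe _ (j.tensorFun V _ v) = ρ.coe _ (r • j.tensorFun V p v)
      rw [coe_tensorFun, ρ.coe_smul, coe_tensorFun, smul_actTmul, ← op_one (α := S), j.map_smul,
        ← op_one (α := F), ← j.right_smul_toHom, tmul_smul_smul, tmul_smul_smul, σ.map_one, σ.isIdempotentElem.eq,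
        mul_one, mul_one])

theorem coe_tensorHom_tmul (p : P) (v : V) :
    ρ.coe _ ((j.tensorHom V).hom (actTmul P V p v)) =
      actTmul M (σ.ind.obj V) (j.toHom p) (σ.indTmul V 1 v) := rfl

/-- The map `Ff ⊗_S V → P ⊗_S V`, `x ⊗ v ↦ emx ⊗ v`. -/
def tensorInvAux (m : M) : σ.ind.obj V →+ actObj P V :=
  σ.indLiftAdd
      (AddMonoidHom.mk' (fun x => actTmul P V (j.preimage (((1 : E) ⊗ₜ[O] op x) • m)))
        fun x y => by
          rw [MulOpposite.op_add, TensorProduct.tmul_add, add_smul, preimage_add, map_add])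
      (fun s x v => by
        change actTmul P V (j.preimage (((1 : E) ⊗ₜ[O] op (x * σ s)) • m)) v =
          actTmul P V (j.preimage (((1 : E) ⊗ₜ[O] op x) • m)) (s • v)
        rw [← actTmul_smul, ← preimage_right_smul, tmul_smul_smul, one_mul])

theorem tensorInvAux_tmul (m : M) (x : F) (v : V) :
    j.tensorInvAux V m (σ.indTmul V x v) =
      actTmul P V (j.preimage (((1 : E) ⊗ₜ[O] op x) • m)) v :=
  σ.indLiftAdd_tmul _ _ x v

theorem tensorInvAux_add (m m' : M) :
    j.tensorInvAux V (m + m') = j.tensorInvAux V m + j.tensorInvAux V m' := by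
  ext z
  induction z using σ.ind_induction with
  | tmul x v =>
    rw [AddMonoidHom.add_apply, tensorInvAux_tmul, tensorInvAux_tmul, tensorInvAux_tmul, smul_add,
      preimage_add, map_add, AddMonoidHom.add_apply]
  | add x y hx hy => rw [map_add, map_add, hx, hy]

theorem tensorInvAux_smul (y : F) (m : M) (z : σ.ind.obj V) :
    j.tensorInvAux V (((1 : E) ⊗ₜ[O] op y) • m) z = j.tensorInvAux V m (y • z) := by
  induction z using σ.ind_induction with
  | tmul x v => rw [σ.smul_indTmul, tensorInvAux_tmul, tensorInvAux_tmul, tmul_smul_smul, one_mul]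
  | add a b ha hb => rw [smul_add, map_add, map_add, ha, hb]

/-- The map `M ⊗_F (Ff ⊗_S V) → P ⊗_S V`, `m ⊗ (x ⊗ v) ↦ emx ⊗ v`. -/
def tensorInv : actObj M (σ.ind.obj V) →+ actObj P V :=
  actLiftAdd (AddMonoidHom.mk' (j.tensorInvAux V) (j.tensorInvAux_add V)) (j.tensorInvAux_smul V)

theorem tensorInv_tmul (m : M) (x : F) (v : V) :
    j.tensorInv V (actTmul M _ m (σ.indTmul V x v)) =
      actTmul P V (j.preimage (((1 : E) ⊗ₜ[O] op x) • m)) v :=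
  j.tensorInvAux_tmul V m x v

theorem tensorInv_tensorHom (z : actObj P V) :
    j.tensorInv V (ρ.coe _ ((j.tensorHom V).hom z)) = z := by
  induction z using act_induction with
  | tmul p v =>
    rw [coe_tensorHom_tmul, tensorInv_tmul, op_one, ← Algebra.TensorProduct.one_def, one_smul,
      preimage_toHom]
  | add x y hx hy => rw [map_add, map_add, map_add, hx, hy]

theorem tensorHom_tensorInv (z : actObj M (σ.ind.obj V)) :
    ρ.coe _ ((j.tensorHom V).hom (j.tensorInv V z)) = e • z := by
  induction z using act_induction with
  | tmul m z =>
    induction z using σ.ind_induction with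
    | tmul x v =>
      rw [tensorInv_tmul, coe_tensorHom_tmul, toHom_preimage, tmul_smul_smul, smul_actTmul,
        ← op_one (α := F), ← σ.indTmul_mul_right x, actTmul_indTmul (x := x * f), tmul_smul_smul, mul_one,
        one_mul, one_mul]
    | add x y hx hy => rw [map_add, map_add, map_add, map_add, hx, hy, smul_add]
  | add x y hx hy => rw [map_add, map_add, map_add, hx, hy, smul_add]

theorem isIso_tensorHom : IsIso (j.tensorHom V) := by
  rw [ConcreteCategory.isIso_iff_bijective]
  constructor
  · intro v w h
    have h' := congrArg (fun z => j.tensorInv V (ρ.coe _ z)) h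
    exact (j.tensorInv_tensorHom V v).symm.trans (h'.trans (j.tensorInv_tensorHom V w))
  · intro z
    refine ⟨j.tensorInv V (ρ.coe _ z), ρ.coe_injective ?_⟩
    exact (j.tensorHom_tensorInv V _).trans (ρ.smul_coe z)

/-- The isomorphism `P ⊗_S V ≅ e(M ⊗_F (Ff ⊗_S V))`. -/
def tensorIso : actObj P V ≅ ρ.res.obj (actObj M (σ.ind.obj V)) :=
  haveI := j.isIso_tensorHom V
  asIso (j.tensorHom V)

variable {V}

/-- Together with naturality in the bimodule, this makes the termwise isomorphisms an isomorphism of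
double complexes; it then passes to total complexes by `totalOf.mapIso`. -/
theorem tensorHom_naturality {V' : ModuleCat.{u} S} (φ : V ⟶ V') :
    actMap (𝟙 P) φ ≫ j.tensorHom V' =
      j.tensorHom V ≫ ρ.res.map (actMap (𝟙 M) (σ.ind.map φ)) :=
  act_hom_ext fun _ _ => ρ.coe_injective rfl

theorem tensorHom_naturality_left {P' : BimodCat O R S} {M' : BimodCat O E F}
    (j' : CornerBimodEmbedding ρ σ P' M') (α : P ⟶ P') (β : M ⟶ M')
    (h : ∀ p, j'.toHom (α.hom p) = β.hom (j.toHom p)) :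
    actMap α (𝟙 V) ≫ j'.tensorHom V =
      j.tensorHom V ≫ ρ.res.map (actMap β (𝟙 (σ.ind.obj V))) :=
  act_hom_ext fun p v => ρ.coe_injective
    (congrArg (fun m => actTmul M' (σ.ind.obj V) m (σ.indTmul V 1 v)) (h p))

end CornerBimodEmbedding

/-- An isomorphism of the complex `P` of `R`-`S`-bimodules with the corner `eMf`. -/
structure CornerComplexEmbedding (ρ : CornerEmbedding O R e) (σ : CornerEmbedding O S f)
    (P : CochainComplex (BimodCat O R S) ℤ) (M : CochainComplex (BimodCat O E F) ℤ) where
  embedding (i : ℤ) : CornerBimodEmbedding ρ σ (P.X i) (M.X i)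
  comm (i : ℤ) (p : P.X i) : (embedding (i + 1)).toHom ((P.d i (i + 1)).hom p) =
    (M.d i (i + 1)).hom ((embedding i).toHom p)

namespace CornerComplexEmbedding

variable {ρ : CornerEmbedding O R e} {σ : CornerEmbedding O S f}
variable {P : CochainComplex (BimodCat O R S) ℤ} {M : CochainComplex (BimodCat O E F) ℤ}
variable (j : CornerComplexEmbedding ρ σ P M) (s : Finset ℤ) (hs : ∀ i ∉ s, IsZero (M.X i))

/-- The isomorphism of double complexes underlying `P ⊗_S V ≅ e(M ⊗_F (Ff ⊗_S V))`. -/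
def termIso (V : CochainComplex (ModuleCat.{u} S) ℤ) (i k : ℤ) :
    ((actBifunctor O R S).obj (P.X i)).obj (V.X k) ≅
      ρ.res.obj (((actBifunctor O E F).obj (M.X i)).obj
        (((σ.ind.mapHomologicalComplex (ComplexShape.up ℤ)).obj V).X k)) :=
  (j.embedding i).tensorIso (V.X k)

/-- The isomorphism `P ⊗_S V ≅ e(M ⊗_F (Ff ⊗_S V))` for complexes. -/
def tensorFunctorIsoApp (V : CochainComplex (ModuleCat.{u} S) ℤ) :
    (tensorFunctor O R S P).obj V ≅ (ρ.res.mapHomologicalComplex (ComplexShape.up ℤ)).obj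
      ((tensorFunctor O E F M).obj ((σ.ind.mapHomologicalComplex (ComplexShape.up ℤ)).obj V)) :=
  totalOf.mapIso (j.termIso V)
    (fun i _ => (j.embedding i).tensorHom_naturality_left (j.embedding (i + 1)) (P.d i (i + 1))
      (M.d i (i + 1)) (j.comm i))
    (fun i k => (j.embedding i).tensorHom_naturality (V.d k (k + 1))) s hs

theorem tensorFunctorIsoApp_naturality {V V' : CochainComplex (ModuleCat.{u} S) ℤ} (φ : V ⟶ V') :
    (tensorFunctor O R S P).map φ ≫ (j.tensorFunctorIsoApp s hs V').hom =
      (j.tensorFunctorIsoApp s hs V).hom ≫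
        (ρ.res.mapHomologicalComplex (ComplexShape.up ℤ)).map ((tensorFunctor O E F M).map
          ((σ.ind.mapHomologicalComplex (ComplexShape.up ℤ)).map φ)) := by
  ext n : 1
  exact totalOf.mapIsoHom_naturality (j.termIso V) (j.termIso V') φ
    ((σ.ind.mapHomologicalComplex (ComplexShape.up ℤ)).map φ)
    (fun i k => (j.embedding i).tensorHom_naturality (φ.f k)) n

/-- The isomorphism `P ⊗_S - ≅ e(M ⊗_F (Ff ⊗_S -))`. -/
def tensorFunctorIso : tensorFunctor O R S P ≅
    σ.ind.mapHomologicalComplex (ComplexShape.up ℤ) ⋙ tensorFunctor O E F M ⋙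
      ρ.res.mapHomologicalComplex (ComplexShape.up ℤ) :=
  NatIso.ofComponents (j.tensorFunctorIsoApp s hs) (j.tensorFunctorIsoApp_naturality s hs)

end CornerComplexEmbedding

end CornerTensor

/-! ### Quasi-isomorphisms and corners -/

section PreservesSplit

open Limits Pretriangulated HomologicalComplex CochainComplex

universe v₁ u₁ v₂ u₂ v₃ u₃

variable {C : Type u₁} [Category.{v₁} C] {D : Type u₂} [Category.{v₂} D]
variable {D' : Type u₃} [Category.{v₃} D'] [Preadditive C] [Preadditive D] [Preadditive D']

theorem preservesDegreewiseSplit_mapHomologicalComplex (F : C ⥤ D) [F.Additive] :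
    PreservesDegreewiseSplit (F.mapHomologicalComplex (ComplexShape.up ℤ)) := by
  intro S σ
  refine ⟨fun n => (σ n).map F, ?_⟩
  ext n
  refine (homOfDegreewiseSplit_f _ _ n).trans (Eq.trans ?_ (Category.comp_id _).symm)
  refine Eq.trans ?_ (congrArg F.map (homOfDegreewiseSplit_f S σ n).symm)
  exact ((F.map_comp (σ n).s (S.X₂.d n (n + 1) ≫ (σ (n + 1)).r)).trans
    (congrArg (F.map (σ n).s ≫ ·) (F.map_comp (S.X₂.d n (n + 1)) (σ (n + 1)).r))).symm

theorem PreservesDegreewiseSplit.comp {G : CochainComplex C ℤ ⥤ CochainComplex D ℤ} [G.Additive]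
    [G.CommShift ℤ] {G' : CochainComplex D ℤ ⥤ CochainComplex D' ℤ} [G'.Additive]
    [G'.CommShift ℤ] (hG : PreservesDegreewiseSplit G) (hG' : PreservesDegreewiseSplit G') :
    PreservesDegreewiseSplit (G ⋙ G') := by
  intro S σ
  obtain ⟨σ', h⟩ := hG S σ
  obtain ⟨σ'', h'⟩ := hG' (S.map G) σ'
  refine ⟨σ'', h'.trans ?_⟩
  rw [h, Functor.commShiftIso_comp_hom_app]
  exact (congrArg (· ≫ _) (G'.map_comp (G.map (homOfDegreewiseSplit S σ))
    ((G.commShiftIso (1 : ℤ)).hom.app S.X₁))).trans (Category.assoc _ _ _)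

/-- The converse of `PreservesDegreewiseSplit.quasiIso_map`. Together they translate statements
about acyclic complexes into statements about quasi-isomorphisms. -/
theorem PreservesDegreewiseSplit.acyclic_obj_mappingCone
    {C : Type u₁} [Category.{v₁} C] {D : Type u₂} [Category.{v₂} D] [Abelian C] [Abelian D]
    {G : CochainComplex C ℤ ⥤ CochainComplex D ℤ} [G.Additive] [G.CommShift ℤ]
    (hG : PreservesDegreewiseSplit G) {K L : CochainComplex C ℤ} (φ : K ⟶ L)
    (h : QuasiIso (G.map φ)) : (G.obj (mappingCone φ)).Acyclic := by
  let := HasDerivedCategory.standard D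
  have h1 : IsIso (DerivedCategory.Q.map (G.map φ)) :=
    (DerivedCategory.isIso_Q_map_iff_quasiIso _ _).2 h
  have h2 : IsZero (DerivedCategory.Q.obj (G.obj (mappingCone φ))) :=
    (Triangle.isZero₃_iff_isIso₁ _ (hG.map_mappingCone_distinguished φ)).2 h1
  -- The object vanishes in the derived category, so zero is a quasi-isomorphism. On cohomology it
  -- is then both zero and invertible.
  have h3 : QuasiIso (0 : G.obj (mappingCone φ) ⟶ G.obj (mappingCone φ)) := by
    rw [← DerivedCategory.isIso_Q_map_iff_quasiIso]
    exact ⟨0, h2.eq_of_src _ _, h2.eq_of_src _ _⟩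
  intro i
  rw [exactAt_iff_isZero_homology]
  have h4 : IsIso (homologyMap (0 : G.obj (mappingCone φ) ⟶ G.obj (mappingCone φ)) i) :=
    inferInstance
  rw [homologyMap_zero] at h4
  exact (IsZero.iff_id_eq_zero _).2 (by
    rw [← cancel_mono (0 : (G.obj (mappingCone φ)).homology i ⟶
      (G.obj (mappingCone φ)).homology i), zero_comp, comp_zero])

end PreservesSplit

/-! ### Tensoring with corner bimodules respects quasi-isomorphisms -/

section CornerQuasiIso

open BimodCat Limits CochainComplex

variable {O R S E F : Type u} [CommRing O] [Ring R] [Algebra O R] [Ring S] [Algebra O S]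
variable [Ring E] [Algebra O E] [Ring F] [Algebra O F] {e : E} {f : F}

namespace CornerEmbedding

variable (ρ : CornerEmbedding O R e)

/-- The functor `W ↦ eW` on complexes. -/
abbrev resComplex : CochainComplex (ModuleCat.{u} E) ℤ ⥤ CochainComplex (ModuleCat.{u} R) ℤ :=
  ρ.res.mapHomologicalComplex (ComplexShape.up ℤ)

/-- The functor `V ↦ Ee ⊗_R V` on complexes. -/
abbrev indComplex : CochainComplex (ModuleCat.{u} R) ℤ ⥤ CochainComplex (ModuleCat.{u} E) ℤ :=
  ρ.ind.mapHomologicalComplex (ComplexShape.up ℤ)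

/-- The counit of the adjunction between induction and restriction, on complexes. -/
def counitComplex : ρ.resComplex ⋙ ρ.indComplex ⟶ 𝟭 _ :=
  NatTrans.mapHomologicalComplex ρ.counit (ComplexShape.up ℤ) ≫
    (Functor.mapHomologicalComplexIdIso (ModuleCat.{u} E) (ComplexShape.up ℤ)).hom

/-- The unit of the adjunction between induction and restriction, on complexes. -/
def unitComplexIso : 𝟭 _ ≅ ρ.indComplex ⋙ ρ.resComplex :=
  (Functor.mapHomologicalComplexIdIso (ModuleCat.{u} R) (ComplexShape.up ℤ)).symm ≪≫
    NatIso.mapHomologicalComplex ρ.unitIso (ComplexShape.up ℤ)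

theorem quasiIso_res_counitComplex (K : CochainComplex (ModuleCat.{u} E) ℤ) :
    QuasiIso (ρ.resComplex.map (ρ.counitComplex.app K)) := by
  have (n : ℤ) : IsIso ((ρ.resComplex.map (ρ.counitComplex.app K)).f n) := by
    have h := ρ.isIso_res_counitApp (K.X n)
    have h1 : (ρ.resComplex.map (ρ.counitComplex.app K)).f n = ρ.res.map (ρ.counitApp (K.X n)) :=
      congrArg ρ.res.map (Category.comp_id (ρ.counitApp (K.X n)))
    rw [h1]
    exact h
  have : IsIso (ρ.resComplex.map (ρ.counitComplex.app K)) :=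
    HomologicalComplex.Hom.isIso_of_components _
  infer_instance

end CornerEmbedding

variable {ρ : CornerEmbedding O R e} {σ : CornerEmbedding O S f}
variable {M : CochainComplex (BimodCat O E F) ℤ} {N : CochainComplex (BimodCat O F E) ℤ}

/-- Transfer of corner acyclicity, applied to the cone of `φ`: the functor M ⊗ - respects morphisms
that are quasi-isomorphisms only after cutting with `f`. -/
theorem quasiIso_res_tensorFunctor_map (ρ : CornerEmbedding O R e) (σ : CornerEmbedding O S f)
    (hE : IsFrobeniusCorner O e) (hF : IsFrobeniusCorner O f)
    (hMN : IsRickardEquivalence M N) {K L : CochainComplex (ModuleCat.{u} F) ℤ} (φ : K ⟶ L)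
    (hφ : QuasiIso (σ.resComplex.map φ)) :
    QuasiIso (ρ.resComplex.map ((tensorFunctor O E F M).map φ)) := by
  have h1 := (σ.acyclic_res_iff _).1
    ((preservesDegreewiseSplit_mapHomologicalComplex σ.res).acyclic_obj_mappingCone φ hφ)
  have h2 := h1.tensor_of_isRickardEquivalence hE hF ρ.isIdempotentElem σ.isIdempotentElem hMN
  exact ((preservesDegreewiseSplit_tensorFunctor M).comp
    (preservesDegreewiseSplit_mapHomologicalComplex ρ.res)).quasiIso_map φ
      ((ρ.acyclic_res_iff _).2 h2)

variable {P : CochainComplex (BimodCat O R S) ℤ} {Q : CochainComplex (BimodCat O S R) ℤ}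

theorem quasiIso_iff_of_natIso {C D : Type*} [Category* C] [Category* D] [Abelian D]
    {G H : C ⥤ CochainComplex D ℤ} (α : G ≅ H) {X Y : C} (φ : X ⟶ Y) :
    QuasiIso (G.map φ) ↔ QuasiIso (H.map φ) :=
  quasiIso_iff_of_arrow_mk_iso _ _ (Arrow.isoMk (α.app X) (α.app Y) (by simp))

/-- Induction from the corner need not be exact, but restriction undoes it. So the induced morphism
is a quasi-isomorphism after cutting, which is enough for `quasiIso_res_tensorFunctor_map`. -/
theorem CornerComplexEmbedding.quasiIso_tensorFunctor_map (j : CornerComplexEmbedding ρ σ P M)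
    (hE : IsFrobeniusCorner O e) (hF : IsFrobeniusCorner O f)
    (hMN : IsRickardEquivalence M N) {K L : CochainComplex (ModuleCat.{u} S) ℤ} (φ : K ⟶ L)
    (hφ : QuasiIso φ) : QuasiIso ((tensorFunctor O R S P).map φ) := by
  obtain ⟨s, hs⟩ := hMN.bounded_left.exists_finset
  rw [quasiIso_iff_of_natIso (j.tensorFunctorIso s hs)]
  exact quasiIso_res_tensorFunctor_map ρ σ hE hF hMN _
    ((quasiIso_iff_of_natIso σ.unitComplexIso φ).1 hφ)

/-- The composite is e(M ⊗ Ff ⊗ f(N ⊗ Ee ⊗ V)). The counit removes Ff ⊗ f(-), the homotopy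
equivalence M ⊗ N ≃ E removes the bimodules, and e(Ee ⊗ V) ≅ V remains. -/
theorem CornerComplexEmbedding.exists_counit (j : CornerComplexEmbedding ρ σ P M)
    (k : CornerComplexEmbedding σ ρ Q N)
    (hE : IsFrobeniusCorner O e) (hF : IsFrobeniusCorner O f)
    (hMN : IsRickardEquivalence M N) :
    ∃ c : tensorFunctor O S R Q ⋙ tensorFunctor O R S P ⟶ 𝟭 _, ∀ K, QuasiIso (c.app K) := by
  obtain ⟨s, hs⟩ := hMN.bounded_left.exists_finset
  obtain ⟨t, ht⟩ := hMN.bounded_right.exists_finset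
  obtain ⟨c, hc⟩ := _root_.exists_counit M N hMN.bounded_left hMN.bounded_right
    hMN.homotopyEquiv_left.some
  let TM := tensorFunctor O E F M
  let TN := tensorFunctor O F E N
  let α : tensorFunctor O S R Q ⋙ tensorFunctor O R S P ≅
      (ρ.indComplex ⋙ TN ⋙ σ.resComplex) ⋙ (σ.indComplex ⋙ TM ⋙ ρ.resComplex) :=
    Functor.isoWhiskerRight (k.tensorFunctorIso t ht) _ ≪≫
      Functor.isoWhiskerLeft _ (j.tensorFunctorIso s hs)
  let β : (ρ.indComplex ⋙ TN ⋙ σ.resComplex) ⋙ (σ.indComplex ⋙ TM ⋙ ρ.resComplex) ⟶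
      ρ.indComplex ⋙ (TN ⋙ TM) ⋙ ρ.resComplex :=
    { app := fun K => ρ.resComplex.map (TM.map (σ.counitComplex.app (TN.obj (ρ.indComplex.obj K))))
      naturality := fun K L φ => by
        have h := σ.counitComplex.naturality (TN.map (ρ.indComplex.map φ))
        exact ((ρ.resComplex.map_comp _ _).symm.trans (congrArg ρ.resComplex.map
          ((TM.map_comp _ _).symm.trans ((congrArg TM.map h).trans (TM.map_comp _ _))))).trans
            (ρ.resComplex.map_comp _ _) }
  let γ : ρ.indComplex ⋙ (TN ⋙ TM) ⋙ ρ.resComplex ⟶ ρ.indComplex ⋙ ρ.resComplex :=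
    Functor.whiskerLeft ρ.indComplex (Functor.whiskerRight c ρ.resComplex)
  refine ⟨α.hom ≫ β ≫ γ ≫ ρ.unitComplexIso.inv, fun K => ?_⟩
  -- The counit is only a quasi-isomorphism on the corner at `f`, and that is preserved by e(M ⊗ -).
  have h1 : QuasiIso (β.app K) := quasiIso_res_tensorFunctor_map ρ σ hE hF hMN _
    (σ.quasiIso_res_counitComplex _)
  have h2 : QuasiIso (γ.app K) := by
    obtain ⟨ε, hε⟩ := hc (ρ.indComplex.obj K)
    change QuasiIso (ρ.resComplex.map (c.app (ρ.indComplex.obj K)))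
    rw [← hε]
    exact (ρ.res.mapHomotopyEquiv ε).quasiIso_hom
  rw [NatTrans.comp_app, NatTrans.comp_app, NatTrans.comp_app]
  infer_instance

end CornerQuasiIso

/-! ### Full subcategories and bounded derived categories -/

section FullSubcategory

open Limits Pretriangulated HomologicalComplex CochainComplex

universe v₁ u₁ v₂ u₂ w₁ w₂

variable {C : Type u₁} [Category.{v₁} C] {D : Type u₂} [Category.{v₂} D]
variable [Preadditive C] [Preadditive D] (Z : ObjectProperty D)
variable (U : CochainComplex C ℤ ⥤ CochainComplex D ℤ) (hU : ∀ K n, Z ((U.obj K).X n))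

theorem additive_liftFunctorObjectProperty [U.Additive] :
    (liftFunctorObjectProperty Z U hU).Additive where
  map_add {K L f g} := by
    ext n
    exact congrArg (fun φ => φ.f n) (U.map_add (f := f) (g := g))

/-- Corestricting a functor between categories of complexes to a full subcategory and composing
with the inclusion gives back the functor. -/
def liftFunctorObjectPropertyCompIso :
    liftFunctorObjectProperty Z U hU ⋙ Z.ι.mapHomologicalComplex (ComplexShape.up ℤ) ≅ U :=
  NatIso.ofComponents (fun K => HomologicalComplex.Hom.isoOfComponents (fun n => Iso.refl _)
    (fun i j _ => (Category.id_comp _).trans (Category.comp_id _).symm)) (fun φ => by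
      ext n
      exact (Category.comp_id _).trans (Category.id_comp _).symm)

/-- The compatibility with shifts of the corestriction of a functor to a full subcategory. -/
@[reducible] def commShiftLiftFunctorObjectProperty [U.CommShift ℤ] :
    (liftFunctorObjectProperty Z U hU).CommShift ℤ :=
  Functor.CommShift.ofComp (liftFunctorObjectPropertyCompIso Z U hU) ℤ

/-- Retractions and sections lie in the full subcategory automatically. The shift isomorphisms agree
with those of `U`, because the comparison isomorphism is the identity in each degree. -/
theorem preservesDegreewiseSplit_liftFunctorObjectProperty [U.Additive] [U.CommShift ℤ]
    (h : PreservesDegreewiseSplit U) :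
    letI := commShiftLiftFunctorObjectProperty Z U hU
    haveI := additive_liftFunctorObjectProperty Z U hU
    PreservesDegreewiseSplit (liftFunctorObjectProperty Z U hU) := by
  letI := commShiftLiftFunctorObjectProperty Z U hU
  haveI := additive_liftFunctorObjectProperty Z U hU
  intro S σ
  obtain ⟨σ', h'⟩ := h S σ
  refine ⟨fun n =>
    { r := ObjectProperty.homMk (σ' n).r
      s := ObjectProperty.homMk (σ' n).s
      f_r := ObjectProperty.hom_ext _ (σ' n).f_r
      s_g := ObjectProperty.hom_ext _ (σ' n).s_g
      id := ObjectProperty.hom_ext _ (σ' n).id }, ?_⟩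
  apply (Z.ι.mapHomologicalComplex (ComplexShape.up ℤ)).map_injective
  ext n
  have h1 := congrArg (fun φ => φ.f n) h'
  have h2 := congrArg (fun φ => φ.f n) (Functor.CommShift.OfComp.map_iso_hom_app
    (liftFunctorObjectPropertyCompIso Z U hU) (1 : ℤ) S.X₁)
  have h3 : ((Z.ι.mapHomologicalComplex (ComplexShape.up ℤ)).map
      (((liftFunctorObjectProperty Z U hU).commShiftIso (1 : ℤ)).hom.app S.X₁)).f n =
      ((U.commShiftIso (1 : ℤ)).hom.app S.X₁).f n :=
    h2.trans ((Category.id_comp _).trans ((congrArg (_ ≫ ·) (Category.id_comp _)).trans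
      (Category.comp_id _)))
  refine Eq.trans (b := (homOfDegreewiseSplit (S.map U) σ').f n) ?_ (h1.trans ?_)
  · exact (congrArg Z.ι.map (homOfDegreewiseSplit_f _ _ n)).trans
      (homOfDegreewiseSplit_f _ _ n).symm
  · refine Eq.trans ?_ (congrArg (fun φ => φ.f n) ((Z.ι.mapHomologicalComplex
      (ComplexShape.up ℤ)).map_comp ((liftFunctorObjectProperty Z U hU).map
        (homOfDegreewiseSplit S σ)) (((liftFunctorObjectProperty Z U hU).commShiftIso
          (1 : ℤ)).hom.app S.X₁))).symm
    exact congrArg ((U.map (homOfDegreewiseSplit S σ)).f n ≫ ·) h3.symm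

end FullSubcategory

/-! ### Bounded objects of derived categories -/

section Bounded

open Limits

universe v₁ u₁ v₂ u₂ w₁ w₂

variable {C : Type u₁} [Category.{v₁} C] {D : Type u₂} [Category.{v₂} D]
variable [Abelian C] [Abelian D] [HasDerivedCategory.{w₁} C] [HasDerivedCategory.{w₂} D]

open DerivedCategory

theorem DerivedCategory.bounded_Q_obj {K : CochainComplex C ℤ} (hK : IsBoundedComplex K) :
    TStructure.t.bounded (Q.obj K) := by
  obtain ⟨n, hn⟩ := hK
  refine ⟨⟨-n, K, Iso.refl _, ?_⟩, ⟨n, K, Iso.refl _, ?_⟩⟩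
  · rw [CochainComplex.isStrictlyGE_iff]
    exact fun i hi => hn i (by rw [lt_abs]; omega)
  · rw [CochainComplex.isStrictlyLE_iff]
    exact fun i hi => hn i (by rw [lt_abs]; omega)

theorem DerivedCategory.exists_isBoundedComplex {K : DerivedCategory C}
    (hK : TStructure.t.bounded K) : ∃ L : CochainComplex C ℤ, IsBoundedComplex L ∧
      Nonempty (K ≅ Q.obj L) := by
  obtain ⟨⟨a, ha⟩, ⟨b, hb⟩⟩ := hK
  have : K.IsGE a := ha
  have : K.IsLE b := hb
  obtain ⟨L, hLa, hLb, e⟩ := K.exists_iso_Q_obj_of_isGE_of_isLE a b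
  refine ⟨L, ⟨a.natAbs + b.natAbs, fun i hi => ?_⟩, e⟩
  rw [lt_abs] at hi
  rcases hi with hi | hi
  · exact L.isZero_of_isStrictlyLE b i (by omega)
  · exact L.isZero_of_isStrictlyGE a i (by omega)

/-- An object with bounded cohomology is represented by a bounded complex, which `G` keeps bounded.
For the converse the object is recovered through the inverse functor, represented by `H`. -/
theorem DerivedCategory.bounded_iff_of_equivalence (Φ : DerivedCategory C ≌ DerivedCategory D)
    {G : CochainComplex C ℤ ⥤ CochainComplex D ℤ} {H : CochainComplex D ℤ ⥤ CochainComplex C ℤ}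
    (e : Q ⋙ Φ.functor ≅ G ⋙ Q) (e' : Q ⋙ Φ.inverse ≅ H ⋙ Q)
    (hG : ∀ K, IsBoundedComplex K → IsBoundedComplex (G.obj K))
    (hH : ∀ K, IsBoundedComplex K → IsBoundedComplex (H.obj K)) (K : DerivedCategory C) :
    TStructure.t.bounded K ↔ TStructure.t.bounded (Φ.functor.obj K) := by
  constructor
  · intro hK
    obtain ⟨L, hL, ⟨i⟩⟩ := exists_isBoundedComplex hK
    exact TStructure.t.bounded.prop_of_iso ((Φ.functor.mapIso i ≪≫ e.app L).symm)
      (bounded_Q_obj (hG L hL))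
  · intro hK
    obtain ⟨L, hL, ⟨i⟩⟩ := exists_isBoundedComplex hK
    exact TStructure.t.bounded.prop_of_iso
      ((Φ.unitIso.app K ≪≫ Φ.inverse.mapIso i ≪≫ e'.app L).symm) (bounded_Q_obj (hH L hL))

end Bounded

/-! ### Derived equivalences of corner algebras -/

section CornerDerived

open BimodCat Limits HomologicalComplex

variable {O R S E F : Type u} [CommRing O] [Ring R] [Algebra O R] [Ring S] [Algebra O S]
variable [Ring E] [Algebra O E] [Ring F] [Algebra O F] {e : E} {f : F}

attribute [local instance] baseModule isScalarTower_base

attribute [local instance] leftModule rightModule isScalarTower_left in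
theorem BimodCat.finite_actObj [Module.Finite O S] {M : BimodCat O R S} (hM : Module.Finite O M)
    {V : ModuleCat.{u} S} (hV : Module.Finite S V) : Module.Finite R (actObj M V) := by
  have hV' : Module.Finite O V := Module.Finite.trans S V
  have h : Module.Finite O (BalancedTensor O S M V) :=
    Module.Finite.of_surjective (BalancedTensor.mk O S M V) BalancedTensor.mk_surjective
  have := smulCommClass M
  let : Module R (BalancedTensor O S M V) := BalancedTensor.leftModule O S M V R
  have : IsScalarTower O R (BalancedTensor O S M V) := ⟨fun o r x => by
    induction x using BalancedTensor.induction with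
    | tmul m n =>
      change BalancedTensor.mk O S M V (((o • r) • m) ⊗ₜ n) =
        o • BalancedTensor.mk O S M V ((r • m) ⊗ₜ n)
      rw [smul_assoc, ← map_smul, TensorProduct.smul_tmul']
    | add x y hx hy => rw [smul_add, smul_add, smul_add, hx, hy]⟩
  exact Module.Finite.of_restrictScalars_finite O R (BalancedTensor O S M V)

theorem CornerBimodEmbedding.map_base_smul {ρ : CornerEmbedding O R e} {σ : CornerEmbedding O S f}
    {P : BimodCat O R S} {M : BimodCat O E F} (j : CornerBimodEmbedding ρ σ P M) (o : O) (p : P) :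
    j.toHom (o • p) = o • j.toHom p := by
  rw [base_smul_def, base_smul_def, Algebra.TensorProduct.algebraMap_apply, ← op_one, j.map_smul,
    Algebra.algebraMap_eq_smul_one, ρ.toLinearMap.map_smul, ρ.map_one, σ.map_one,
    ← TensorProduct.smul_tmul']
  exact (congrArg (· • j.toHom p) (Algebra.smul_def o (e ⊗ₜ[O] op f))).trans
    (by rw [mul_smul, j.smul_toHom])

theorem CornerBimodEmbedding.finite {ρ : CornerEmbedding O R e} {σ : CornerEmbedding O S f}
    [IsNoetherianRing O] {P : BimodCat O R S} {M : BimodCat O E F}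
    (j : CornerBimodEmbedding ρ σ P M) (hM : Module.Finite O M) : Module.Finite O P :=
  Module.Finite.of_injective (show P →ₗ[O] M from
    { j.toHom with map_smul' := j.map_base_smul }) j.injective

theorem IsFGProjectiveBimod.finite [Module.Finite O E] {M : BimodCat O E F}
    (hM : IsFGProjectiveBimod M) : Module.Finite O M := by
  let := leftModule M
  have := isScalarTower_left M
  have := hM.left_finite
  exact Module.Finite.trans E M

theorem finite_tensorFunctor_obj_X [Module.Finite O S] {P : CochainComplex (BimodCat O R S) ℤ}
    (hPb : IsBoundedComplex P) (hP : ∀ i, Module.Finite O (P.X i))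
    {V : CochainComplex (ModuleCat.{u} S) ℤ} (hV : ∀ j, Module.Finite S (V.X j)) (n : ℤ) :
    Module.Finite R (((tensorFunctor O R S P).obj V).X n) := by
  obtain ⟨s, hs⟩ := hPb.exists_finset
  have h (i : ℤ) : Module.Finite R (actObj (P.X i) (V.X (n - i))) := finite_actObj (hP i) (hV _)
  -- Boundedness of `P` makes each term of the total complex a finite sum of images of M ⊗ V-terms,
  -- which are finitely generated.
  have h1 : (⊤ : Submodule R (((tensorFunctor O R S P).obj V).X n)) ≤
      ⨆ i ∈ s, LinearMap.range (totalOf.ι P V i (n - i) n (by lia)).hom := by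
    intro x _
    have h2 : (∑ i ∈ s, (totalOf.π P V i (n - i) n ≫ totalOf.ι P V i (n - i) n (by lia)).hom) x =
        x := by
      rw [← ModuleCat.hom_sum]
      exact congrArg (fun φ => φ.hom x) (totalOf.sum_proj_incl (actBifunctor O R S) P V s hs n)
    rw [← h2, LinearMap.sum_apply]
    exact Submodule.sum_mem _ fun i hi => Submodule.mem_iSup_of_mem i
      (Submodule.mem_iSup_of_mem hi ⟨_, rfl⟩)
  refine ⟨?_⟩
  rw [← top_le_iff.1 h1]
  refine Submodule.fg_biSup s _ fun i _ => ?_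
  rw [LinearMap.range_eq_map]
  exact (h i).fg_top.map _

theorem isBoundedComplex_tensorFunctor_obj {P : CochainComplex (BimodCat O R S) ℤ}
    (hP : IsBoundedComplex P) {V : CochainComplex (ModuleCat.{u} S) ℤ} (hV : IsBoundedComplex V) :
    IsBoundedComplex ((tensorFunctor O R S P).obj V) := by
  obtain ⟨a, ha⟩ := hP
  obtain ⟨b, hb⟩ := hV
  refine ⟨a + b, fun n hn => (IsZero.iff_id_eq_zero _).2 (totalOf.hom_ext fun i j h => ?_)⟩
  refine IsZero.eq_of_src (?_ : IsZero (((actBifunctor O R S).obj (P.X i)).obj (V.X j))) _ _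
  by_cases hi : (a : ℤ) < |i|
  · exact isZero_obj_of_isZero _ (ha i hi) _
  · refine Functor.map_isZero _ (hb j ?_)
    have := abs_add_le i j
    rw [h] at this
    push_cast at hn
    omega

/-- The restriction of `P ⊗_S -` to complexes of finitely generated modules. -/
def fgTensorFunctor [Module.Finite O S] (P : CochainComplex (BimodCat O R S) ℤ)
    (hPb : IsBoundedComplex P) (hP : ∀ i, Module.Finite O (P.X i)) :
    CochainComplex (FGModuleCat.{u} S) ℤ ⥤ CochainComplex (FGModuleCat.{u} R) ℤ :=
  liftFunctorObjectProperty (ModuleCat.isFG.{u} R)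
    ((ModuleCat.isFG.{u} S).ι.mapHomologicalComplex (ComplexShape.up ℤ) ⋙ tensorFunctor O R S P)
    fun K n => finite_tensorFunctor_obj_X hPb hP (V := ((ModuleCat.isFG.{u} S).ι.mapHomologicalComplex
      (ComplexShape.up ℤ)).obj K) (fun j => (K.X j).property) n

/-- `fgTensorFunctor` is the restriction of `P ⊗_S -`. -/
def fgTensorFunctorIso [Module.Finite O S] (P : CochainComplex (BimodCat O R S) ℤ)
    (hPb : IsBoundedComplex P) (hP : ∀ i, Module.Finite O (P.X i)) :
    fgTensorFunctor P hPb hP ⋙ (ModuleCat.isFG.{u} R).ι.mapHomologicalComplex (ComplexShape.up ℤ) ≅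
      (ModuleCat.isFG.{u} S).ι.mapHomologicalComplex (ComplexShape.up ℤ) ⋙ tensorFunctor O R S P :=
  liftFunctorObjectPropertyCompIso _ _ _

theorem IsBoundedComplex.of_ι {K : CochainComplex (FGModuleCat.{u} R) ℤ}
    (h : IsBoundedComplex
      (((ModuleCat.isFG.{u} R).ι.mapHomologicalComplex (ComplexShape.up ℤ)).obj K)) :
    IsBoundedComplex K := by
  obtain ⟨n, hn⟩ := h
  refine ⟨n, fun i hi => (IsZero.iff_id_eq_zero _).2
    ((ModuleCat.isFG.{u} R).ι.map_injective ((hn i hi).eq_of_src _ _))⟩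

theorem IsBoundedComplex.map {C D : Type*} [Category* C] [Category* D] [Preadditive C]
    [Preadditive D] (T : C ⥤ D) [T.Additive] {K : CochainComplex C ℤ} (h : IsBoundedComplex K) :
    IsBoundedComplex ((T.mapHomologicalComplex (ComplexShape.up ℤ)).obj K) := by
  obtain ⟨n, hn⟩ := h
  exact ⟨n, fun i hi => T.map_isZero (hn i hi)⟩

/-- Over a noetherian ring the embedding of finitely generated modules is exact and reflects
quasi-isomorphisms, so everything known for all modules descends. -/
theorem FGModuleCat.quasiIso_ι_map_iff [IsNoetherianRing R] {K L : CochainComplex (FGModuleCat.{u} R) ℤ}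
    (φ : K ⟶ L) : QuasiIso (((ModuleCat.isFG.{u} R).ι.mapHomologicalComplex
      (ComplexShape.up ℤ)).map φ) ↔ QuasiIso φ := by
  have : PreservesFiniteLimits (ModuleCat.isFG.{u} R).ι :=
    inferInstanceAs (PreservesFiniteLimits (forget₂ (FGModuleCat.{u} R) (ModuleCat.{u} R)))
  have : PreservesFiniteColimits (ModuleCat.isFG.{u} R).ι :=
    inferInstanceAs (PreservesFiniteColimits (forget₂ (FGModuleCat.{u} R) (ModuleCat.{u} R)))
  exact quasiIso_map_iff_of_preservesHomology φ (ModuleCat.isFG.{u} R).ι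

/-- The transformation of functors on complexes of finitely generated modules induced by a
transformation of functors on complexes of modules. -/
def fgCounit [Module.Finite O S] [Module.Finite O R] {P : CochainComplex (BimodCat O R S) ℤ}
    (hPb : IsBoundedComplex P) (hP : ∀ i, Module.Finite O (P.X i))
    {Q : CochainComplex (BimodCat O S R) ℤ}
    (hQb : IsBoundedComplex Q) (hQ : ∀ i, Module.Finite O (Q.X i))
    (c : tensorFunctor O S R Q ⋙ tensorFunctor O R S P ⟶ 𝟭 _) :
    fgTensorFunctor Q hQb hQ ⋙ fgTensorFunctor P hPb hP ⟶ 𝟭 _ where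
  app K :=
    { f := fun n => ObjectProperty.homMk ((c.app
        (((ModuleCat.isFG.{u} R).ι.mapHomologicalComplex (ComplexShape.up ℤ)).obj K)).f n)
      comm' := fun i j _ => ObjectProperty.hom_ext _ ((c.app
        (((ModuleCat.isFG.{u} R).ι.mapHomologicalComplex (ComplexShape.up ℤ)).obj K)).comm i j) }
  naturality K L φ := by
    ext n : 1
    exact ObjectProperty.hom_ext _ (congrArg (fun φ => φ.f n) (c.naturality
      (((ModuleCat.isFG.{u} R).ι.mapHomologicalComplex (ComplexShape.up ℤ)).map φ)))

theorem CornerComplexEmbedding.isBoundedComplex {ρ : CornerEmbedding O R e}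
    {σ : CornerEmbedding O S f} {P : CochainComplex (BimodCat O R S) ℤ}
    {M : CochainComplex (BimodCat O E F) ℤ} (j : CornerComplexEmbedding ρ σ P M)
    (hM : IsBoundedComplex M) : IsBoundedComplex P := by
  obtain ⟨n, hn⟩ := hM
  refine ⟨n, fun i hi => (IsZero.iff_id_eq_zero _).2 ?_⟩
  ext p
  refine (j.embedding i).injective ?_
  exact congrArg (fun φ => φ.hom ((j.embedding i).toHom p)) ((hn i hi).eq_of_src (𝟙 _) 0) |>.trans
    (map_zero (j.embedding i).toHom).symm

theorem CornerComplexEmbedding.induceDerivedEquivalence [IsNoetherianRing O] [Module.Finite O E]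
    [Module.Finite O F] [Module.Finite O R] [Module.Finite O S]
    {ρ : CornerEmbedding O R e} {σ : CornerEmbedding O S f}
    (hE : IsFrobeniusCorner O e) (hF : IsFrobeniusCorner O f)
    {M : CochainComplex (BimodCat O E F) ℤ} {N : CochainComplex (BimodCat O F E) ℤ}
    {P : CochainComplex (BimodCat O R S) ℤ} {Q : CochainComplex (BimodCat O S R) ℤ}
    (hMN : IsRickardEquivalence M N) (j : CornerComplexEmbedding ρ σ P M)
    (k : CornerComplexEmbedding σ ρ Q N) : InduceDerivedEquivalence P Q := by
  have : IsNoetherianRing R := IsNoetherianRing.of_finite O R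
  have : IsNoetherianRing S := IsNoetherianRing.of_finite O S
  letI := HasDerivedCategory.standard (FGModuleCat.{u} R)
  letI := HasDerivedCategory.standard (FGModuleCat.{u} S)
  -- The situation is symmetric in the two sides, so the same results also give the inverse functor.
  have hNM : IsRickardEquivalence N M :=
    ⟨hMN.bounded_right, hMN.bounded_left, hMN.projective_right, hMN.projective_left,
      hMN.homotopyEquiv_right, hMN.homotopyEquiv_left⟩
  have hPb := j.isBoundedComplex hMN.bounded_left
  have hQb := k.isBoundedComplex hMN.bounded_right
  have hP (i : ℤ) : Module.Finite O (P.X i) :=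
    (j.embedding i).finite (hMN.projective_left i).finite
  have hQ (i : ℤ) : Module.Finite O (Q.X i) :=
    (k.embedding i).finite (hMN.projective_right i).finite
  let G := fgTensorFunctor P hPb hP
  let H := fgTensorFunctor Q hQb hQ
  let U := (ModuleCat.isFG.{u} S).ι.mapHomologicalComplex (ComplexShape.up ℤ) ⋙
    tensorFunctor O R S P
  let _ : G.CommShift ℤ := commShiftLiftFunctorObjectProperty _ U _
  have : G.Additive := additive_liftFunctorObjectProperty _ U _
  have hG : PreservesDegreewiseSplit G := preservesDegreewiseSplit_liftFunctorObjectProperty _ U _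
    ((preservesDegreewiseSplit_mapHomologicalComplex _).comp
      (preservesDegreewiseSplit_tensorFunctor P))
  obtain ⟨c, hc⟩ := k.exists_counit j hF hE hNM
  obtain ⟨c', hc'⟩ := j.exists_counit k hE hF hMN
  have hGq ⦃K L : CochainComplex (FGModuleCat.{u} S) ℤ⦄ (φ : K ⟶ L) (hφ : QuasiIso φ) :
      QuasiIso (G.map φ) :=
    (FGModuleCat.quasiIso_ι_map_iff _).1 ((quasiIso_iff_of_natIso
      (fgTensorFunctorIso P hPb hP) φ).2 (j.quasiIso_tensorFunctor_map hE hF hMN _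
        ((FGModuleCat.quasiIso_ι_map_iff _).2 hφ)))
  have hHq ⦃K L : CochainComplex (FGModuleCat.{u} R) ℤ⦄ (φ : K ⟶ L) (hφ : QuasiIso φ) :
      QuasiIso (H.map φ) :=
    (FGModuleCat.quasiIso_ι_map_iff _).1 ((quasiIso_iff_of_natIso
      (fgTensorFunctorIso Q hQb hQ) φ).2 (k.quasiIso_tensorFunctor_map hF hE hNM _
        ((FGModuleCat.quasiIso_ι_map_iff _).2 hφ)))
  obtain ⟨Φ, hΦ, hΦt, ⟨α⟩, ⟨β⟩⟩ := exists_derivedEquivalence hG hGq hHq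
    (fgCounit hQb hQ hPb hP c) (fun K => (FGModuleCat.quasiIso_ι_map_iff _).1 (hc _))
    (fgCounit hPb hP hQb hQ c') (fun K => (FGModuleCat.quasiIso_ι_map_iff _).1 (hc' _))
  refine ⟨G, H, Φ, hΦ, ⟨fgTensorFunctorIso P hPb hP⟩, ⟨fgTensorFunctorIso Q hQb hQ⟩, hΦt, ⟨α⟩, ⟨β⟩,
    DerivedCategory.bounded_iff_of_equivalence Φ α β (fun K hK => ?_) (fun K hK => ?_)⟩
  · exact IsBoundedComplex.of_ι (isBoundedComplex_tensorFunctor_obj hPb (hK.map _))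
  · exact IsBoundedComplex.of_ι (isBoundedComplex_tensorFunctor_obj hQb (hK.map _))

end CornerDerived

/-! ### Corners of endomorphism algebras over symmetric algebras -/

section SymmetricForm

variable {O A : Type u} [CommRing O] [Ring A] [Algebra O A]

/-- A linear form `t` on `A` such that every linear form on `A` is `c ↦ t (c * a)` for a unique
element `a`. -/
def IsFrobeniusForm (t : A →ₗ[O] O) : Prop :=
  (∀ l : A →ₗ[O] O, ∃ a, ∀ c, t (c * a) = l c) ∧ ∀ a, (∀ c, t (c * a) = 0) → a = 0

variable (O A) in
-- The form is φ(1): bilinearity of the isomorphism gives φ(a)(c) = φ(1)(ca), so bijectivity of φ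
-- becomes the representability of forms.
theorem IsSymmetricOverBase.exists_isFrobeniusForm [IsSymmetricOverBase O A] :
    ∃ t : A →ₗ[O] O, IsFrobeniusForm t := by
  obtain ⟨φ, hφ⟩ := IsSymmetricOverBase.exists_bimodule_iso (O := O) (A := A)
  have h (a c : A) : φ 1 (c * a) = φ a c := by
    simpa using (hφ a 1 1 c).symm
  refine ⟨φ 1, fun l => ⟨φ.symm l, fun c => ?_⟩, fun a ha => φ.injective ?_⟩
  · rw [h, LinearEquiv.apply_symm_apply]
  · ext c
    rw [← h, ha, map_zero, LinearMap.zero_apply]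

variable {X : Type u} [AddCommGroup X] [Module O X] [Module A X] [IsScalarTower O A X]
variable {t : A →ₗ[O] O}

namespace IsFrobeniusForm

theorem eq_of_forall (ht : IsFrobeniusForm t) {a b : A} (h : ∀ c, t (c * a) = t (c * b)) : a = b :=
  sub_eq_zero.1 (ht.2 _ fun c => by rw [mul_sub, map_sub, h, sub_self])

/-- The value h(x) is the unique element with t(c h(x)) = η(cx) for all c. Uniqueness makes h linear
over `A`. -/
theorem exists_linearMap (ht : IsFrobeniusForm t) (η : X →ₗ[O] O) :
    ∃ h : X →ₗ[A] A, ∀ x, t (h x) = η x := by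
  choose h hh using fun x : X => ht.1 (η ∘ₗ (LinearMap.toSpanSingleton A X x).restrictScalars O)
  refine ⟨⟨⟨h, fun x y => ht.eq_of_forall fun c => ?_⟩, fun b x => ht.eq_of_forall fun c => ?_⟩,
    fun x => ?_⟩
  · rw [mul_add, map_add, hh, hh, hh]
    simp
  · change t (c * h (b • x)) = t (c * (b * h x))
    rw [← mul_assoc, hh, hh]
    simp [mul_smul]
  · simpa using hh x 1

theorem eq_zero_of_linearMap (ht : IsFrobeniusForm t) (h : X →ₗ[A] A) (hh : ∀ x, t (h x) = 0) :
    h = 0 := by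
  ext x
  refine ht.2 _ fun c => ?_
  rw [← smul_eq_mul, ← map_smul, hh]

/-- The isomorphism `Hom_A(X, A) ≅ Hom_O(X, O)` given by composition with `t`. -/
def dualEquiv (ht : IsFrobeniusForm t) : (X →ₗ[A] A) ≃ₗ[O] Module.Dual O X :=
  LinearEquiv.ofBijective
    { toFun := fun h => t ∘ₗ h.restrictScalars O
      map_add' := fun g h => by ext x; simp
      map_smul' := fun o h => by ext x; simp } (by
    constructor
    · rw [injective_iff_map_eq_zero]
      exact fun h hh => ht.eq_zero_of_linearMap h fun x => LinearMap.congr_fun hh x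
    · intro η
      obtain ⟨h, hh⟩ := ht.exists_linearMap η
      exact ⟨h, LinearMap.ext hh⟩)

theorem dualEquiv_apply (ht : IsFrobeniusForm t) (h : X →ₗ[A] A) (x : X) :
    ht.dualEquiv h x = t (h x) := rfl

/-- Through `dualEquiv` this is the reflexivity of `X` over `O`. -/
theorem exists_apply_eq (ht : IsFrobeniusForm t) [Module.Finite O X] [Module.Free O X]
    (l : (X →ₗ[A] A) →ₗ[O] O) : ∃ x, ∀ h, l h = t (h x) := by
  refine ⟨(Module.evalEquiv O X).symm (l ∘ₗ ht.dualEquiv.symm.toLinearMap), fun h => ?_⟩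
  rw [← ht.dualEquiv_apply, Module.apply_evalEquiv_symm_apply]
  simp

end IsFrobeniusForm

/-- A linear form on End_A(X) extends to End_O(X), where a basis of `X` gives the required shape.
The extension exists because End_A(X) is a direct summand of End_O(X) over `O`. -/
theorem exists_sum_dual_apply [IsDomain O] [IsPrincipalIdealRing O] [Module.Finite O X]
    [Module.Free O X] (l : Module.End A X →ₗ[O] O) :
    ∃ (n : ℕ) (η : Fin n → Module.Dual O X) (x : Fin n → X), ∀ c, l c = ∑ k, η k (c (x k)) := by
  let j : Module.End A X →ₗ[O] Module.End O X := LinearMap.restrictScalarsₗ O A X X O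
  have hj : Function.Injective j := LinearMap.restrictScalars_injective O
  -- If a nonzero multiple of an endomorphism is linear over `A`, so is the endomorphism, since `X`
  -- is torsion-free. The quotient is thus torsion-free and, over a principal ideal domain, free.
  have hfree : Module.Free O (Module.End O X ⧸ LinearMap.range j) := by
    have : Module.IsTorsionFree O (Module.End O X ⧸ LinearMap.range j) := by
      refine .of_smul_eq_zero fun o u hu => ?_
      obtain ⟨u, rfl⟩ := Submodule.mkQ_surjective _ u
      rw [or_iff_not_imp_left]
      intro ho
      obtain ⟨c, hc⟩ := (Submodule.Quotient.mk_eq_zero _).1 hu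
      have hu' (a : A) (x : X) : u (a • x) = a • u x := by
        refine smul_right_injective X ho ?_
        have h1 (y : X) : o • u y = c y := (LinearMap.congr_fun hc y).symm
        change o • u (a • x) = o • a • u x
        rw [h1, smul_comm, h1, map_smul]
      exact (Submodule.Quotient.mk_eq_zero _).2 ⟨{ u with map_smul' := hu' }, rfl⟩
    exact Module.free_of_finite_type_torsion_free'
  obtain ⟨q, hq⟩ := Module.projective_lifting_property (LinearMap.range j).mkQ LinearMap.id
    (Submodule.mkQ_surjective _)
  -- The retraction onto End_A(X) obtained by splitting off the quotient.
  let r : Module.End O X →ₗ[O] LinearMap.range j :=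
    (LinearMap.id - q ∘ₗ (LinearMap.range j).mkQ).codRestrict _ fun u => by
      rw [← Submodule.Quotient.mk_eq_zero]
      have := LinearMap.congr_fun hq ((LinearMap.range j).mkQ u)
      exact (map_sub (LinearMap.range j).mkQ u _).trans (sub_eq_zero.2 this.symm)
  let l' : Module.End O X →ₗ[O] O := l ∘ₗ (LinearEquiv.ofInjective j hj).symm.toLinearMap ∘ₗ r
  have hl' (c : Module.End A X) : l' (j c) = l c := by
    have h1 : r (j c) = LinearEquiv.ofInjective j hj c := Subtype.ext (by
      have h2 : (LinearMap.range j).mkQ (j c) = 0 := (Submodule.Quotient.mk_eq_zero _).2 ⟨c, rfl⟩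
      change j c - q ((LinearMap.range j).mkQ (j c)) = j c
      rw [h2, map_zero, sub_zero])
    change l ((LinearEquiv.ofInjective j hj).symm (r (j c))) = l c
    rw [h1, LinearEquiv.symm_apply_apply]
  let b := Module.finBasis O X
  refine ⟨_, fun k => l' ∘ₗ LinearMap.smulRightₗ (b.coord k), b, fun c => ?_⟩
  have h3 : j c = ∑ k, LinearMap.smulRightₗ (b.coord k) (c (b k)) := by
    ext x
    rw [LinearMap.sum_apply]
    change c x = ∑ k, b.repr x k • c (b k)
    refine (congrArg c (b.sum_repr x).symm).trans ?_
    rw [map_sum]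
    exact Finset.sum_congr rfl fun k _ => LinearMap.map_smul_of_tower c _ _
  rw [← hl', h3, map_sum]
  rfl

variable {e : Module.End A X} (θ : LinearMap.range e ≃ₗ[A] A)

/-- The endomorphism `y ↦ π(y) • x`, for the projection `π` of `X` to `e(X) ≅ A`. -/
def spanProj (θ : LinearMap.range e ≃ₗ[A] A) (x : X) : Module.End A X :=
  LinearMap.toSpanSingleton A X x ∘ₗ summandProj θ

theorem spanProj_summandIncl (he : IsIdempotentElem e) (x : X) :
    spanProj θ x (summandIncl θ 1) = x := by
  simp [spanProj, summandProj_summandIncl he]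

/-- The identification of Ee with X, given by be ↦ b(ι(1)), with inverse `spanProj`. -/
theorem mul_eq_spanProj (b : Module.End A X) : b * e = spanProj θ (b (summandIncl θ 1)) := by
  ext y
  rw [Module.End.mul_apply, ← summandIncl_summandProj θ]
  simp [spanProj, ← map_smul]

theorem apply_summandIncl (he : IsIdempotentElem e) (a : A) :
    e (summandIncl θ a) = summandIncl θ a := by
  rw [← summandIncl_summandProj θ, summandProj_summandIncl he]

/-- The form `c ↦ t (π (c (ι 1)))`. -/
def cornerForm (t : A →ₗ[O] O) (θ : LinearMap.range e ≃ₗ[A] A) : Module.End A X →ₗ[O] O where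
  toFun c := t (summandProj θ (c (summandIncl θ 1)))
  map_add' c d := by simp
  map_smul' o c := by simp [LinearMap.map_smul_of_tower]

/-- The homomorphism `x ↦ (y ↦ π(y) • x)`. -/
def spanProjₗ (θ : LinearMap.range e ≃ₗ[A] A) : X →ₗ[O] Module.End A X where
  toFun := spanProj θ
  map_add' x y := by ext; simp [spanProj]
  map_smul' o x := by ext y; exact smul_comm _ _ _

/-- Composition with the inclusion of `A ≅ e(X)` in `X`. -/
def compIncl (θ : LinearMap.range e ≃ₗ[A] A) : (X →ₗ[A] A) →ₗ[O] Module.End A X where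
  toFun h := summandIncl θ ∘ₗ h
  map_add' g h := by ext; simp
  map_smul' o h := by ext y; simp [LinearMap.map_smul_of_tower]

/-- The form `c ↦ η (c x)`. -/
def applyForm (η : X →ₗ[O] O) (x : X) : Module.End A X →ₗ[O] O where
  toFun c := η (c x)
  map_add' c d := by simp
  map_smul' o c := by simp

/-- Here Ee ≅ X and eE ≅ Hom_A(X, A), and the pairing becomes (h, x) ↦ t(h(x)), which identifies
Hom_A(X, A) with the dual of X. For the second condition each form η in `exists_sum_dual_apply` is
written as t ∘ h, and h factors through the summand A of X. -/
theorem isFrobeniusCorner_end [IsDomain O] [IsPrincipalIdealRing O] [Module.Finite O X]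
    [Module.Free O X] (ht : IsFrobeniusForm t) (he : IsIdempotentElem e)
    (θ : LinearMap.range e ≃ₗ[A] A) : IsFrobeniusCorner O e where
  exists_form := by
    have key (h : X →ₗ[A] A) (b : Module.End A X) :
        cornerForm t θ (summandIncl θ ∘ₗ h * b * e) = t (h (b (summandIncl θ 1))) := by
      change t (summandProj θ (summandIncl θ (h (b (e (summandIncl θ 1)))))) = _
      rw [summandProj_summandIncl he, apply_summandIncl θ he]
    refine ⟨cornerForm t θ, fun l => ?_, fun a hea ha => ?_⟩
    · obtain ⟨h, hh⟩ := ht.exists_linearMap (l ∘ₗ spanProjₗ θ)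
      refine ⟨summandIncl θ ∘ₗ h, ?_, fun b => ?_⟩
      · ext x
        exact apply_summandIncl θ he _
      · rw [key, hh, mul_eq_spanProj θ]
        rfl
    · have h1 : a = summandIncl θ ∘ₗ (summandProj θ ∘ₗ a) := by
        conv_lhs => rw [← hea]
        ext x
        exact (summandIncl_summandProj θ _).symm
      have h2 : summandProj θ ∘ₗ a = 0 := ht.eq_zero_of_linearMap _ fun x => by
        have := ha (spanProj θ x)
        rwa [h1, key, spanProj_summandIncl θ he] at this
      rw [h1, h2, LinearMap.comp_zero]
  exists_sum l := by
    obtain ⟨n, η, x, hl⟩ := exists_sum_dual_apply l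
    choose h hh using fun k => ht.exists_linearMap (η k)
    refine ⟨n, fun k => applyForm (t ∘ₗ (summandProj θ).restrictScalars O) (x k),
      fun k => summandIncl θ ∘ₗ h k, fun c => (hl c).trans (Finset.sum_congr rfl fun k _ => ?_)⟩
    change _ = t (summandProj θ (e (summandIncl θ (h k (c (x k))))))
    rw [apply_summandIncl θ he, summandProj_summandIncl he, hh]

/-- In Eᵒᵖ the modules eE and Ee change places, so X must be the dual of Hom_A(X, A); this is
reflexivity. The second condition is easier: η(c x) is the value at ι(1) of c followed after
`spanProj θ x`, so the vector `x` itself provides the factor. -/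
theorem isFrobeniusCorner_op_end [IsDomain O] [IsPrincipalIdealRing O] [Module.Finite O X]
    [Module.Free O X] (ht : IsFrobeniusForm t) (he : IsIdempotentElem e)
    (θ : LinearMap.range e ≃ₗ[A] A) : IsFrobeniusCorner O (op e) where
  exists_form := by
    have key (x : X) (b : Module.End A X) :
        cornerForm t θ (e * (b * spanProj θ x)) = t ((summandProj θ ∘ₗ b) x) := by
      change t (summandProj θ (e (b (spanProj θ x (summandIncl θ 1))))) = _
      rw [spanProj_summandIncl θ he, ← summandIncl_summandProj θ, summandProj_summandIncl he]
      rfl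
    have key' (b : Module.End A X) : e * b = compIncl (O := O) θ (summandProj θ ∘ₗ b) := by
      ext x
      exact (summandIncl_summandProj θ _).symm
    let opₗ : Module.End A X ≃ₗ[O] (Module.End A X)ᵐᵒᵖ := opLinearEquiv O
    refine ⟨cornerForm t θ ∘ₗ opₗ.symm.toLinearMap, fun l => ?_, fun a hea ha => ?_⟩
    · obtain ⟨x, hx⟩ := ht.exists_apply_eq (l ∘ₗ opₗ.toLinearMap ∘ₗ compIncl θ)
      refine ⟨op (spanProj θ x), ?_, fun b => ?_⟩
      · rw [← op_mul, mul_eq_spanProj θ, spanProj_summandIncl θ he]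
      · change cornerForm t θ (e * (b.unop * spanProj θ x)) = l (op (e * b.unop))
        rw [key, ← hx, key']
        rfl
    · have h1 : a = op (spanProj θ (a.unop (summandIncl θ 1))) := by
        rw [← mul_eq_spanProj θ, op_mul, op_unop, hea]
      have h2 : a.unop (summandIncl θ 1) = 0 := by
        rw [← Module.forall_dual_apply_eq_zero_iff O]
        intro η
        obtain ⟨h, hh⟩ := ht.exists_linearMap η
        have := ha (op (summandIncl θ ∘ₗ h))
        rw [h1] at this
        have h3 := (key (a.unop (summandIncl θ 1)) (summandIncl θ ∘ₗ h)).symm.trans this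
        rw [← hh, ← h3]
        simp [summandProj_summandIncl he]
      rw [h1, h2]
      exact congrArg op (map_zero (spanProjₗ (O := O) θ))
  exists_sum l := by
    obtain ⟨n, η, x, hl⟩ := exists_sum_dual_apply
      (l ∘ₗ (opLinearEquiv O : Module.End A X ≃ₗ[O] (Module.End A X)ᵐᵒᵖ).toLinearMap)
    refine ⟨n, fun k => applyForm (η k) (summandIncl θ 1) ∘ₗ (opLinearEquiv O :
      Module.End A X ≃ₗ[O] (Module.End A X)ᵐᵒᵖ).symm.toLinearMap, fun k => op (spanProj θ (x k)),
      fun c => (hl c.unop).trans (Finset.sum_congr rfl fun k _ => ?_)⟩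
    change _ = η k (c.unop (spanProj θ (x k) (e (summandIncl θ 1))))
    rw [apply_summandIncl θ he, spanProj_summandIncl θ he]

end SymmetricForm

/-! ### Bimodules over opposite algebras -/

namespace BimodCat

variable {O E F T : Type u} [CommRing O] [Ring E] [Algebra O E] [Ring F] [Algebra O F]
variable [Ring T] [Algebra O T]

variable (O E F) in
/-- The homomorphism `Fᵒᵖ ⊗ (Eᵒᵖ)ᵒᵖ → E ⊗ Fᵒᵖ`. -/
def flipAlgHom : Fᵐᵒᵖ ⊗[O] Eᵐᵒᵖᵐᵒᵖ →ₐ[O] E ⊗[O] Fᵐᵒᵖ :=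
  (Algebra.TensorProduct.map (AlgEquiv.opOp O E).symm.toAlgHom (AlgHom.id O Fᵐᵒᵖ)).comp
    (Algebra.TensorProduct.comm O Fᵐᵒᵖ Eᵐᵒᵖᵐᵒᵖ).toAlgHom

variable (O E F) in
/-- An `E`-`F`-bimodule, regarded as an `Fᵒᵖ`-`Eᵒᵖ`-bimodule. -/
def flipFunctor : BimodCat O E F ⥤ BimodCat O Fᵐᵒᵖ Eᵐᵒᵖ :=
  ModuleCat.restrictScalars (flipAlgHom O E F).toRingHom

instance : (flipFunctor O E F).Additive :=
  inferInstanceAs (ModuleCat.restrictScalars _).Additive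

/-- The flip of a bimodule. -/
abbrev flip (M : BimodCat O E F) : BimodCat O Fᵐᵒᵖ Eᵐᵒᵖ := (flipFunctor O E F).obj M

/-- A bimodule and its flip have the same elements. -/
def toFlip (M : BimodCat O E F) : M ≃+ flip M := AddEquiv.refl M

variable {M : BimodCat O E F}

theorem smul_toFlip (x : Fᵐᵒᵖ) (a : Eᵐᵒᵖᵐᵒᵖ) (m : M) :
    (x ⊗ₜ[O] a) • toFlip M m = toFlip M ((a.unop.unop ⊗ₜ[O] x) • m) := rfl


section FlipTensor

variable (M) (N : BimodCat O F T)

/-- The biadditive map `(n, m) ↦ m ⊗ n`. -/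
def flipTmul : flip N →+ flip M →+ flip (tensorObj M N) :=
  (((tmul M N).flip.comp (toFlip N).symm.toAddMonoidHom).compl₂
    (toFlip M).symm.toAddMonoidHom).compr₂ (toFlip (tensorObj M N)).toAddMonoidHom

theorem flipTmul_toFlip (m : M) (n : N) :
    flipTmul M N (toFlip N n) (toFlip M m) = toFlip _ (tmul M N m n) := by
  simp [flipTmul]

theorem flipTmul_smul (s : Fᵐᵒᵖ) (n : flip N) (m : flip M) :
    flipTmul M N (((1 : Tᵐᵒᵖ) ⊗ₜ[O] op s) • n) m = flipTmul M N n ((s ⊗ₜ[O] (1 : Eᵐᵒᵖᵐᵒᵖ)) • m) := by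
  obtain ⟨n, rfl⟩ := (toFlip N).surjective n
  obtain ⟨m, rfl⟩ := (toFlip M).surjective m
  rw [smul_toFlip, smul_toFlip, flipTmul_toFlip, flipTmul_toFlip]
  exact congrArg _ (tmul_smul s.unop m n).symm

/-- The map `n ⊗ m ↦ m ⊗ n`. -/
def flipTensorHomAdd : tensorObj (flip N) (flip M) →+ flip (tensorObj M N) :=
  tensorLiftAdd (flipTmul M N) (flipTmul_smul M N)

theorem flipTensorHomAdd_tmul (m : M) (n : N) :
    flipTensorHomAdd M N (tmul _ _ (toFlip N n) (toFlip M m)) = toFlip _ (tmul M N m n) :=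
  flipTmul_toFlip M N m n

/-- The biadditive map `(m, n) ↦ n ⊗ m`. -/
def flipTmulInv : M →+ N →+ tensorObj (flip N) (flip M) :=
  ((tmul (flip N) (flip M)).flip.comp (toFlip M).toAddMonoidHom).compl₂ (toFlip N).toAddMonoidHom

theorem flipTmulInv_smul (s : F) (m : M) (n : N) :
    flipTmulInv M N (((1 : E) ⊗ₜ[O] op s) • m) n = flipTmulInv M N m ((s ⊗ₜ[O] (1 : Tᵐᵒᵖ)) • n) :=
  (tmul_smul (op s) (toFlip N n) (toFlip M m)).symm

/-- The map `m ⊗ n ↦ n ⊗ m`. -/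
def flipTensorInvAdd : tensorObj M N →+ tensorObj (flip N) (flip M) :=
  tensorLiftAdd (flipTmulInv M N) (flipTmulInv_smul M N)

theorem flipTensorInvAdd_tmul (m : M) (n : N) :
    flipTensorInvAdd M N (tmul M N m n) = tmul _ _ (toFlip N n) (toFlip M m) := rfl

theorem flipTensorHomAdd_invAdd (x : tensorObj M N) :
    flipTensorHomAdd M N (flipTensorInvAdd M N x) = toFlip _ x := by
  induction x using tensor_induction with
  | add x y hx hy => rw [map_add, map_add, map_add, hx, hy]
  | tmul m n => rw [flipTensorInvAdd_tmul, flipTensorHomAdd_tmul]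

theorem flipTensorInvAdd_homAdd (x : tensorObj (flip N) (flip M)) :
    flipTensorInvAdd M N ((toFlip _).symm (flipTensorHomAdd M N x)) = x := by
  induction x using tensor_induction with
  | add x y hx hy => rw [map_add, map_add, map_add, hx, hy]
  | tmul n m =>
    obtain ⟨n, rfl⟩ := (toFlip N).surjective n
    obtain ⟨m, rfl⟩ := (toFlip M).surjective m
    rw [flipTensorHomAdd_tmul, AddEquiv.symm_apply_apply, flipTensorInvAdd_tmul]

theorem flipTensorHomAdd_smul (t : Tᵐᵒᵖ) (a : Eᵐᵒᵖᵐᵒᵖ) (x : tensorObj (flip N) (flip M)) :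
    flipTensorHomAdd M N ((t ⊗ₜ[O] a) • x) = (t ⊗ₜ[O] a) • flipTensorHomAdd M N x := by
  induction x using tensor_induction with
  | add x y hx hy => rw [smul_add, map_add, map_add, smul_add, hx, hy]
  | tmul n m =>
    obtain ⟨n, rfl⟩ := (toFlip N).surjective n
    obtain ⟨m, rfl⟩ := (toFlip M).surjective m
    rw [smul_tmul, smul_toFlip, smul_toFlip, flipTensorHomAdd_tmul, flipTensorHomAdd_tmul,
      smul_toFlip, smul_tmul]
    rfl

/-- The homomorphism `n ⊗ m ↦ m ⊗ n`. -/
def flipTensorHom : tensorObj (flip N) (flip M) ⟶ flip (tensorObj M N) :=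
  ModuleCat.ofHom (X := tensorObj (flip N) (flip M)) (Y := flip (tensorObj M N))
    (linearMapOfTmul (flipTensorHomAdd M N) (flipTensorHomAdd_smul M N))

instance : IsIso (flipTensorHom M N) :=
  (ConcreteCategory.isIso_iff_bijective _).2 (Function.bijective_iff_has_inverse.2
    ⟨fun x => flipTensorInvAdd M N ((toFlip _).symm x), flipTensorInvAdd_homAdd M N,
      fun x => (flipTensorHomAdd_invAdd M N _).trans (AddEquiv.apply_symm_apply _ _)⟩)

/-- The isomorphism `n ⊗ m ↦ m ⊗ n`. -/
def flipTensorIso : tensorObj (flip N) (flip M) ≅ flip (tensorObj M N) := asIso (flipTensorHom M N)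

variable {M N}

theorem flipTensorIso_naturality {M' : BimodCat O E F} {N' : BimodCat O F T} (φ : M ⟶ M')
    (ψ : N ⟶ N') :
    tensorMap ((flipFunctor O F T).map ψ) ((flipFunctor O E F).map φ) ≫ (flipTensorIso M' N').hom =
      (flipTensorIso M N).hom ≫ (flipFunctor O E T).map (tensorMap φ ψ) := by
  refine tensorObj_hom_ext fun n m => ?_
  obtain ⟨n, rfl⟩ := (toFlip N).surjective n
  obtain ⟨m, rfl⟩ := (toFlip M).surjective m
  refine (flipTensorHomAdd_tmul M' N' (φ.hom m) (ψ.hom n)).trans ?_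
  exact (congrArg ((flipFunctor O E T).map (tensorMap φ ψ)).hom
    (flipTensorHomAdd_tmul M N m n)).symm

end FlipTensor

variable (O E) in
/-- The identity map from the flip of the regular bimodule to the regular bimodule. -/
def flipRegularAdd : flip (regular O E) →+ regular O Eᵐᵒᵖ :=
  (toRegular O Eᵐᵒᵖ).comp (opAddEquiv (α := E)).toAddMonoidHom

theorem flipRegularAdd_smul (x : Eᵐᵒᵖ) (a : Eᵐᵒᵖᵐᵒᵖ) (r : flip (regular O E)) :
    flipRegularAdd O E ((x ⊗ₜ[O] a) • r) = (x ⊗ₜ[O] a) • flipRegularAdd O E r := by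
  have h1 := smul_toRegular (O := O) x a (op (show E from r))
  have h2 := smul_toRegular (O := O) a.unop.unop x (show E from r)
  refine Eq.trans ?_ h1.symm
  refine (congrArg (flipRegularAdd O E) h2).trans ?_
  exact congrArg (toRegular O Eᵐᵒᵖ) (unop_injective (mul_assoc _ _ _).symm)

variable (O E) in
/-- The identity map from the flip of the regular bimodule to the regular bimodule. -/
def flipRegularHom : flip (regular O E) ⟶ regular O Eᵐᵒᵖ :=
  ModuleCat.ofHom (X := flip (regular O E)) (Y := regular O Eᵐᵒᵖ)
    (linearMapOfTmul (flipRegularAdd O E) flipRegularAdd_smul)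

instance : IsIso (flipRegularHom O E) :=
  (ConcreteCategory.isIso_iff_bijective _).2 (opAddEquiv (α := E)).bijective

end BimodCat

/-! ### Rickard equivalences between opposite algebras -/

section FlipComplex

open Limits HomologicalComplex BimodCat

variable {O E F T : Type u} [CommRing O] [Ring E] [Algebra O E] [Ring F] [Algebra O F]
variable [Ring T] [Algebra O T]

/-- The flip of a complex of bimodules. -/
abbrev flipComplex (M : CochainComplex (BimodCat O E F) ℤ) :
    CochainComplex (BimodCat O Fᵐᵒᵖ Eᵐᵒᵖ) ℤ :=
  ((flipFunctor O E F).mapHomologicalComplex (ComplexShape.up ℤ)).obj M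

instance : (tensorBifunctor O E F T).flip.Additive where
  map_add := NatTrans.ext (funext fun M => ((tensorBifunctor O E F T).obj M).map_add)

instance (N : BimodCat O F T) : ((tensorBifunctor O E F T).flip.obj N).Additive where
  map_add {_ _ f g} := NatTrans.congr_app ((tensorBifunctor O E F T).map_add (f := f) (g := g)) N

variable (M : CochainComplex (BimodCat O E F) ℤ) (N : CochainComplex (BimodCat O F T) ℤ)

/-- The flip of a tensor product of complexes is the tensor product of the flips. -/
def flipTensorComplexIso (hN : IsBoundedComplex N) :
    tensorComplex O Tᵐᵒᵖ Fᵐᵒᵖ Eᵐᵒᵖ (flipComplex N) (flipComplex M) ≅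
      flipComplex (tensorComplex O E F T M N) :=
  totalOf.mapIso (F := (tensorBifunctor O E F T).flip) (F' := tensorBifunctor O Tᵐᵒᵖ Fᵐᵒᵖ Eᵐᵒᵖ)
    (G := flipFunctor O E T) (K₁ := N) (K₂ := M) (L₁ := flipComplex N) (L₂ := flipComplex M)
    (fun i j => flipTensorIso (M.X j) (N.X i))
    (fun i j => flipTensorIso_naturality (𝟙 (M.X j)) (N.d i (i + 1)))
    (fun i j => flipTensorIso_naturality (M.d j (j + 1)) (𝟙 (N.X i)))
    hN.exists_finset.choose hN.exists_finset.choose_spec ≪≫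
  -- Interchanging the two factors of a total complex involves signs, which this isomorphism takes
  -- care of.
  ((flipFunctor O E T).mapHomologicalComplex (ComplexShape.up ℤ)).mapIso
    (mapBifunctorFlipIso M N (tensorBifunctor O E F T) (ComplexShape.up ℤ))

variable (O E) in
/-- The flip of the regular bimodule, as a complex. -/
def flipRegularComplexIso : flipComplex (regularComplex O E) ≅ regularComplex O Eᵐᵒᵖ :=
  (singleMapHomologicalComplex (flipFunctor O E E) (ComplexShape.up ℤ) 0).app (regular O E) ≪≫
    (single _ (ComplexShape.up ℤ) 0).mapIso (asIso (flipRegularHom O E))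

attribute [local instance] leftModule rightModule

/-- The identity map from a left `E`-module to the right `Eᵒᵖ`-module it defines. -/
def rightFlipEquiv (M : BimodCat O E F) :
    letI := RingHomInvPair.of_ringEquiv (RingEquiv.opOp E)
    letI := RingHomInvPair.symm (RingEquiv.opOp E : E →+* Eᵐᵒᵖᵐᵒᵖ) (RingEquiv.opOp E).symm
    M ≃ₛₗ[(RingEquiv.opOp E : E →+* Eᵐᵒᵖᵐᵒᵖ)] BimodCat.flip M :=
  letI := RingHomInvPair.of_ringEquiv (RingEquiv.opOp E)
  letI := RingHomInvPair.symm (RingEquiv.opOp E : E →+* Eᵐᵒᵖᵐᵒᵖ) (RingEquiv.opOp E).symm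
  { toFlip M with
    map_smul' := fun _ _ => rfl }

theorem IsFGProjectiveBimod.flip {M : BimodCat O E F} (h : IsFGProjectiveBimod M) :
    IsFGProjectiveBimod (BimodCat.flip M) where
  left_finite := h.right_finite
  left_projective := h.right_projective
  right_finite := by
    letI := RingHomInvPair.of_ringEquiv (RingEquiv.opOp E)
    letI := RingHomInvPair.symm (RingEquiv.opOp E : E →+* Eᵐᵒᵖᵐᵒᵖ) (RingEquiv.opOp E).symm
    have := h.left_finite
    exact Module.Finite.of_surjective (rightFlipEquiv M).toLinearMap (rightFlipEquiv M).surjective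
  right_projective := by
    letI := RingHomInvPair.of_ringEquiv (RingEquiv.opOp E)
    letI := RingHomInvPair.symm (RingEquiv.opOp E : E →+* Eᵐᵒᵖᵐᵒᵖ) (RingEquiv.opOp E).symm
    have := h.left_projective
    exact Module.Projective.of_equiv (rightFlipEquiv M)

/-- Flipping reverses the order of tensor factors, so the two homotopy equivalences exchange their
roles. -/
theorem IsRickardEquivalence.flip {M : CochainComplex (BimodCat O E F) ℤ}
    {N : CochainComplex (BimodCat O F E) ℤ} (h : IsRickardEquivalence M N) :
    IsRickardEquivalence (flipComplex M) (flipComplex N) where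
  bounded_left := h.bounded_left.map _
  bounded_right := h.bounded_right.map _
  projective_left i := (h.projective_left i).flip
  projective_right i := (h.projective_right i).flip
  homotopyEquiv_left := h.homotopyEquiv_right.map fun α =>
    (HomotopyEquiv.ofIso (flipTensorComplexIso N M h.bounded_left)).trans
      (((flipFunctor O F F).mapHomotopyEquiv α).trans
        (HomotopyEquiv.ofIso (flipRegularComplexIso O F)))
  homotopyEquiv_right := h.homotopyEquiv_left.map fun α =>
    (HomotopyEquiv.ofIso (flipTensorComplexIso M N h.bounded_right)).trans
      (((flipFunctor O E E).mapHomotopyEquiv α).trans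
        (HomotopyEquiv.ofIso (flipRegularComplexIso O E)))

end FlipComplex

/-! ### The corners that occur in the two parts of the theorem -/

section CornerEmbeddings

open BimodCat

variable {O E F : Type u} [CommRing O] [Ring E] [Algebra O E] [Ring F] [Algebra O F]
variable {e : E} {f : F}

/-- The inclusion of `eEe` into `E`. -/
def cornerEmbedding (O : Type u) [CommRing O] [Algebra O E] (he : IsIdempotentElem e) :
    CornerEmbedding O he.Corner e where
  __ := cornerIncl O he
  map_mul' _ _ := rfl
  map_one' := rfl
  injective' := Subtype.val_injective
  exists_eq' x h h' := ⟨⟨x, (Subsemigroup.mem_corner_iff he).2 ⟨h, h'⟩⟩, rfl⟩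

/-- The inclusion of `eMf` into `M`. -/
def cornerBimodEmbedding (he : IsIdempotentElem e) (hf : IsIdempotentElem f)
    (M : BimodCat O E F) :
    CornerBimodEmbedding (cornerEmbedding O he) (cornerEmbedding O hf)
      ((cornerBimod O he hf).obj M) M where
  toHom := AddSubgroupClass.subtype (cornerSub e f M)
  map_smul r s p := cornerSub.coe_tmul_smul he hf M r (op s) p
  injective := Subtype.val_injective
  exists_eq m h := ⟨⟨m, cornerSub.mem_of_smul_eq h⟩, rfl⟩

/-- The inclusion of the complex `eMf` into `M`. -/
def cornerComplexEmbedding (he : IsIdempotentElem e) (hf : IsIdempotentElem f)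
    (M : CochainComplex (BimodCat O E F) ℤ) :
    CornerComplexEmbedding (cornerEmbedding O he) (cornerEmbedding O hf)
      (((cornerBimod O he hf).mapHomologicalComplex (ComplexShape.up ℤ)).obj M) M where
  embedding i := cornerBimodEmbedding he hf (M.X i)
  comm _ _ := rfl

variable {A B X Y : Type u} [Ring A] [Algebra O A] [Ring B] [Algebra O B]
variable [AddCommGroup X] [Module O X] [Module A X] [IsScalarTower O A X]
variable [AddCommGroup Y] [Module O Y] [Module B Y] [IsScalarTower O B Y]
variable {e : Module.End A X} {f : Module.End B Y}

/-- The embedding of `A ≅ (eEe)ᵒᵖ` into `Eᵒᵖ`, where `E = End_A(X)`. -/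
def opEndEmbedding (O : Type u) [CommRing O] [Algebra O A] [Module O X] [IsScalarTower O A X]
    (he : IsIdempotentElem e) (θ : LinearMap.range e ≃ₗ[A] A) : CornerEmbedding O A (op e) where
  __ := (opLinearEquiv O).toLinearMap ∘ₗ cornerIncl O he ∘ₗ
    (opEquivCorner O he θ).toLinearMap ∘ₗ (opLinearEquiv O).toLinearMap
  map_mul' r s := unop_injective
    (congrArg Subtype.val (map_mul (opEquivCorner O he θ) (op s) (op r)))
  map_one' := unop_injective (congrArg Subtype.val (map_one (opEquivCorner O he θ)))
  injective' := op_injective.comp <| Subtype.val_injective.comp <|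
    (opEquivCorner O he θ).injective.comp op_injective
  exists_eq' x h h' := by
    obtain ⟨r, hr⟩ := (opEquivCorner O he θ).surjective ⟨x.unop, (Subsemigroup.mem_corner_iff he).2
      ⟨op_injective h', op_injective h⟩⟩
    exact ⟨r.unop, unop_injective (congrArg Subtype.val hr)⟩

/-- The inclusion of `eMf` into `M`, regarded as a homomorphism of `B`-`A`-bimodules. -/
def cornerBimodOpEmbedding (he : IsIdempotentElem e) (θ : LinearMap.range e ≃ₗ[A] A)
    (hf : IsIdempotentElem f) (η : LinearMap.range f ≃ₗ[B] B)
    (M : BimodCat O (Module.End A X) (Module.End B Y)) :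
    CornerBimodEmbedding (opEndEmbedding O hf η) (opEndEmbedding O he θ)
      ((cornerBimodOp O he θ hf η).obj M) (flip M) where
  toHom := (toFlip M).toAddMonoidHom.comp (AddSubgroupClass.subtype (cornerSub e f M))
  map_smul b a p := cornerSub.coe_tmul_smul he hf M (opEquivCorner O he θ (op a))
    (op (opEquivCorner O hf η (op b))) p
  injective := (toFlip M).injective.comp Subtype.val_injective
  exists_eq m h := ⟨⟨m, cornerSub.mem_of_smul_eq h⟩, rfl⟩

/-- The inclusion of the complex `eMf` into `M`, regarded as a homomorphism of complexes of
`B`-`A`-bimodules. -/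
def cornerComplexOpEmbedding (he : IsIdempotentElem e) (θ : LinearMap.range e ≃ₗ[A] A)
    (hf : IsIdempotentElem f) (η : LinearMap.range f ≃ₗ[B] B)
    (M : CochainComplex (BimodCat O (Module.End A X) (Module.End B Y)) ℤ) :
    CornerComplexEmbedding (opEndEmbedding O hf η) (opEndEmbedding O he θ)
      (((cornerBimodOp O he θ hf η).mapHomologicalComplex (ComplexShape.up ℤ)).obj M)
      (flipComplex M) where
  embedding i := cornerBimodOpEmbedding he θ hf η (M.X i)
  comm _ _ := rfl

theorem IsIsoToDirectSummand.exists_isIdempotentElem (h : IsIsoToDirectSummand A A X) :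
    ∃ e : Module.End A X, IsIdempotentElem e ∧ Nonempty (LinearMap.range e ≃ₗ[A] A) := by
  obtain ⟨i, p, hpi⟩ := h
  have hpi' (a : A) : p (i a) = a := LinearMap.congr_fun hpi a
  -- Since p ∘ i = id, the composite is idempotent, and its image is that of the injective map `i`.
  refine ⟨i ∘ₗ p, LinearMap.ext fun x => congrArg i (hpi' (p x)), ⟨?_⟩⟩
  have hr : LinearMap.range (i ∘ₗ p) = LinearMap.range i :=
    LinearMap.range_comp_of_range_eq_top i (LinearMap.range_eq_top.2 fun a => ⟨i a, hpi' a⟩)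
  exact (LinearEquiv.ofEq _ _ hr).trans
    (LinearEquiv.ofInjective i (Function.LeftInverse.injective hpi')).symm

end CornerEmbeddings

end

/-! ### The theorem -/

theorem mainTheorem3
    (p : ℕ) [Fact p.Prime]
    (O : Type u) [CommRing O] [IsDomain O] [IsPrincipalIdealRing O] [IsLocalRing O]
    [IsAdicComplete (IsLocalRing.maximalIdeal O) O] [CharP (IsLocalRing.ResidueField O) p]
    (A B : Type u) [Ring A] [Algebra O A] [IsSymmetricOverBase O A]
    [Ring B] [Algebra O B] [IsSymmetricOverBase O B]
    (X : Type u) [AddCommGroup X] [Module O X] [Module A X] [IsScalarTower O A X]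
    [Module.Finite A X] [Module.Free O X]
    (Y : Type u) [AddCommGroup Y] [Module O Y] [Module B Y] [IsScalarTower O B Y]
    [Module.Finite B Y] [Module.Free O Y]
    (hAX : IsIsoToDirectSummand A A X) (hBY : IsIsoToDirectSummand B B Y)
    (M : CochainComplex (BimodCat O (Module.End A X) (Module.End B Y)) ℤ)
    (N : CochainComplex (BimodCat O (Module.End B Y) (Module.End A X)) ℤ)
    (hMN : IsRickardEquivalence M N) :
    (∃ e : Module.End A X, IsIdempotentElem e ∧ Nonempty (LinearMap.range e ≃ₗ[A] A)) ∧
    (∃ f : Module.End B Y, IsIdempotentElem f ∧ Nonempty (LinearMap.range f ≃ₗ[B] B)) ∧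
    ∀ (e : Module.End A X) (he : IsIdempotentElem e) (θ : LinearMap.range e ≃ₗ[A] A)
      (f : Module.End B Y) (hf : IsIdempotentElem f) (η : LinearMap.range f ≃ₗ[B] B),
      InduceDerivedEquivalence
        (((cornerBimod O he hf).mapHomologicalComplex (ComplexShape.up ℤ)).obj M)
        (((cornerBimod O hf he).mapHomologicalComplex (ComplexShape.up ℤ)).obj N) ∧
      InduceDerivedEquivalence
        (((cornerBimodOp O he θ hf η).mapHomologicalComplex (ComplexShape.up ℤ)).obj M)
        (((cornerBimodOp O hf η he θ).mapHomologicalComplex (ComplexShape.up ℤ)).obj N) := by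
  have : Module.Finite O X := Module.Finite.trans A X
  have : Module.Finite O Y := Module.Finite.trans B Y
  obtain ⟨s, hs⟩ := IsSymmetricOverBase.exists_isFrobeniusForm O A
  obtain ⟨t, ht⟩ := IsSymmetricOverBase.exists_isFrobeniusForm O B
  refine ⟨hAX.exists_isIdempotentElem, hBY.exists_isIdempotentElem, fun e he θ f hf η => ⟨?_, ?_⟩⟩
  · exact CornerComplexEmbedding.induceDerivedEquivalence (isFrobeniusCorner_end hs he θ)
      (isFrobeniusCorner_end ht hf η) hMN (cornerComplexEmbedding he hf M)
      (cornerComplexEmbedding hf he N)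
  -- Over the opposite algebras the corner at `op f` acts on the left, so the data of `f` come
  -- first.
  · exact CornerComplexEmbedding.induceDerivedEquivalence (isFrobeniusCorner_op_end ht hf η)
      (isFrobeniusCorner_op_end hs he θ) hMN.flip (cornerComplexOpEmbedding he θ hf η M)
      (cornerComplexOpEmbedding hf η he θ N)
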